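/- Let a null horizon be given: a family of lightrays labelled by $x\in X$, where $X$ carries a $\sigma$-finite measure $d^2x$; each ray is an open interval with parameter $\lambda$, and $\sqrt{\gamma(\lambda,x)}>0$ is the area density, $\gamma$ being $C^1$ in $\lambda$. Let $u$ be any null coordinate, increasing and $C^1$ (with $C^1$ inverse) along every ray, with range $-\infty<u<\infty$. For a field $\varphi$ put $\phi=\gamma^{1/4}\varphi$; the symplectic form is $\Omega(\varphi_1,\varphi_2)=\int d^2x\,d\lambda\,\sqrt\gamma\,(\varphi_1\partial_\lambda\varphi_2-\varphi_2\partial_\lambda\varphi_1)$. Test fields are the fields for which $\phi(u,x)$ is measurable, smooth in $u$, with $u$-support in a fixed compact set (contained in $(0,\infty)$ for fields on the half-horizon $u>0$), and with $\phi,\partial_u\phi,\partial_u^2\phi$ dominated by an $L^2$ function of $x$. For $f$ with rescaled field $\phi$, put $a_f(\omega,x)=\sqrt{2\omega}\int du\,e^{i\omega u}\phi(u,x)$ and, if $f$ lives on $u>0$, with $\tau=\ln u$, $a_{\tau,f}(\Omega,x)=\sqrt{2\Omega}\int d\tau\,e^{i\Omega\tau}\phi(e^\tau,x)$. On the bosonic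 Fock space over $L^2\big((0,\infty)\times X,\tfrac{d\omega}{2\pi}d^2x\big)$, with creation and annihilation operators $\hat a^\dagger,\hat a$, let $$W_u(f)=\exp\Big(i\int d^2x\,\tfrac{d\omega}{2\pi}\,(i a_f\hat a^\dagger+\text{h.c.})\Big)$$ and define $W_\tau(f)$ in the same way from $a_{\tau,f}$; these operators represent $\exp(i\Omega(f,\hat\varphi))$. In the $\tau$-Fock space (the Hilbert space of the half-horizon) let $\hat N$ be the number operator and $\hat H=\int d^2x\frac{d\Omega}{2\pi}\,\Omega\,\hat a_\tau^\dagger\hat a_\tau$. Let $\alpha_t$ be the translation $\phi(\tau)\mapsto\phi(\tau-t)$ of fields on $u>0$. A vacuum wavefunctional is a nonzero functional $\Psi[\phi_-]$ of the $u$-odd fields (given by their values at $u>0$, which form a half-horizon test field), differentiable along lines, that is annihilated by all lowering operators $\hat a(\omega,x)=\frac{i}{\sqrt2}\big(2\pi\frac{\delta}{\delta g(\omega,x)}+g(\omega,x)\big)$ (smeared with the $g$ of $u$-odd fields), $g(\omega,x)=2\sqrt\omega\int_{-\infty}^\infty du\,\sin(\omega u)\,\phi_-(u,x)$. For a functional $\Psi$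 on the half-horizon's phase space and a finite-dimensional symplectic subspace $V$ of that phase space (finitely many modes; phase-space points are identified when they differ by an element of the kernel of $\Omega$), write $\Psi|_V[\varphi]=\int_V dr\,c_V(r)\,e^{i\Omega(r,\varphi)}$ (up to normalization) and let $\hat\Psi_V=\int_V dr\,c_V(r)\,W_\tau(r)$ be its Weyl quantization. A Wigner–Weyl transform of $\Psi$ is a nonzero bounded operator $\hat\Psi$ on the $\tau$-Fock space such that, for suitable normalization constants $n_V$ not depending on the vectors, all matrix elements of $n_V\hat\Psi_V$ between coherent (exponential) vectors converge to those of $\hat\Psi$ as $V$ grows. The recipe for restricting a state to $u>0$ replaces $\phi_-\to\phi$ in its wavefunctional, takes the Wigner–Weyl transform $\hat\Psi$, and forms the (unnormalized) density operator $\hat\rho=\hat\Psi\hat\Psi^\dagger$. Then: 1. $W_u(f)W_u(g)=e^{-\frac i2\Omega(f,g)}W_u(f+g)$ for all test fields $f,g$ on the horizon, $W_\tau(f)W_\tau(g)=e^{-\frac i2\Omega(f,g)}W_\tau(f+g)$ for all test fields on $u>0$, and $e^{it\hat H}W_\tau(f)e^{-it\hat H}=W_\tau(\alpha_tf)$ for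 all real $t$. 2. A vacuum wavefunctional exists. Every vacuum wavefunctional, with $\phi_-$ replaced by $\phi$ on $u>0$, has a Wigner–Weyl transform, and each of its Wigner–Weyl transforms is $$\hat\Psi=k\,(-1)^{\hat N}e^{-\pi\hat H}\qquad\text{for some complex }k\neq0,$$ so that $\hat\rho=\hat\Psi\hat\Psi^\dagger=|k|^2e^{-2\pi\hat H}$. 3. The state given by the recipe is the restriction of the $u$-vacuum $|0_u\rangle$: for every $f$ on $u>0$, the expectation values $\operatorname{Tr}\big(\hat\Psi_V\hat\Psi_V^\dagger W(f)\big)/\operatorname{Tr}\big(\hat\Psi_V\hat\Psi_V^\dagger\big)$ in the finite-mode systems $V\ni f$ converge to $\langle 0_u|W_u(f)|0_u\rangle$ as $V$ grows. (These traces are those of the irreducible representation of the Weyl relations of $V$.) 4. This state is thermal with temperature $1/2\pi$ with respect to $\tau=\ln u$: for all $f$ on $u>0$, $$\langle0_u|W_u(f)|0_u\rangle=\exp\Big(-\tfrac12\int d^2x\,\tfrac{d\Omega}{2\pi}\Big(1+\tfrac{2}{e^{2\pi\Omega}-1}\Big)|a_{\tau,f}(\Omega,x)|^2\Big),$$ and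 it satisfies the KMS condition at inverse temperature $2\pi$ for $\alpha_t$: for all $f,g$ on $u>0$ there is a function $G$, bounded and continuous on $0\le\operatorname{Im}z\le2\pi$ and holomorphic inside, with $G(t)=\langle0_u|W_u(f)W_u(\alpha_tg)|0_u\rangle$ and $G(t+2\pi i)=\langle0_u|W_u(\alpha_tg)W_u(f)|0_u\rangle$ for all real $t$. -/

import Mathlib

noncomputable section

namespace Unruh

open MeasureTheory Complex Real

section Fock

variable {M : Type*} [MeasurableSpace M] (ν : Measure M) [SigmaFinite ν]

/-- The direct sum over `n` of the spaces of square-integrable `n`-particle wavefunctions. -/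
abbrev FullFock : Type _ := lp (fun n : ℕ => Lp ℂ 2 (Measure.pi fun _ : Fin n => ν)) 2

variable {ν}

/-- The function `(p₁, …, pₙ) ↦ z(p₁) ⋯ z(pₙ)`. -/
def prodFun (z : Lp ℂ 2 ν) (n : ℕ) : (Fin n → M) → ℂ := fun p => ∏ i, z (p i)

theorem memLp_prodFun (z : Lp ℂ 2 ν) (n : ℕ) :
    MemLp (prodFun z n) 2 (Measure.pi fun _ : Fin n => ν) := by
  have hm : AEStronglyMeasurable (prodFun z n) (Measure.pi fun _ : Fin n => ν) :=
    Finset.aestronglyMeasurable_fun_prod _ fun i _ =>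
      (Lp.aestronglyMeasurable z).comp_quasiMeasurePreserving
        (Measure.quasiMeasurePreserving_eval _ i)
  rw [memLp_two_iff_integrable_sq_norm hm]
  have h := Integrable.fintype_prod (ι := Fin n) (μ := fun _ => ν)
    (f := fun _ (x : M) => ‖z x‖ ^ 2)
    (fun _ => (memLp_two_iff_integrable_sq_norm (Lp.aestronglyMeasurable z)).1 (Lp.memLp z))
  refine h.congr (Filter.Eventually.of_forall fun p => ?_)
  simp [prodFun, Finset.prod_pow]

/-- The `n`-particle component `z ⊗ ⋯ ⊗ z / √(n!)` of the exponential vector of `z`. -/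
def expComponent (z : Lp ℂ 2 ν) (n : ℕ) : Lp ℂ 2 (Measure.pi fun _ : Fin n => ν) :=
  ((√(n.factorial : ℝ))⁻¹ : ℂ) • (memLp_prodFun z n).toLp

theorem inner_expComponent (z w : Lp ℂ 2 ν) (n : ℕ) :
    inner ℂ (expComponent z n) (expComponent w n) = (inner ℂ z w) ^ n / n.factorial := by
  have h1 : inner ℂ (memLp_prodFun z n).toLp (memLp_prodFun w n).toLp = (inner ℂ z w) ^ n := by
    rw [L2.inner_def, L2.inner_def]
    have : (∫ p : Fin n → M, ∏ i, inner ℂ (z (p i)) (w (p i)) ∂(Measure.pi fun _ => ν)) =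
        ∏ _i : Fin n, ∫ x, inner ℂ (z x) (w x) ∂ν :=
      integral_fintype_prod_eq_prod (fun _ x => inner ℂ (z x) (w x))
    rw [Finset.prod_const, Finset.card_univ, Fintype.card_fin] at this
    rw [← this]
    refine integral_congr_ae ?_
    filter_upwards [(memLp_prodFun z n).coeFn_toLp, (memLp_prodFun w n).coeFn_toLp] with p hp hq
    rw [hp, hq]
    simp [prodFun, Finset.prod_mul_distrib]
  have hs : ((√(n.factorial : ℝ) : ℝ) : ℂ) * (√(n.factorial : ℝ) : ℝ) = n.factorial := by
    rw [← ofReal_mul, Real.mul_self_sqrt (by positivity)]; simp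
  rw [expComponent, expComponent, inner_smul_left, inner_smul_right, h1, map_inv₀, conj_ofReal,
    ← mul_assoc, ← mul_inv, hs, div_eq_inv_mul]

theorem memlp_expComponent (z : Lp ℂ 2 ν) : Memℓp (expComponent z) 2 := by
  rw [memℓp_gen_iff (by norm_num)]
  have h : ∀ n, ‖expComponent z n‖ ^ (2 : ENNReal).toReal = (‖z‖ ^ 2) ^ n / n.factorial := by
    intro n
    have h2 := inner_expComponent z z n
    rw [inner_self_eq_norm_sq_to_K, inner_self_eq_norm_sq_to_K] at h2
    norm_num
    rw [← ofReal_inj]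
    push_cast
    exact h2
  simp_rw [h]
  exact Real.summable_pow_div_factorial _

/-- The exponential vector `e(z) = ∑ₙ z ⊗ ⋯ ⊗ z / √(n!) = exp(a†(z)) |0⟩`. -/
def fullExpVec (z : Lp ℂ 2 ν) : FullFock ν := ⟨expComponent z, memlp_expComponent z⟩

theorem inner_fullExpVec (z w : Lp ℂ 2 ν) :
    inner ℂ (fullExpVec z) (fullExpVec w) = Complex.exp (inner ℂ z w) := by
  rw [lp.inner_eq_tsum, Complex.exp_eq_exp_ℂ, NormedSpace.exp_eq_tsum_div]
  exact tsum_congr fun n => inner_expComponent z w n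

variable (ν)

/-- The bosonic Fock space over `L²(M, ν)`: the closed linear span of the exponential vectors,
i.e. the permutation-symmetric part of the full Fock space. -/
def fockSubmodule : Submodule ℂ (FullFock ν) :=
  (Submodule.span ℂ (Set.range (fullExpVec (ν := ν)))).topologicalClosure

def BoseFock : Type _ := fockSubmodule ν

instance : NormedAddCommGroup (BoseFock ν) :=
  inferInstanceAs (NormedAddCommGroup (fockSubmodule ν))

instance : InnerProductSpace ℂ (BoseFock ν) :=
  inferInstanceAs (InnerProductSpace ℂ (fockSubmodule ν))

instance : CompleteSpace (BoseFock ν) :=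
  (Submodule.isClosed_topologicalClosure _).completeSpace_coe

variable {ν}

/-- The exponential vector `e(z)`, as an element of the bosonic Fock space. -/
def expVec (z : Lp ℂ 2 ν) : BoseFock ν :=
  ⟨fullExpVec z, Submodule.le_topologicalClosure _ (Submodule.subset_span ⟨z, rfl⟩)⟩

/-- The Fock vacuum. -/
def vac : BoseFock ν := expVec 0

theorem inner_expVec (z w : Lp ℂ 2 ν) :
    inner ℂ (expVec z) (expVec w) = Complex.exp (inner ℂ z w) :=
  inner_fullExpVec z w

theorem denseRange_expVec :
    DenseRange (Finsupp.linearCombination ℂ (expVec (ν := ν))) := by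
  rw [DenseRange, ← LinearMap.coe_range, Finsupp.range_linearCombination]
  intro x
  refine (closure_subtype (p := (· ∈ fockSubmodule ν))).2 ?_
  have hx : x.1 ∈ fockSubmodule ν := x.2
  unfold fockSubmodule at hx
  rw [← SetLike.mem_coe, Submodule.topologicalClosure_coe] at hx
  refine closure_mono ?_ hx
  have h : (Submodule.span ℂ (Set.range (expVec (ν := ν)))).map (fockSubmodule ν).subtype =
      Submodule.span ℂ (Set.range (fullExpVec (ν := ν))) := by
    erw [Submodule.map_span, ← Set.range_comp]; rfl
  rw [← h]
  exact subset_rfl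

/-- The vector `exp(i(a(ξ) + a†(ξ))) e(w)`. -/
def weylVec (ξ w : Lp ℂ 2 ν) : BoseFock ν :=
  Complex.exp (-(‖ξ‖ ^ 2 / 2 : ℝ) + I * inner ℂ ξ w) • expVec (w + I • ξ)

theorem inner_weylVec (ξ z w : Lp ℂ 2 ν) :
    inner ℂ (weylVec ξ z) (weylVec ξ w) = inner ℂ (expVec z) (expVec w) := by
  have h : inner ℂ ξ ξ = ((‖ξ‖ ^ 2 : ℝ) : ℂ) := by
    rw [inner_self_eq_norm_sq_to_K]; norm_cast
  rw [weylVec, weylVec, inner_smul_left, inner_smul_right, inner_expVec, inner_expVec,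
    ← Complex.exp_conj, ← Complex.exp_add, ← Complex.exp_add]
  congr 1
  simp only [inner_add_left, inner_add_right, inner_smul_left, inner_smul_right, map_add, map_neg,
    map_mul, conj_I, conj_ofReal, inner_conj_symm, h]
  push_cast
  linear_combination (-(‖ξ‖ : ℂ) ^ 2) * I_mul_I

theorem norm_linearCombination_weylVec (ξ : Lp ℂ 2 ν) (c : Lp ℂ 2 ν →₀ ℂ) :
    ‖Finsupp.linearCombination ℂ (weylVec ξ) c‖ = ‖Finsupp.linearCombination ℂ expVec c‖ := by
  have h : inner ℂ (Finsupp.linearCombination ℂ (weylVec ξ) c)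
      (Finsupp.linearCombination ℂ (weylVec ξ) c) =
      inner ℂ (Finsupp.linearCombination ℂ expVec c)
      (Finsupp.linearCombination ℂ expVec c) := by
    simp only [Finsupp.linearCombination_apply, Finsupp.sum, sum_inner, inner_sum,
      inner_smul_left, inner_smul_right, inner_weylVec]
  rw [inner_self_eq_norm_sq_to_K, inner_self_eq_norm_sq_to_K] at h
  have h' : ‖Finsupp.linearCombination ℂ (weylVec ξ) c‖ ^ 2 =
    ‖Finsupp.linearCombination ℂ expVec c‖ ^ 2 := by exact_mod_cast h
  exact (sq_eq_sq₀ (norm_nonneg _) (norm_nonneg _)).1 h'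

/-- The Weyl operator `exp(i(a(ξ) + a†(ξ)))` on the bosonic Fock space: the isometry with
`e(w) ↦ exp(-‖ξ‖²/2 + i⟪ξ, w⟫) e(w + iξ)` for all `w`. -/
def fockWeyl (ξ : Lp ℂ 2 ν) : BoseFock ν →L[ℂ] BoseFock ν :=
  (Finsupp.linearCombination ℂ (weylVec ξ)).extendOfNorm
    (Finsupp.linearCombination ℂ (expVec (ν := ν)))

theorem fockWeyl_expVec (ξ w : Lp ℂ 2 ν) :
    fockWeyl ξ (expVec w) =
      Complex.exp (-(‖ξ‖ ^ 2 / 2 : ℝ) + I * inner ℂ ξ w) • expVec (w + I • ξ) := by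
  have h := LinearMap.extendOfNorm_eq (f := Finsupp.linearCombination ℂ (weylVec ξ))
    (denseRange_expVec (ν := ν))
    ⟨1, fun c => by rw [norm_linearCombination_weylVec, one_mul]⟩ (Finsupp.single w 1)
  simpa [fockWeyl, weylVec] using h

end Fock
section Fields

variable {X : Type*} [MeasurableSpace X]

theorem smooth_deriv {f : ℝ → ℝ} (hf : ContDiff ℝ (⊤ : ℕ∞) f) :
    Differentiable ℝ f ∧ ContDiff ℝ (⊤ : ℕ∞) (deriv f) :=
  contDiff_infty_iff_deriv.1 hf

/-- Test fields with respect to a null coordinate with values in `U`: measurable functions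
`φ(x, u)`, smooth in `u`, supported in `K` for a compact `K ⊆ U`, and whose first two
`u`-derivatives are dominated by a square-integrable function of the ray label `x`. -/
def testFields (μ : Measure X) (U : Set ℝ) : Submodule ℝ (X → ℝ → ℝ) where
  carrier := {φ | Measurable (Function.uncurry φ) ∧ (∀ x, ContDiff ℝ (⊤ : ℕ∞) (φ x)) ∧
    (∃ K, IsCompact K ∧ K ⊆ U ∧ ∀ x, ∀ u ∉ K, φ x u = 0) ∧
    ∃ C : X → ℝ, MemLp C 2 μ ∧ ∀ x u,
      |φ x u| ≤ C x ∧ |deriv (φ x) u| ≤ C x ∧ |deriv (deriv (φ x)) u| ≤ C x}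
  zero_mem' := by
    refine ⟨measurable_const, fun x => contDiff_const, ⟨∅, isCompact_empty, by simp, ?_⟩,
      0, MemLp.zero, fun x u => ?_⟩
    · intro x u _; rfl
    · have h : deriv ((0 : X → ℝ → ℝ) x) = 0 := by ext v; simp
      rw [h]; simp
  add_mem' := by
    rintro φ ψ ⟨hm, hs, ⟨K, hK, hKU, hz⟩, C, hC, hb⟩ ⟨hm', hs', ⟨K', hK', hKU', hz'⟩, C', hC', hb'⟩
    refine ⟨hm.add hm', fun x => (hs x).add (hs' x), ⟨K ∪ K', hK.union hK',
      Set.union_subset hKU hKU', ?_⟩, C + C', hC.add hC', fun x u => ?_⟩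
    · intro x u hu
      have h := fun h => hu (Or.inl h)
      have h' := fun h => hu (Or.inr h)
      simp [hz x u h, hz' x u h']
    · have d : ∀ v, deriv ((φ + ψ) x) v = deriv (φ x) v + deriv (ψ x) v := fun v =>
        deriv_add (((hs x).differentiable (by simp)) v) (((hs' x).differentiable (by simp)) v)
      have e : deriv ((φ + ψ) x) = fun v => deriv (φ x) v + deriv (ψ x) v := funext d
      have d2 : deriv (deriv ((φ + ψ) x)) u = deriv (deriv (φ x)) u + deriv (deriv (ψ x)) u := by
        rw [e]
        exact deriv_add ((smooth_deriv (smooth_deriv (hs x)).2).1 u)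
          ((smooth_deriv (smooth_deriv (hs' x)).2).1 u)
      obtain ⟨h0, h1, h2⟩ := hb x u
      obtain ⟨h0', h1', h2'⟩ := hb' x u
      rw [d2, d u]
      exact ⟨(abs_add_le _ _).trans (add_le_add h0 h0'), (abs_add_le _ _).trans (add_le_add h1 h1'),
        (abs_add_le _ _).trans (add_le_add h2 h2')⟩
  smul_mem' := by
    rintro c φ ⟨hm, hs, ⟨K, hK, hKU, hz⟩, C, hC, hb⟩
    refine ⟨hm.const_smul c, fun x => (hs x).const_smul c, ⟨K, hK, hKU, ?_⟩,
      |c| • C, hC.const_smul _, fun x u => ?_⟩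
    · intro x u hu
      simp [hz x u hu]
    · have e : deriv ((c • φ) x) = fun v => c * deriv (φ x) v := by
        ext v
        exact deriv_const_mul c (((hs x).differentiable (by simp)) v)
      have d2 : deriv (deriv ((c • φ) x)) u = c * deriv (deriv (φ x)) u := by
        rw [e]
        exact deriv_const_mul c ((smooth_deriv (smooth_deriv (hs x)).2).1 u)
      obtain ⟨h0, h1, h2⟩ := hb x u
      rw [d2, e]
      simp only [Pi.smul_apply, smul_eq_mul, abs_mul]
      exact ⟨mul_le_mul_of_nonneg_left h0 (abs_nonneg c),
        mul_le_mul_of_nonneg_left h1 (abs_nonneg c), mul_le_mul_of_nonneg_left h2 (abs_nonneg c)⟩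

theorem testFields_mono (μ : Measure X) {U V : Set ℝ} (h : U ⊆ V) :
    testFields μ U ≤ testFields μ V := by
  rintro φ ⟨hm, hs, ⟨K, hK, hKU, hz⟩, hb⟩
  exact ⟨hm, hs, ⟨K, hK, hKU.trans h, hz⟩, hb⟩

/-- The measure `dω/2π d²x` on the labels `(ω, x)`, `ω > 0`, of the modes. -/
def modeMeasure (μ : Measure X) : Measure (ℝ × X) :=
  ((1 / (2 * π)).toNNReal • volume.restrict (Set.Ioi 0)).prod μ

instance (μ : Measure X) [SigmaFinite μ] : SigmaFinite (modeMeasure μ) := by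
  unfold modeMeasure
  infer_instance

/-- The classical oscillator amplitudes `a(ω, x) = √(2ω) ∫ du e^{iωu} φ(u, x)`. -/
def amplitude (φ : X → ℝ → ℝ) (p : ℝ × X) : ℂ :=
  √(2 * p.1) * ∫ u : ℝ, Complex.exp (I * p.1 * u) * φ p.2 u

theorem integrable_exp_mul {f : ℝ → ℝ} (hf : Continuous f) {K : Set ℝ} (hK : IsCompact K)
    (hz : ∀ u ∉ K, f u = 0) (ω : ℝ) :
    Integrable fun u : ℝ => Complex.exp (I * ω * u) * f u := by
  refine Continuous.integrable_of_hasCompactSupport (by fun_prop) ?_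
  refine HasCompactSupport.intro hK fun u hu => ?_
  simp [hz u hu]

theorem integral_exp_mul_deriv {f : ℝ → ℝ} (hf : ContDiff ℝ 1 f) {K : Set ℝ} (hK : IsCompact K)
    (hz : ∀ u ∉ K, f u = 0) (hz' : ∀ u ∉ K, deriv f u = 0) (ω : ℝ) :
    ∫ u : ℝ, Complex.exp (I * ω * u) * (deriv f u : ℝ) =
      -(I * ω) * ∫ u : ℝ, Complex.exp (I * ω * u) * f u := by
  have hd : Continuous (deriv f) := hf.continuous_deriv le_rfl
  have hu : ∀ u : ℝ, HasDerivAt (fun u : ℝ => Complex.exp (I * ω * u))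
      (I * ω * Complex.exp (I * ω * u)) u := by
    intro u
    have h1 : HasDerivAt (fun u : ℝ => I * ω * (u : ℂ)) (I * ω * 1) u :=
      (Complex.ofRealCLM.hasDerivAt (x := u)).const_mul _
    convert h1.cexp using 1
    ring
  have hv : ∀ u : ℝ, HasDerivAt (fun u : ℝ => (f u : ℂ)) ((deriv f u : ℝ) : ℂ) u := fun u =>
    ((hf.differentiable one_ne_zero) u).hasDerivAt.ofReal_comp
  have h := integral_mul_deriv_eq_deriv_mul_of_integrable (fun u _ => hu u) (fun u _ => hv u)
    (integrable_exp_mul hd hK hz' ω)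
    (((integrable_exp_mul hf.continuous hK hz ω).const_mul (I * ω)).congr
      (Filter.Eventually.of_forall fun u => by simp only [Pi.mul_apply]; ring))
    (integrable_exp_mul hf.continuous hK hz ω)
  rw [h, ← integral_const_mul, ← integral_neg]
  exact integral_congr_ae (Filter.Eventually.of_forall fun u => by ring)

theorem norm_integral_exp_mul_le {f : ℝ → ℝ} {K : Set ℝ} (hK : IsCompact K)
    (hz : ∀ u ∉ K, f u = 0) {C : ℝ} (hC : ∀ u, |f u| ≤ C) (ω : ℝ) :
    ‖∫ u : ℝ, Complex.exp (I * ω * u) * f u‖ ≤ C * volume.real K := by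
  rw [← setIntegral_eq_integral_of_forall_compl_eq_zero (s := K)
    (fun u hu => by simp [hz u hu])]
  refine norm_setIntegral_le_of_norm_le_const hK.measure_lt_top fun u _ => ?_
  have : I * ω * u = ((ω * u : ℝ) : ℂ) * I := by push_cast; ring
  rw [norm_mul, this, Complex.norm_exp_ofReal_mul_I, one_mul, Complex.norm_real]
  exact hC u

theorem memLp_amplitude {μ : Measure X} [SigmaFinite μ] {φ : X → ℝ → ℝ}
    (hφ : φ ∈ testFields μ Set.univ) : MemLp (amplitude φ) 2 (modeMeasure μ) := by
  obtain ⟨hm, hs, ⟨K, hK, -, hz⟩, C, hC, hb⟩ := hφ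
  set L := volume.real K with hL
  have hd1 : ∀ x, ContDiff ℝ 1 (φ x) := fun x => (hs x).of_le (by simp)
  have hd2 : ∀ x, ContDiff ℝ 1 (deriv (φ x)) := fun x =>
    (smooth_deriv (hs x)).2.of_le (by simp)
  have hz0 : ∀ f : ℝ → ℝ, (∀ u ∉ K, f u = 0) → ∀ u ∉ K, deriv f u = 0 := by
    intro f hf u hu
    have : f =ᶠ[nhds u] fun _ => 0 := by
      filter_upwards [hK.isClosed.isOpen_compl.mem_nhds hu] with v hv using hf v hv
    rw [this.deriv_eq, deriv_const]
  have hz1 := fun x => hz0 _ (hz x)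
  have hz2 := fun x => hz0 _ (hz1 x)
  have hbound : ∀ (ω : ℝ) (x : X),
      (1 + ω ^ 2) * ‖∫ u : ℝ, Complex.exp (I * ω * u) * φ x u‖ ≤ 2 * (C x * L) := by
    intro ω x
    have h0 := norm_integral_exp_mul_le hK (hz x) (fun u => (hb x u).1) ω
    have h2 := norm_integral_exp_mul_le hK (hz2 x) (fun u => (hb x u).2.2) ω
    rw [integral_exp_mul_deriv (hd2 x) hK (hz1 x) (hz2 x), integral_exp_mul_deriv (hd1 x) hK
      (hz x) (hz1 x), ← mul_assoc, norm_mul] at h2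
    have : ‖-(I * (ω : ℂ)) * -(I * ω)‖ = ω ^ 2 := by
      simp [← sq]
    rw [this] at h2
    nlinarith
  have hmeas : AEStronglyMeasurable (amplitude φ) (modeMeasure μ) := by
    have h1 : Measurable fun q : (ℝ × X) × ℝ => Complex.exp (I * q.1.1 * q.2) * φ q.1.2 q.2 := by
      have : Measurable fun q : (ℝ × X) × ℝ => φ q.1.2 q.2 :=
        hm.comp ((measurable_snd.comp measurable_fst).prodMk measurable_snd)
      fun_prop
    have h2 := (h1.stronglyMeasurable.integral_prod_right' (ν := (volume : Measure ℝ)))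
    have h3 : Measurable fun p : ℝ × X => ((√(2 * p.1) : ℝ) : ℂ) := by fun_prop
    exact (h3.stronglyMeasurable.mul h2).aestronglyMeasurable
  have hdom : MemLp (fun p : ℝ × X => (√(1 + p.1 ^ 2))⁻¹ * C p.2) 2 (modeMeasure μ) := by
    have hc : Continuous fun ω : ℝ => (√(1 + ω ^ 2))⁻¹ := by
      refine Continuous.inv₀ (by fun_prop) fun ω => ?_
      positivity
    have hi : Integrable (fun ω : ℝ => ‖(√(1 + ω ^ 2))⁻¹‖ ^ 2)
        ((1 / (2 * π)).toNNReal • volume.restrict (Set.Ioi 0)) := by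
      refine Integrable.smul_measure_nnreal ?_
      refine Integrable.restrict ?_
      refine integrable_inv_one_add_sq.congr (Filter.Eventually.of_forall fun ω => ?_)
      simp only [norm_inv, Real.norm_eq_abs, inv_pow, sq_abs]
      rw [Real.sq_sqrt (by positivity)]
    have hj := (memLp_two_iff_integrable_sq_norm hC.1).1 hC
    have hm' : AEStronglyMeasurable (fun p : ℝ × X => (√(1 + p.1 ^ 2))⁻¹ * C p.2)
        (modeMeasure μ) :=
      (hc.measurable.comp measurable_fst).aestronglyMeasurable.mul hC.1.comp_snd
    rw [memLp_two_iff_integrable_sq_norm hm']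
    refine (hi.mul_prod hj).congr (Filter.Eventually.of_forall fun p => ?_)
    simp only [norm_mul, mul_pow]
  refine MemLp.of_le_mul (c := 2 * L) hdom hmeas (Filter.Eventually.of_forall fun p => ?_)
  obtain ⟨ω, x⟩ := p
  have hCx : 0 ≤ C x := (abs_nonneg _).trans (hb x 0).1
  have hL0 : 0 ≤ L := measureReal_nonneg
  have h1 : √(2 * ω) ≤ √(1 + ω ^ 2) := Real.sqrt_le_sqrt (by nlinarith [sq_nonneg (ω - 1)])
  have hpos : 0 < √(1 + ω ^ 2) := by positivity
  have hsq : √(1 + ω ^ 2) * √(1 + ω ^ 2) = 1 + ω ^ 2 := Real.mul_self_sqrt (by positivity)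
  have h3 := hbound ω x
  simp only [amplitude, norm_mul, Complex.norm_real, Real.norm_eq_abs, norm_inv,
    abs_of_nonneg (Real.sqrt_nonneg _), abs_of_nonneg hCx]
  set J := ‖∫ u : ℝ, Complex.exp (I * ω * u) * φ x u‖ with hJ
  have hJ0 : 0 ≤ J := norm_nonneg _
  calc √(2 * ω) * J ≤ √(1 + ω ^ 2) * J := mul_le_mul_of_nonneg_right h1 hJ0
    _ = (√(1 + ω ^ 2))⁻¹ * ((1 + ω ^ 2) * J) := by
        rw [show (1 + ω ^ 2) * J = √(1 + ω ^ 2) * (√(1 + ω ^ 2) * J) by rw [← mul_assoc, hsq]]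
        rw [← mul_assoc, inv_mul_cancel₀ hpos.ne', one_mul]
    _ ≤ (√(1 + ω ^ 2))⁻¹ * (2 * (C x * L)) := by gcongr
    _ = 2 * L * ((√(1 + ω ^ 2))⁻¹ * C x) := by ring

/-- The amplitudes of a test field as an element of the one-particle space `L²(dω/2π d²x)`. -/
def modes {μ : Measure X} [SigmaFinite μ] (φ : testFields μ Set.univ) :
    Lp ℂ 2 (modeMeasure μ) :=
  (memLp_amplitude φ.2).toLp

end Fields

section Horizon

variable {X : Type*} [MeasurableSpace X]

/-- A caustic-free null horizon. `X` is the space of its lightrays, with measure `μ` (`d²x`), the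
ray with label `x` is parametrized by the open interval `ray x`, and `γ x l > 0` is the determinant
of the transverse metric (so `√γ` is the area density) at the point `l` of the ray `x`. -/
structure NullHorizon (X : Type*) [MeasurableSpace X] where
  μ : Measure X
  sigmaFinite : SigmaFinite μ
  ray : X → Set ℝ
  isOpen_ray : ∀ x, IsOpen (ray x)
  ordConnected_ray : ∀ x, (ray x).OrdConnected
  γ : X → ℝ → ℝ
  γ_pos : ∀ x, ∀ l ∈ ray x, 0 < γ x l
  contDiffOn_γ : ∀ x, ContDiffOn ℝ 1 (γ x) (ray x)

instance (S : NullHorizon X) : SigmaFinite S.μ := S.sigmaFinite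

/-- A null coordinate on a horizon: along every ray an increasing `C¹` coordinate `u` with range
`-∞ < u < ∞`; `param x s` is the point of the ray `x` at which `u = s`. -/
structure NullCoordinate (S : NullHorizon X) where
  u : X → ℝ → ℝ
  param : X → ℝ → ℝ
  param_mem : ∀ x s, param x s ∈ S.ray x
  u_param : ∀ x s, u x (param x s) = s
  param_u : ∀ x, ∀ l ∈ S.ray x, param x (u x l) = l
  contDiff_param : ∀ x, ContDiff ℝ 1 (param x)
  deriv_param_pos : ∀ x s, 0 < deriv (param x) s

/-- The symplectic form `∫ d²x dl √γ (ϕ₁ ∂ϕ₂ - ϕ₂ ∂ϕ₁)` of the horizon. -/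
def symplecticForm (S : NullHorizon X) (ϕ₁ ϕ₂ : X → ℝ → ℝ) : ℝ :=
  ∫ x, (∫ l in S.ray x, √(S.γ x l) * (ϕ₁ x l * deriv (ϕ₂ x) l - ϕ₂ x l * deriv (ϕ₁ x) l)) ∂S.μ

variable {S : NullHorizon X} (c : NullCoordinate S)

/-- The rescaled field `φ(u, x) = γ^{1/4} ϕ` as a function of the null coordinate. -/
def rescaled (ϕ : X → ℝ → ℝ) : X → ℝ → ℝ := fun x s =>
  S.γ x (c.param x s) ^ (1 / 4 : ℝ) * ϕ x (c.param x s)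

open Classical in
/-- The field `ϕ` on the horizon (zero off the rays) with rescaled field `φ`. -/
def ofRescaled (φ : X → ℝ → ℝ) : X → ℝ → ℝ := fun x l =>
  if l ∈ S.ray x then S.γ x l ^ (-(1 / 4) : ℝ) * φ x (c.u x l) else 0

theorem rescaled_ofRescaled (φ : X → ℝ → ℝ) : rescaled c (ofRescaled c φ) = φ := by
  ext x s
  have h := S.γ_pos x _ (c.param_mem x s)
  rw [rescaled, ofRescaled, if_pos (c.param_mem x s), c.u_param, ← mul_assoc,
    ← Real.rpow_add h]
  simp

/-- The classical phase space of the part of the horizon where `u ∈ U`: fields on the horizon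
(extended by zero off the rays) whose rescaled field is a test field with support in `U`. -/
def phaseSpace (U : Set ℝ) : Submodule ℝ (X → ℝ → ℝ) where
  carrier := {ϕ | rescaled c ϕ ∈ testFields S.μ U ∧ ∀ x, ∀ l ∉ S.ray x, ϕ x l = 0}
  zero_mem' := by
    refine ⟨?_, fun x l _ => rfl⟩
    have : rescaled c 0 = 0 := by ext x s; simp [rescaled]
    rw [this]; exact zero_mem _
  add_mem' := by
    rintro ϕ ψ ⟨h, hz⟩ ⟨h', hz'⟩
    refine ⟨?_, fun x l hl => by simp [hz x l hl, hz' x l hl]⟩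
    have : rescaled c (ϕ + ψ) = rescaled c ϕ + rescaled c ψ := by
      ext x s; simp [rescaled, mul_add]
    rw [this]; exact add_mem h h'
  smul_mem' := by
    rintro a ϕ ⟨h, hz⟩
    refine ⟨?_, fun x l hl => by simp [hz x l hl]⟩
    have : rescaled c (a • ϕ) = a • rescaled c ϕ := by
      ext x s; simp only [rescaled, Pi.smul_apply, smul_eq_mul]; ring
    rw [this]; exact Submodule.smul_mem _ _ h

/-- The phase space of the whole horizon. -/
abbrev FullPhase : Type _ := phaseSpace c Set.univ

/-- The phase space of the half-horizon `u > 0`. -/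
abbrev HalfPhase : Type _ := phaseSpace c (Set.Ioi 0)

variable {c}

/-- A field on the half-horizon `u > 0` as a field on the whole horizon. -/
def HalfPhase.toFull (f : HalfPhase c) : FullPhase c :=
  ⟨f.1, testFields_mono _ (Set.subset_univ _) f.2.1, f.2.2⟩

theorem comp_mul_mem_testFields {μ : Measure X} {φ : X → ℝ → ℝ}
    (hφ : φ ∈ testFields μ (Set.Ioi 0)) {a : ℝ} (ha : 0 < a) :
    (fun x u => φ x (a * u)) ∈ testFields μ (Set.Ioi 0) := by
  obtain ⟨hm, hs, ⟨K, hK, hKU, hz⟩, C, hC, hb⟩ := hφ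
  refine ⟨hm.comp (measurable_fst.prodMk (measurable_snd.const_mul a)), fun x => ?_,
    ⟨(fun u => a⁻¹ * u) '' K, hK.image (by fun_prop), ?_, ?_⟩,
    (1 + a + a * a) • C, hC.const_smul _, fun x u => ?_⟩
  · have := hs x
    fun_prop
  · rintro _ ⟨u, hu, rfl⟩
    exact mul_pos (inv_pos.2 ha) (hKU hu)
  · intro x u hu
    refine hz x _ fun h => hu ⟨a * u, h, ?_⟩
    simp only
    rw [← mul_assoc, inv_mul_cancel₀ ha.ne', one_mul]
  · have e : ∀ g : ℝ → ℝ, Differentiable ℝ g →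
        deriv (fun u => g (a * u)) = fun u => a * deriv g (a * u) := by
      intro g hg
      ext v
      have h := (hg (a * v)).hasDerivAt.comp v ((hasDerivAt_id v).const_mul a)
      have h' := h.deriv
      simp only [Function.comp_def, mul_one] at h'
      rw [h', mul_comm]
    have e1 := e _ (smooth_deriv (hs x)).1
    have e2 := e _ (smooth_deriv (smooth_deriv (hs x)).2).1
    have e3 : deriv (fun u => a * deriv (φ x) (a * u)) u = a * (a * deriv (deriv (φ x)) (a * u)) := by
      have hd : DifferentiableAt ℝ (fun u => deriv (φ x) (a * u)) u :=
        ((smooth_deriv (smooth_deriv (hs x)).2).1.comp (differentiable_id.const_mul a)) u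
      rw [deriv_const_mul _ hd, e2]
    obtain ⟨h0, h1, h2⟩ := hb x (a * u)
    have hC0 : 0 ≤ C x := (abs_nonneg _).trans h0
    rw [e1, e3]
    simp only [Pi.smul_apply, smul_eq_mul, abs_mul, abs_of_pos ha]
    have ha2 : 0 < a * a := mul_pos ha ha
    refine ⟨?_, ?_, ?_⟩
    · nlinarith [mul_nonneg ha.le hC0, mul_nonneg ha2.le hC0]
    · nlinarith [mul_nonneg ha.le hC0, mul_nonneg ha2.le hC0, mul_le_mul_of_nonneg_left h1 ha.le]
    · rw [← mul_assoc]
      nlinarith [mul_nonneg ha.le hC0, mul_nonneg ha2.le hC0, mul_le_mul_of_nonneg_left h2 ha2.le]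

theorem comp_exp_mem_testFields {μ : Measure X} {φ : X → ℝ → ℝ}
    (hφ : φ ∈ testFields μ (Set.Ioi 0)) :
    (fun x τ => φ x (Real.exp τ)) ∈ testFields μ Set.univ := by
  obtain ⟨hm, hs, ⟨K, hK, hKU, hz⟩, C, hC, hb⟩ := hφ
  obtain ⟨R, hR⟩ := hK.isBounded.exists_norm_le
  have hz0 : ∀ f : ℝ → ℝ, (∀ u ∉ K, f u = 0) → ∀ u ∉ K, deriv f u = 0 := by
    intro f hf u hu
    have : f =ᶠ[nhds u] fun _ => 0 := by
      filter_upwards [hK.isClosed.isOpen_compl.mem_nhds hu] with v hv using hf v hv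
    rw [this.deriv_eq, deriv_const]
  have hz1 := fun x => hz0 _ (hz x)
  have hz2 := fun x => hz0 _ (hz1 x)
  refine ⟨hm.comp (measurable_fst.prodMk (Real.measurable_exp.comp measurable_snd)), fun x => ?_,
    ⟨Real.log '' K, hK.image_of_continuousOn (Real.continuousOn_log.mono fun u hu => ?_),
      Set.subset_univ _, ?_⟩,
    (1 + |R| + |R| * |R|) • C, hC.const_smul _, fun x τ => ?_⟩
  · have := hs x
    fun_prop
  · exact (ne_of_gt (hKU hu) : u ≠ 0)
  · intro x τ hτ
    exact hz x _ fun h => hτ ⟨Real.exp τ, h, Real.log_exp τ⟩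
  · have e : ∀ g : ℝ → ℝ, Differentiable ℝ g → ∀ v,
        HasDerivAt (fun v => g (Real.exp v)) (deriv g (Real.exp v) * Real.exp v) v :=
      fun g hg v => (hg (Real.exp v)).hasDerivAt.comp v (Real.hasDerivAt_exp v)
    have e1 : deriv (fun v => φ x (Real.exp v)) = fun v => deriv (φ x) (Real.exp v) * Real.exp v :=
      funext fun v => (e _ (smooth_deriv (hs x)).1 v).deriv
    have e2 := ((e _ (smooth_deriv (smooth_deriv (hs x)).2).1 τ).mul (Real.hasDerivAt_exp τ)).deriv
    have e3 : deriv (fun v => deriv (φ x) (Real.exp v) * Real.exp v) τ =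
        deriv (deriv (φ x)) (Real.exp τ) * Real.exp τ * Real.exp τ +
          deriv (φ x) (Real.exp τ) * Real.exp τ := e2
    obtain ⟨h0, h1, h2⟩ := hb x (Real.exp τ)
    have hC0 : 0 ≤ C x := (abs_nonneg _).trans h0
    rw [e1, e3]
    simp only [Pi.smul_apply, smul_eq_mul]
    have hR0 : 0 ≤ |R| := abs_nonneg R
    have hRC := mul_nonneg hR0 hC0
    have hRRC := mul_nonneg hR0 hRC
    by_cases hτ : Real.exp τ ∈ K
    · have hE : Real.exp τ ≤ |R| := by
        have := hR _ hτ
        rw [Real.norm_eq_abs, abs_of_pos (Real.exp_pos τ)] at this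
        exact this.trans (le_abs_self R)
      have hE0 := (Real.exp_pos τ).le
      have b1 : |deriv (φ x) (Real.exp τ) * Real.exp τ| ≤ |R| * C x := by
        rw [abs_mul, abs_of_nonneg hE0, mul_comm]
        exact mul_le_mul hE h1 (abs_nonneg _) hR0
      have b2 : |deriv (deriv (φ x)) (Real.exp τ) * Real.exp τ * Real.exp τ| ≤ |R| * (|R| * C x) := by
        rw [abs_mul, abs_mul, abs_of_nonneg hE0, mul_comm, mul_comm |deriv (deriv (φ x)) _|]
        exact mul_le_mul hE (mul_le_mul hE h2 (abs_nonneg _) hR0) (by positivity) hR0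
      refine ⟨by nlinarith, by nlinarith, (abs_add_le _ _).trans (by nlinarith)⟩
    · rw [hz x _ hτ, hz1 x _ hτ, hz2 x _ hτ]
      have : 0 ≤ (1 + |R| + |R| * |R|) * C x := by positivity
      simpa using this

/-- The rescaled field of a field on `u > 0`, as a function of the null time `τ = ln u`. -/
def tauField (f : HalfPhase c) : testFields S.μ Set.univ :=
  ⟨fun x τ => rescaled c f.1 x (Real.exp τ), comp_exp_mem_testFields f.2.1⟩

/-- The translation by `t` in `τ = ln u` of a field on `u > 0`: `φ(τ) ↦ φ(τ - t)`. -/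
def translate (t : ℝ) (f : HalfPhase c) : HalfPhase c :=
  ⟨ofRescaled c fun x u => rescaled c f.1 x (Real.exp (-t) * u), by
    refine ⟨?_, fun x l hl => if_neg hl⟩
    rw [rescaled_ofRescaled]
    exact comp_mul_mem_testFields f.2.1 (Real.exp_pos _)⟩

variable (S) in
/-- The Fock space over the one-particle space `L²(dω/2π d²x)`. -/
abbrev HorizonFock : Type _ := BoseFock (modeMeasure S.μ)

/-- The amplitudes `a(ω, x)` of a field on the horizon with respect to the null time `u`. -/
def modesU (f : FullPhase c) : Lp ℂ 2 (modeMeasure S.μ) := modes ⟨rescaled c f.1, f.2.1⟩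

/-- The amplitudes `a_τ(Ω, x)` of a field on the half-horizon with respect to `τ = ln u`. -/
def modesTau (f : HalfPhase c) : Lp ℂ 2 (modeMeasure S.μ) := modes (tauField f)

/-- The operator `exp(i Ω(f, ϕ̂))`, with `Ω(f, ϕ̂) = ∫ d²x dω/2π (i a_f â† + h.c.)` the quantum
field smeared with `f` through the symplectic form, on the Fock space of the modes of the null
time `u`. -/
def weylU (f : FullPhase c) : HorizonFock S →L[ℂ] HorizonFock S := fockWeyl (I • modesU f)

/-- The operator `exp(i Ω(f, ϕ̂))` for `f` on the half-horizon, on the half-horizon's Hilbert space,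
i.e. on the Fock space of the modes of the null time `τ = ln u`. -/
def weylTau (f : HalfPhase c) : HorizonFock S →L[ℂ] HorizonFock S := fockWeyl (I • modesTau f)

/-- `A = m(N, H)` for the number operator `N` and the Hamiltonian `H = ∫ d²x dΩ/2π Ω â†â`, which
multiply an `n`-particle wavefunction `ψₙ(Ω₁, x₁; …; Ωₙ, xₙ)` by `n` and by `Ω₁ + ⋯ + Ωₙ`. -/
def IsFunctionOfNH (m : ℕ → ℝ → ℂ) (A : HorizonFock S →L[ℂ] HorizonFock S) : Prop :=
  ∀ (ψ : HorizonFock S) (n : ℕ),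
    ((A ψ).1.1 n : (Fin n → ℝ × X) → ℂ) =ᵐ[Measure.pi fun _ : Fin n => modeMeasure S.μ]
      fun p => m n (∑ i, (p i).1) * (ψ.1.1 n : (Fin n → ℝ × X) → ℂ) p

/-- The sine transform `g(ω, x) = 2√ω ∫ du sin(ωu) φ(u, x)`. -/
def sineTransform (φ : X → ℝ → ℝ) (p : ℝ × X) : ℝ :=
  2 * √p.1 * ∫ u : ℝ, Real.sin (p.1 * u) * φ p.2 u

/-- The `u`-odd field on the whole range of `u` with the given values `φ₋(u, x)` for `u > 0`. -/
def oddExtension (φ : X → ℝ → ℝ) : X → ℝ → ℝ := fun x u =>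
  if 0 < u then φ x u else -φ x (-u)

/-- `∫ d²x dω/2π g_f(ω, x) g_h(ω, x)` for two `u`-odd fields, given by their values at `u > 0`. -/
def sinePairing (f h : HalfPhase c) : ℝ :=
  ∫ p, sineTransform (oddExtension (rescaled c f.1)) p *
    sineTransform (oddExtension (rescaled c h.1)) p ∂(modeMeasure S.μ)

/-- `Ψ[φ₋]` is a vacuum wavefunctional over the `u`-odd fields (given by their values at `u > 0`):
it is not zero, and it is annihilated by the lowering operators
`â(ω, x) = (i/√2) (2π δ/δg(ω, x) + g(ω, x))`, here smeared with `g_h(ω, x) d²x dω/2π`. -/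
def IsVacuumWavefunctional (Ψ : HalfPhase c → ℂ) : Prop :=
  Ψ ≠ 0 ∧ ∀ h f : HalfPhase c,
    DifferentiableAt ℝ (fun t : ℝ => Ψ (f + t • h)) 0 ∧
    I / √2 * (deriv (fun t : ℝ => Ψ (f + t • h)) 0 + sinePairing h f * Ψ f) = 0

/-- The field `∑ᵢ rᵢ vᵢ`. -/
def combine {m : ℕ} (v : Fin m → HalfPhase c) (r : Fin m → ℝ) : HalfPhase c := ∑ i, r i • v i

/-- `v` spans a finite-dimensional symplectic subspace (finitely many modes) of the half-horizon's
phase space. -/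
def IsSymplecticFrame {m : ℕ} (v : Fin m → HalfPhase c) : Prop :=
  (Matrix.of fun i j => symplecticForm S (v i).1 (v j).1).det ≠ 0

/-- `combine v r` and `f` are the same point of phase space: they differ at most by a field in the
kernel of the symplectic form, i.e. by one that vanishes on almost all rays. -/
def Represents {m : ℕ} (v : Fin m → HalfPhase c) (r : Fin m → ℝ) (f : HalfPhase c) : Prop :=
  ∀ h : HalfPhase c, symplecticForm S (combine v r).1 h.1 = symplecticForm S f.1 h.1

/-- The span of `v` contains all points of `F`. -/
def Contains {m : ℕ} (v : Fin m → HalfPhase c) (F : Finset (HalfPhase c)) : Prop :=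
  ∀ f ∈ F, ∃ r, Represents v r f

/-- The symplectic Fourier transform of the restriction of the phase-space functional `Ψ` to the
span of `v`, up to normalization: `Ψ[ϕ] ∝ ∫ dr (weylCoeff Ψ v r) exp(i Ω(combine v r, ϕ))`. -/
def weylCoeff (Ψ : HalfPhase c → ℂ) {m : ℕ} (v : Fin m → HalfPhase c) (r : Fin m → ℝ) : ℂ :=
  ∫ s : Fin m → ℝ,
    Ψ (combine v s) * Complex.exp (-I * symplecticForm S (combine v r).1 (combine v s).1)

/-- `⟨e(z)| Ψ̂ᵥ |e(w)⟩` for the Weyl quantization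
`Ψ̂ᵥ = ∫ dr (weylCoeff Ψ v r) exp(i Ω(combine v r, ϕ̂))` of the restriction of `Ψ` to the finitely many modes spanned by `v`. -/
def weylQuantization (Ψ : HalfPhase c → ℂ) {m : ℕ} (v : Fin m → HalfPhase c)
    (z w : Lp ℂ 2 (modeMeasure S.μ)) : ℂ :=
  ∫ r : Fin m → ℝ, weylCoeff Ψ v r * inner ℂ (expVec z) (weylTau (combine v r) (expVec w))

/-- The operator `A` is a Wigner–Weyl transform of the phase-space functional `Ψ`: it is nonzero
and, with suitable normalizations, the Weyl quantizations of the restrictions of `Ψ` to finitely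
many modes converge to it as the set of modes grows (in matrix elements between coherent
states). -/
def IsWignerWeylTransform (Ψ : HalfPhase c → ℂ) (A : HorizonFock S →L[ℂ] HorizonFock S) : Prop :=
  A ≠ 0 ∧ ∃ N : (m : ℕ) → (Fin m → HalfPhase c) → ℂ,
    ∀ z w : Lp ℂ 2 (modeMeasure S.μ), ∀ ε > 0, ∃ F : Finset (HalfPhase c),
      ∀ (m : ℕ) (v : Fin m → HalfPhase c), IsSymplecticFrame v → Contains v F →
        ‖N m v * weylQuantization Ψ v z w - inner ℂ (expVec z) (A (expVec w))‖ < ε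

/-- The expectation value `Tr(ρ̂ᵥ exp(i Ω(combine v s, ϕ̂))) / Tr ρ̂ᵥ` in the state of finitely many
modes with density operator `ρ̂ᵥ = Ψ̂ᵥ Ψ̂ᵥ†`. Here
`ρ̂ᵥ = ∫∫ dr dr' (weylCoeff Ψ v r) (weylCoeff Ψ v r')^* W(r) W(-r')` with
`W(r) = exp(i Ω(combine v r, ϕ̂))`, and the trace is evaluated with
`W(s) W(r) = exp(-i Ω(combine v s, combine v r)/2) W(s + r)` and `Tr W(r) ∝ δ(r)`. -/
def reducedExpectation (Ψ : HalfPhase c → ℂ) {m : ℕ} (v : Fin m → HalfPhase c)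
    (s : Fin m → ℝ) : ℂ :=
  (∫ r : Fin m → ℝ, weylCoeff Ψ v r * (starRingEnd ℂ) (weylCoeff Ψ v (r + s)) *
    Complex.exp (-I * symplecticForm S (combine v s).1 (combine v r).1 / 2)) /
  ∫ r : Fin m → ℝ, weylCoeff Ψ v r * (starRingEnd ℂ) (weylCoeff Ψ v r)

/-- The vacuum state with respect to the null time `u`, as an expectation functional. -/
def vacuumState (A : HorizonFock S →L[ℂ] HorizonFock S) : ℂ := inner ℂ vac (A vac)

/-- The state `ω` on the algebra spanned by the operators `W f` is thermal at temperature `T` with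
respect to the time evolution `W f ↦ W (α t f)`: it satisfies the Kubo–Martin–Schwinger condition at
inverse temperature `β = 1/T`. -/
def IsThermalState {E P : Type*} [NormedAddCommGroup E] [InnerProductSpace ℂ E]
    (ω : (E →L[ℂ] E) → ℂ) (W : P → E →L[ℂ] E) (α : ℝ → P → P) (T : ℝ) : Prop :=
  ∀ f g : P, ∃ G : ℂ → ℂ,
    ContinuousOn G {z | 0 ≤ z.im ∧ z.im ≤ 1 / T} ∧
    DifferentiableOn ℂ G {z | 0 < z.im ∧ z.im < 1 / T} ∧
    (∃ B : ℝ, ∀ z : ℂ, 0 ≤ z.im → z.im ≤ 1 / T → ‖G z‖ ≤ B) ∧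
    ∀ t : ℝ, G t = ω (W f * W (α t g)) ∧ G (t + (1 / T : ℝ) * I) = ω (W (α t g) * W f)

end Horizon

end Unruh

end

/-!
Write `a`, `d` and `c` for the amplitudes `a_τ(Ω, x)` of a field on `u > 0`, multiplied by `1`,
`√coth(πΩ/2)` and `√coth(πΩ)` (`modesTauL`, `waveModes`, `vacuumModes`). Everything follows from
three facts about them.

* The symplectic form is `2 Im ⟪a_f, a_g⟫`, and also twice the imaginary part of the inner product
  of the `u`-amplitudes (`symplecticForm_eq_im_modesTau`, `symplecticForm_eq_im_modesU`). So the
  Weyl relations are those of the Fock space.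
* The `u`-amplitudes of a field on `u > 0` have norm `‖c_f‖` (`norm_sq_modesU`), and the exponent of
  the vacuum wavefunctional is `-2‖d_f‖²` (`sinePairing_eq`, `IsVacuumWavefunctional.eq`). Both come
  from writing `∫ ω |φ̂(ω)|² dω` as the double integral of `(φ(u) - φ(v))² / (u - v)²`, where one can
  substitute `u = e^τ`: the kernel becomes `1 / (4 sinh²((τ - τ')/2))`, whose Fourier transform is
  known from the partial fractions of `coth` (`lintegral_ft_eq_thermal`,
  `lintegral_ft_odd_eq_thermal`).
* The amplitudes, with any of these weights, are dense in the real Hilbert space of one-particle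
  vectors (`exists_weightedModes_near`).

On finitely many modes the wavefunctional is a Gaussian, hence so are its symplectic Fourier
transform and the matrix elements of its Weyl quantization, and the latter have as exponent the
inverse of a quadratic form, i.e. the solution of a finite-dimensional maximization problem. It is
bounded from below by trial vectors of this problem (`le_weylForm`) and from above by those of the
dual problem (`weylForm_le`). As the set of modes grows, by density, both bounds approach the common
optimal value `⟪y, (1 + e^{-πΩ}) y⟫ / 4` of the two problems on the whole one-particle space
(`tendsto_weylForm`). Therefore the normalized matrix elements between `e(z)` and `e(w)` tend to
`exp(-⟪z, e^{-πΩ} w⟫)`, which is the matrix element of the second quantization of multiplication by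
`-e^{-πΩ}`, that is, of `(-1)^N e^{-πH}`. The finite-mode expectation values are treated in the same
way (`exists_finset_dualMatrix`); their limit is `exp(-(‖R a_f‖² + ‖d_f‖²)/4)` with `R² = tanh(πΩ/2)`,
and `(tanh(x/2) + coth(x/2))/2 = coth x` identifies it with the vacuum expectation value.

The KMS condition holds since the two-point function is the integral of
`(k e^{iΩz} + k^* e^{-2πΩ - iΩz}) / (1 + e^{-2πΩ})` with `k = c_f^* c_g` integrable, which is bounded
by `2|k|` on the strip `0 ≤ Im z ≤ 2π`.
-/

noncomputable section

namespace Unruh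

open MeasureTheory Complex Real

/-! ### Second quantization of multiplication operators -/

section SecondQuantization

variable {M : Type*} [MeasurableSpace M]

/-- A measurable function `b` with `‖b‖ ≤ 1`, to be used as a contractive multiplication operator. -/
def Multiplier (M : Type*) [MeasurableSpace M] : Type _ :=
  {b : M → ℂ // Measurable b ∧ ∀ p, ‖b p‖ ≤ 1}

variable {ν : Measure M}

theorem Multiplier.memLp (b : Multiplier M) (f : Lp ℂ 2 ν) :
    MemLp (fun p => b.1 p * f p) 2 ν := by
  refine (Lp.memLp f).of_le (b.2.1.aestronglyMeasurable.mul (Lp.aestronglyMeasurable f))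
    (Filter.Eventually.of_forall fun p => ?_)
  rw [norm_mul]
  exact mul_le_of_le_one_left (norm_nonneg _) (b.2.2 p)

/-- Multiplication by `b` on `L²`. -/
def Multiplier.toCLM (b : Multiplier M) : Lp ℂ 2 ν →L[ℂ] Lp ℂ 2 ν :=
  LinearMap.mkContinuous
    { toFun := fun f => (b.memLp f).toLp
      map_add' := fun f g => by
        rw [← MemLp.toLp_add]
        refine MemLp.toLp_congr _ _ ?_
        filter_upwards [Lp.coeFn_add f g] with p hp
        rw [hp, Pi.add_apply, mul_add]
        rfl
      map_smul' := fun c f => by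
        rw [RingHom.id_apply, ← MemLp.toLp_const_smul]
        refine MemLp.toLp_congr _ _ ?_
        filter_upwards [Lp.coeFn_smul c f] with p hp
        simp only [hp, Pi.smul_apply, smul_eq_mul]
        ring } 1 fun f => by
    rw [one_mul]
    refine Lp.norm_le_norm_of_ae_le ?_
    filter_upwards [(b.memLp f).coeFn_toLp] with p hp
    rw [LinearMap.coe_mk, AddHom.coe_mk, hp, norm_mul]
    exact mul_le_of_le_one_left (norm_nonneg _) (b.2.2 p)

theorem Multiplier.coeFn_toCLM (b : Multiplier M) (f : Lp ℂ 2 ν) :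
    (b.toCLM f : M → ℂ) =ᵐ[ν] fun p => b.1 p * f p :=
  (b.memLp f).coeFn_toLp

theorem Multiplier.norm_toCLM_le (b : Multiplier M) (f : Lp ℂ 2 ν) : ‖b.toCLM f‖ ≤ ‖f‖ := by
  refine Lp.norm_le_norm_of_ae_le ?_
  filter_upwards [b.coeFn_toCLM f] with p hp
  rw [hp, norm_mul]
  exact mul_le_of_le_one_left (norm_nonneg _) (b.2.2 p)

/-- The function `(p₁, …, pₙ) ↦ b(p₁) ⋯ b(pₙ)`. -/
def Multiplier.pow (b : Multiplier M) (n : ℕ) : Multiplier (Fin n → M) :=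
  ⟨fun p => ∏ i, b.1 (p i),
    Finset.measurable_fun_prod _ fun i _ => b.2.1.comp (measurable_pi_apply i), fun p => by
      rw [norm_prod]
      exact Finset.prod_le_one (fun _ _ => norm_nonneg _) fun i _ => b.2.2 _⟩

/-- The complex conjugate multiplier. -/
def Multiplier.conj (b : Multiplier M) : Multiplier M :=
  ⟨fun p => (starRingEnd ℂ) (b.1 p), Complex.continuous_conj.measurable.comp b.2.1, fun p => by
    rw [RCLike.norm_conj]; exact b.2.2 p⟩

theorem Multiplier.inner_toCLM_left (b : Multiplier M) (f g : Lp ℂ 2 ν) :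
    inner ℂ (b.toCLM f) g = inner ℂ f (b.conj.toCLM g) := by
  rw [L2.inner_def, L2.inner_def]
  refine integral_congr_ae ?_
  filter_upwards [b.coeFn_toCLM f, b.conj.coeFn_toCLM g] with p hp hq
  rw [hp, hq]
  simp only [RCLike.inner_apply, map_mul, Multiplier.conj]
  ring

theorem Multiplier.memlp (b : Multiplier M) (ψ : FullFock ν) :
    Memℓp (fun n => (b.pow n).toCLM (ψ.1 n)) 2 := by
  refine (lp.memℓp ψ).mono' fun n => ?_
  exact (b.pow n).norm_toCLM_le _

theorem inner_self_ofReal (ξ : Lp ℂ 2 ν) : inner ℂ ξ ξ = ((‖ξ‖ ^ 2 : ℝ) : ℂ) := by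
  rw [inner_self_eq_norm_sq_to_K]; norm_cast

variable [SigmaFinite ν]

/-- The operator `b ⊗ ⋯ ⊗ b` in every `n`-particle sector of the full Fock space. -/
def Multiplier.fullFock (b : Multiplier M) : FullFock ν →L[ℂ] FullFock ν :=
  LinearMap.mkContinuous
    { toFun := fun ψ => ⟨fun n => (b.pow n).toCLM (ψ.1 n), b.memlp ψ⟩
      map_add' := fun ψ χ => by
        ext1; funext n
        exact map_add _ _ _
      map_smul' := fun c ψ => by
        ext1; funext n
        exact map_smul (b.pow n).toCLM c (ψ.1 n) } 1 fun ψ => by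
    rw [one_mul]
    refine lp.norm_le_of_tsum_le (by norm_num) (norm_nonneg _) ?_
    rw [lp.norm_rpow_eq_tsum (by norm_num) ψ]
    refine Summable.tsum_le_tsum (fun n => ?_) ((memℓp_gen_iff (by norm_num)).1 (b.memlp ψ))
      ((memℓp_gen_iff (by norm_num)).1 (lp.memℓp ψ))
    exact Real.rpow_le_rpow (norm_nonneg _) ((b.pow n).norm_toCLM_le _) (by norm_num)

theorem ae_coordinates {p : M → Prop} (h : ∀ᵐ x ∂ν, p x) (n : ℕ) :
    ∀ᵐ q ∂(Measure.pi fun _ : Fin n => ν), ∀ i, p (q i) :=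
  ae_all_iff.2 fun i => (Measure.quasiMeasurePreserving_eval (fun _ : Fin n => ν) i).ae h

theorem Multiplier.fullFock_fullExpVec (b : Multiplier M) (z : Lp ℂ 2 ν) :
    b.fullFock (fullExpVec z) = fullExpVec (b.toCLM z) := by
  ext1; funext n
  change (b.pow n).toCLM (expComponent z n) = expComponent (b.toCLM z) n
  rw [expComponent, expComponent, map_smul]
  congr 1
  refine Lp.ext ?_
  filter_upwards [(b.pow n).coeFn_toCLM (memLp_prodFun z n).toLp,
    (memLp_prodFun z n).coeFn_toLp, (memLp_prodFun (b.toCLM z) n).coeFn_toLp,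
    ae_coordinates (b.coeFn_toCLM z) n] with p h1 h2 h3 h4
  rw [h1, h2, h3]
  simp only [prodFun, Multiplier.pow, ← Finset.prod_mul_distrib]
  exact Finset.prod_congr rfl fun i _ => (h4 i).symm

theorem Multiplier.fullFock_mem (b : Multiplier M) {ψ : FullFock ν} (hψ : ψ ∈ fockSubmodule ν) :
    b.fullFock ψ ∈ fockSubmodule ν := by
  have h : Submodule.span ℂ (Set.range (fullExpVec (ν := ν))) ≤
      (fockSubmodule ν).comap (b.fullFock (ν := ν)).toLinearMap := by
    rw [Submodule.span_le]
    rintro _ ⟨z, rfl⟩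
    change b.fullFock (fullExpVec z) ∈ fockSubmodule ν
    rw [b.fullFock_fullExpVec]
    exact Submodule.le_topologicalClosure _ (Submodule.subset_span ⟨_, rfl⟩)
  have hc : IsClosed ((fockSubmodule ν).comap (b.fullFock (ν := ν)).toLinearMap :
      Set (FullFock ν)) :=
    (Submodule.isClosed_topologicalClosure _).preimage b.fullFock.continuous
  exact Submodule.topologicalClosure_minimal _ h hc hψ

/-- The second quantization `Γ(b)` of multiplication by `b`: it multiplies an `n`-particle
wavefunction by `b(p₁) ⋯ b(pₙ)`. -/
def Multiplier.secondQuantization (b : Multiplier M) : BoseFock ν →L[ℂ] BoseFock ν :=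
  (b.fullFock.restrict fun _ => b.fullFock_mem :
    fockSubmodule ν →L[ℂ] fockSubmodule ν)

theorem Multiplier.secondQuantization_expVec (b : Multiplier M) (z : Lp ℂ 2 ν) :
    b.secondQuantization (expVec z) = expVec (b.toCLM z) :=
  Subtype.ext (b.fullFock_fullExpVec z)

theorem Multiplier.coeFn_secondQuantization (b : Multiplier M) (ψ : BoseFock ν) (n : ℕ) :
    ((b.secondQuantization ψ).1.1 n : (Fin n → M) → ℂ) =ᵐ[Measure.pi fun _ : Fin n => ν]
      fun p => (∏ i, b.1 (p i)) * (ψ.1.1 n : (Fin n → M) → ℂ) p :=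
  (b.pow n).coeFn_toCLM (ψ.1.1 n)

theorem fock_ext {A B : BoseFock ν →L[ℂ] BoseFock ν}
    (h : ∀ z, A (expVec z) = B (expVec z)) : A = B := by
  have h2 := denseRange_expVec (ν := ν).equalizer A.continuous B.continuous (by
    funext c
    simp only [Function.comp_apply, Finsupp.linearCombination_apply, Finsupp.sum, map_sum,
      map_smul, h])
  exact ContinuousLinearMap.ext fun x => congrFun h2 x

theorem fock_vec_ext {x y : BoseFock ν}
    (h : ∀ z, inner ℂ (expVec z) x = inner ℂ (expVec z) y) : x = y := by
  have h2 := denseRange_expVec (ν := ν).equalizer (g := fun v => inner ℂ v x)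
    (h := fun v => inner ℂ v y) (by fun_prop) (by fun_prop) (by
    funext c
    simp only [Function.comp_apply, Finsupp.linearCombination_apply, Finsupp.sum, sum_inner,
      inner_smul_left, h])
  exact ext_inner_left ℂ fun v => congrFun h2 v

/-- A bounded operator on Fock space is determined by its matrix elements between exponential
vectors. -/
theorem fock_ext_inner {A B : BoseFock ν →L[ℂ] BoseFock ν}
    (h : ∀ z w, inner ℂ (expVec z) (A (expVec w)) = inner ℂ (expVec z) (B (expVec w))) : A = B :=
  fock_ext fun w => fock_vec_ext fun z => h z w

theorem Multiplier.adjoint_secondQuantization (b : Multiplier M) :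
    ContinuousLinearMap.adjoint (b.secondQuantization (ν := ν)) = b.conj.secondQuantization := by
  refine fock_ext_inner fun z w => ?_
  rw [ContinuousLinearMap.adjoint_inner_right, b.secondQuantization_expVec,
    b.conj.secondQuantization_expVec, inner_expVec, inner_expVec, b.inner_toCLM_left]

/-- On exponential vectors the Weyl operator of `i a`, formally `exp(a(a) - a†(a))`, acts as the
displacement by `-a`. -/
theorem fockWeyl_I_smul_expVec (a w : Lp ℂ 2 ν) :
    fockWeyl (I • a) (expVec w) =
      Complex.exp (-(‖a‖ ^ 2 / 2 : ℝ) + inner ℂ a w) • expVec (w - a) := by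
  rw [fockWeyl_expVec, smul_smul, I_mul_I, neg_one_smul, norm_smul, inner_smul_left]
  simp only [norm_I, one_mul, conj_I]
  congr 3
  · rw [← mul_assoc, mul_neg, I_mul_I]; ring
  · abel

theorem fockWeyl_mul (a b : Lp ℂ 2 ν) :
    fockWeyl (I • a) * fockWeyl (I • b) =
      Complex.exp (-I * (inner ℂ a b).im) • fockWeyl (I • (a + b)) := by
  refine fock_ext fun w => ?_
  rw [mul_apply_eq_comp, smul_apply, fockWeyl_I_smul_expVec,
    map_smul, fockWeyl_I_smul_expVec, fockWeyl_I_smul_expVec, smul_smul, smul_smul,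
    ← Complex.exp_add, ← Complex.exp_add, sub_sub, add_comm b a]
  congr 2
  have h : ((‖a + b‖ ^ 2 : ℝ) : ℂ) = ‖a‖ ^ 2 + ‖b‖ ^ 2 + inner ℂ a b + inner ℂ b a := by
    rw [← inner_self_ofReal, inner_add_left, inner_add_right, inner_add_right, inner_self_ofReal,
      inner_self_ofReal]
    push_cast; ring
  have h2 : inner ℂ b a = inner ℂ a b - 2 * I * (inner ℂ a b).im := by
    rw [← inner_conj_symm b a, ← Complex.re_add_im (inner ℂ a b)]
    simp only [map_add, conj_ofReal, map_mul, conj_I, add_im, ofReal_im, mul_im, ofReal_re, I_re, I_im]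
    push_cast; ring
  push_cast at h ⊢
  rw [h, h2, inner_sub_right, inner_add_left]
  ring

theorem inner_expVec_fockWeyl (a z w : Lp ℂ 2 ν) :
    inner ℂ (expVec z) (fockWeyl (I • a) (expVec w)) =
      Complex.exp (-(‖a‖ ^ 2 / 2 : ℝ) + inner ℂ a w - inner ℂ z a + inner ℂ z w) := by
  rw [fockWeyl_I_smul_expVec, inner_smul_right, inner_expVec, ← Complex.exp_add, inner_sub_right]
  congr 1; ring

theorem inner_vac_fockWeyl (a : Lp ℂ 2 ν) :
    inner ℂ vac (fockWeyl (I • a) vac) = Complex.exp (-(‖a‖ ^ 2 / 2 : ℝ)) := by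
  rw [vac, inner_expVec_fockWeyl]; simp

theorem inner_vac_fockWeyl_mul (a b : Lp ℂ 2 ν) :
    inner ℂ vac ((fockWeyl (I • a) * fockWeyl (I • b)) vac) =
      Complex.exp (-(‖a‖ ^ 2 / 2 : ℝ) - (‖b‖ ^ 2 / 2 : ℝ) - inner ℂ a b) := by
  rw [mul_apply_eq_comp, vac, fockWeyl_I_smul_expVec b, map_smul, inner_smul_right,
    inner_expVec_fockWeyl, ← Complex.exp_add]
  congr 1; simp [sub_eq_add_neg]; ring

theorem Multiplier.secondQuantization_conj_fockWeyl (b : Multiplier M) (hb : ∀ p, ‖b.1 p‖ = 1)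
    (a : Lp ℂ 2 ν) :
    b.secondQuantization * fockWeyl (I • a) * b.conj.secondQuantization =
      fockWeyl (I • b.toCLM a) := by
  have h1 : ∀ w : Lp ℂ 2 ν, b.toCLM (b.conj.toCLM w) = w := by
    intro w
    refine Lp.ext ?_
    filter_upwards [b.coeFn_toCLM (b.conj.toCLM w), b.conj.coeFn_toCLM w] with p h1 h2
    rw [h1, h2, ← mul_assoc]
    simp only [Multiplier.conj, Complex.mul_conj, Complex.normSq_eq_norm_sq, hb]
    simp
  have h1' : ∀ w : Lp ℂ 2 ν, b.conj.toCLM (b.toCLM w) = w := by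
    intro w
    refine Lp.ext ?_
    filter_upwards [b.conj.coeFn_toCLM (b.toCLM w), b.coeFn_toCLM w] with p h1 h2
    rw [h1, h2, ← mul_assoc]
    simp only [Multiplier.conj, mul_comm ((starRingEnd ℂ) _), Complex.mul_conj,
      Complex.normSq_eq_norm_sq, hb]
    simp
  have h2 : ‖b.toCLM a‖ = ‖a‖ :=
    le_antisymm (b.norm_toCLM_le a) (by simpa only [h1'] using b.conj.norm_toCLM_le (b.toCLM a))
  refine fock_ext fun w => ?_
  simp only [mul_apply_eq_comp]
  rw [Multiplier.secondQuantization_expVec, fockWeyl_I_smul_expVec, map_smul,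
    Multiplier.secondQuantization_expVec, fockWeyl_I_smul_expVec, map_sub, h1, h2,
    b.inner_toCLM_left]

end SecondQuantization

/-! ### Fourier transforms of real test functions -/

section Fourier

/-- The Fourier transform `∫ e^{iωu} f(u) du` of a real function. -/
def ft (f : ℝ → ℝ) (ω : ℝ) : ℂ := ∫ u : ℝ, Complex.exp (I * ω * u) * f u

theorem ft_eq_fourier (f : ℝ → ℝ) (ω : ℝ) :
    ft f ω = FourierTransform.fourier (fun u => (f u : ℂ)) (-(2 * π)⁻¹ * ω) := by
  rw [Real.fourier_real_eq_integral_exp_smul, ft]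
  congr 1; funext u
  rw [smul_eq_mul]
  congr 2
  push_cast
  have : (π : ℂ) ≠ 0 := by exact_mod_cast Real.pi_ne_zero
  field_simp

theorem ft_neg (f : ℝ → ℝ) (ω : ℝ) : ft f (-ω) = (starRingEnd ℂ) (ft f ω) := by
  rw [ft, ft, ← integral_conj]
  congr 1; funext u
  rw [map_mul, conj_ofReal, ← Complex.exp_conj]
  simp

theorem norm_ft_neg (f : ℝ → ℝ) (ω : ℝ) : ‖ft f (-ω)‖ = ‖ft f ω‖ := by
  rw [ft_neg, RCLike.norm_conj]

variable {f g : ℝ → ℝ}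

theorem integrable_exp_mul_of_compact (hf : Continuous f) (hc : HasCompactSupport f) (ω : ℝ) :
    Integrable fun u : ℝ => Complex.exp (I * ω * u) * f u :=
  integrable_exp_mul hf hc (fun _ hu => image_eq_zero_of_notMem_tsupport hu) ω

theorem ft_sub (hf : Continuous f) (hc : HasCompactSupport f) (hg : Continuous g)
    (hd : HasCompactSupport g) (ω : ℝ) : ft (fun u => f u - g u) ω = ft f ω - ft g ω := by
  rw [ft, ft, ft, ← integral_sub (integrable_exp_mul_of_compact hf hc ω)
    (integrable_exp_mul_of_compact hg hd ω)]
  congr 1; funext u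
  push_cast; ring

theorem ft_translate (f : ℝ → ℝ) (h ω : ℝ) :
    ft (fun u => f (u + h)) ω = Complex.exp (-(I * ω * h)) * ft f ω := by
  rw [ft, ft, ← integral_const_mul,
    ← integral_add_right_eq_self (fun u : ℝ => Complex.exp (-(I * ω * h)) *
      (Complex.exp (I * ω * u) * f u)) h]
  congr 1; funext u
  rw [← mul_assoc, ← Complex.exp_add]
  congr 2
  push_cast; ring

theorem continuous_ft (hf : Continuous f) (hc : HasCompactSupport f) : Continuous (ft f) := by
  have h1 : Continuous (FourierTransform.fourier fun u => (f u : ℂ)) :=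
    VectorFourier.fourierIntegral_continuous Real.continuous_fourierChar
      (by fun_prop) (Continuous.integrable_of_hasCompactSupport (by fun_prop)
        (hc.comp_left (g := fun x : ℝ => (x : ℂ)) (by simp)))
  have h2 : ft f = (FourierTransform.fourier fun u => (f u : ℂ)) ∘ fun ω => -(2 * π)⁻¹ * ω :=
    funext fun ω => ft_eq_fourier f ω
  rw [h2]
  fun_prop

/-- The complexification of a real test function, as a Schwartz function. -/
def toSchwartz (hf : ContDiff ℝ (⊤ : ℕ∞) f) (hc : HasCompactSupport f) : SchwartzMap ℝ ℂ :=
  HasCompactSupport.toSchwartzMap (f := fun u => (f u : ℂ))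
    (hc.comp_left (g := fun x : ℝ => (x : ℂ)) (by simp))
    (Complex.ofRealCLM.contDiff.comp hf)

theorem ft_eq_schwartz (hf : ContDiff ℝ (⊤ : ℕ∞) f) (hc : HasCompactSupport f) (ω : ℝ) :
    ft f ω = (FourierTransform.fourier (toSchwartz hf hc)) (-(2 * π)⁻¹ * ω) := by
  rw [ft_eq_fourier, SchwartzMap.fourier_coe]; rfl

/-- Plancherel's theorem. -/
theorem integral_ft_mul_ft (hf : ContDiff ℝ (⊤ : ℕ∞) f) (hc : HasCompactSupport f)
    (hg : ContDiff ℝ (⊤ : ℕ∞) g) (hd : HasCompactSupport g) :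
    ∫ ω, (starRingEnd ℂ) (ft f ω) * ft g ω = ((2 * π * ∫ u, f u * g u : ℝ) : ℂ) := by
  have h := SchwartzMap.integral_inner_fourier_fourier (toSchwartz hf hc) (toSchwartz hg hd)
  have h1 := Measure.integral_comp_mul_left (fun ξ => inner ℂ
    ((FourierTransform.fourier (toSchwartz hf hc)) ξ)
    ((FourierTransform.fourier (toSchwartz hg hd)) ξ)) (-(2 * π)⁻¹)
  rw [h] at h1
  have h2 : ∀ ω, inner ℂ ((FourierTransform.fourier (toSchwartz hf hc)) (-(2 * π)⁻¹ * ω))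
      ((FourierTransform.fourier (toSchwartz hg hd)) (-(2 * π)⁻¹ * ω)) =
      (starRingEnd ℂ) (ft f ω) * ft g ω := by
    intro ω
    rw [← ft_eq_schwartz, ← ft_eq_schwartz, RCLike.inner_apply, mul_comm]
  simp only [h2] at h1
  rw [h1]
  have h3 : |(-(2 * π)⁻¹)⁻¹| = 2 * π := by
    rw [inv_neg, inv_inv, abs_neg, abs_of_pos (by positivity)]
  have h4 : ∀ x, inner ℂ ((toSchwartz hf hc) x) ((toSchwartz hg hd) x) = ((f x * g x : ℝ) : ℂ) := by
    intro x
    change inner ℂ (f x : ℂ) (g x : ℂ) = _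
    rw [RCLike.inner_apply, conj_ofReal]
    push_cast; ring
  simp only [h3, h4]
  rw [integral_complex_ofReal, real_smul]
  push_cast
  ring

theorem integrable_ft_mul_ft (hf : ContDiff ℝ (⊤ : ℕ∞) f) (hc : HasCompactSupport f)
    (hg : ContDiff ℝ (⊤ : ℕ∞) g) (hd : HasCompactSupport g) :
    Integrable fun ω => (starRingEnd ℂ) (ft f ω) * ft g ω := by
  have h1 : Integrable fun ξ => (starRingEnd ℂ) ((FourierTransform.fourier (toSchwartz hf hc)) ξ) *
      (FourierTransform.fourier (toSchwartz hg hd)) ξ :=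
    ((FourierTransform.fourier (toSchwartz hf hc)).memLp 2).star.integrable_mul
      ((FourierTransform.fourier (toSchwartz hg hd)).memLp 2)
  have hne : (-(2 * π)⁻¹ : ℝ) ≠ 0 := by
    have := Real.pi_ne_zero
    simp
  have h2 := h1.comp_mul_left' hne
  refine h2.congr (Filter.Eventually.of_forall fun ω => ?_)
  simp only
  rw [← ft_eq_schwartz, ← ft_eq_schwartz]

theorem integrable_norm_sq_ft (hf : ContDiff ℝ (⊤ : ℕ∞) f) (hc : HasCompactSupport f) :
    Integrable fun ω => ‖ft f ω‖ ^ 2 := by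
  refine (integrable_ft_mul_ft hf hc hf hc).norm.congr (Filter.Eventually.of_forall fun ω => ?_)
  simp [sq]

theorem lintegral_norm_sq_ft (hf : ContDiff ℝ (⊤ : ℕ∞) f) (hc : HasCompactSupport f) :
    ∫⁻ ω, ENNReal.ofReal (‖ft f ω‖ ^ 2) =
      ENNReal.ofReal (2 * π) * ∫⁻ u, ENNReal.ofReal (f u ^ 2) := by
  have hi : Integrable fun u => f u ^ 2 := by
    refine Continuous.integrable_of_hasCompactSupport (by have := hf.continuous; fun_prop) ?_
    exact hc.comp_left (g := fun x => x ^ 2) (by simp)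
  have h := integral_ft_mul_ft hf hc hf hc
  rw [← ofReal_integral_eq_lintegral_ofReal (integrable_norm_sq_ft hf hc)
    (Filter.Eventually.of_forall fun _ => by positivity),
    ← ofReal_integral_eq_lintegral_ofReal hi (Filter.Eventually.of_forall fun _ => by positivity),
    ← ENNReal.ofReal_mul (by positivity)]
  congr 1
  have h2 : ∀ ω, (starRingEnd ℂ) (ft f ω) * ft f ω = ((‖ft f ω‖ ^ 2 : ℝ) : ℂ) := by
    intro ω
    rw [mul_comm, mul_conj, normSq_eq_norm_sq]
  simp only [h2, ← sq] at h
  rw [integral_complex_ofReal] at h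
  exact ofReal_injective h

theorem ft_deriv (hf : ContDiff ℝ (⊤ : ℕ∞) f) (hc : HasCompactSupport f) (ω : ℝ) :
    ft (deriv f) ω = -(I * ω) * ft f ω :=
  integral_exp_mul_deriv (hf.of_le (by simp)) hc
    (fun _ hu => image_eq_zero_of_notMem_tsupport hu)
    (fun _ hu => image_eq_zero_of_notMem_tsupport fun h => hu (tsupport_deriv_subset h)) ω

/-- The symplectic form of two test functions on the line as the imaginary part of the inner product
of their positive-frequency parts. -/
theorem integral_Ioi_im_ft_mul_ft (hf : ContDiff ℝ (⊤ : ℕ∞) f) (hc : HasCompactSupport f)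
    (hg : ContDiff ℝ (⊤ : ℕ∞) g) (hd : HasCompactSupport g) :
    ∫ ω in Set.Ioi 0, ω * ((starRingEnd ℂ) (ft f ω) * ft g ω).im = π * ∫ u, f u * deriv g u := by
  have hg' := (smooth_deriv hg).2
  have h := integral_ft_mul_ft hf hc hg' hd.deriv
  have hi := integrable_ft_mul_ft hf hc hg' hd.deriv
  have h1 : ∀ ω, ((starRingEnd ℂ) (ft f ω) * ft (deriv g) ω).re =
      |ω| * ((starRingEnd ℂ) (ft f |ω|) * ft g |ω|).im := by
    intro ω
    rw [ft_deriv hg hd]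
    rcases le_total 0 ω with h0 | h0
    · rw [abs_of_nonneg h0]
      simp; ring
    · rw [abs_of_nonpos h0, ft_neg, ft_neg]
      simp; ring
  have h2 := congrArg Complex.re h
  rw [← RCLike.re_eq_complex_re, ← integral_re hi] at h2
  simp only [RCLike.re_eq_complex_re, h1] at h2
  rw [integral_comp_abs (f := fun ω => ω * ((starRingEnd ℂ) (ft f ω) * ft g ω).im)] at h2
  rw [ofReal_re] at h2
  linarith

end Fourier

/-! ### Fourier integrals of the kernels `1/h²`, `1/(4 sinh²(h/2))` and `1/sinh² h` -/

section Kernels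

theorem lintegral_real_eq_Ioi (F : ℝ → ENNReal) :
    ∫⁻ u, F u = (∫⁻ u in Set.Ioi 0, F u) + ∫⁻ u in Set.Ioi 0, F (-u) := by
  have h1 : ∫⁻ u in Set.Ioi 0, F (-u) = ∫⁻ u in Set.Iio 0, F u := by
    have h := (Measure.measurePreserving_neg (volume : Measure ℝ)).setLIntegral_comp_preimage_emb
      (Homeomorph.neg ℝ).measurableEmbedding F (Set.Iio 0)
    rw [← h]
    congr 2
    ext u; simp
  rw [h1, ← setLIntegral_congr (Iio_ae_eq_Iic (a := (0 : ℝ)) (μ := volume)).symm,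
    ← lintegral_add_compl F (measurableSet_Ioi (a := (0 : ℝ))), Set.compl_Ioi]

theorem lintegral_even (F : ℝ → ENNReal) (hF : ∀ u, F (-u) = F u) :
    ∫⁻ u, F u = 2 * ∫⁻ u in Set.Ioi 0, F u := by
  rw [lintegral_real_eq_Ioi]
  simp only [hF]
  rw [two_mul]

theorem two_sub_two_cos_nonneg (x : ℝ) : 0 ≤ 2 - 2 * Real.cos x := by
  linarith [Real.cos_le_one x]

theorem integral_exp_neg_mul_cos {t : ℝ} (ht : 0 < t) (ω : ℝ) :
    IntegrableOn (fun h => Real.exp (-(t * h)) * Real.cos (ω * h)) (Set.Ioi 0) ∧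
    ∫ h in Set.Ioi 0, Real.exp (-(t * h)) * Real.cos (ω * h) = t / (t ^ 2 + ω ^ 2) := by
  have hre : ∀ h : ℝ, Real.exp (-(t * h)) * Real.cos (ω * h) =
      RCLike.re (Complex.exp ((-t + ω * I) * h)) := by
    intro h
    rw [RCLike.re_eq_complex_re, Complex.exp_re]
    simp
  have ha : (-t + ω * I : ℂ).re < 0 := by simpa using ht
  have hi := integrableOn_exp_mul_complex_Ioi ha 0
  refine ⟨hi.re.congr (Filter.Eventually.of_forall fun h => (hre h).symm), ?_⟩
  simp only [hre]
  rw [integral_re hi, integral_exp_mul_complex_Ioi ha]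
  simp only [ofReal_zero, mul_zero, Complex.exp_zero, RCLike.re_eq_complex_re]
  rw [Complex.div_re, Complex.normSq_apply]
  simp
  rw [← sq, ← sq]

/-- The Laplace transform of `2 - 2 cos(ωh)`. -/
theorem lintegral_cos_exp {t : ℝ} (ht : 0 < t) (ω : ℝ) :
    ∫⁻ h in Set.Ioi 0, ENNReal.ofReal ((2 - 2 * Real.cos (ω * h)) * (t * Real.exp (-(t * h)))) =
      ENNReal.ofReal (2 * ω ^ 2 / (t ^ 2 + ω ^ 2)) := by
  obtain ⟨hi, hI⟩ := integral_exp_neg_mul_cos ht ω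
  obtain ⟨hi0, hI0⟩ := integral_exp_neg_mul_cos ht 0
  simp only [zero_mul, Real.cos_zero, mul_one] at hi0 hI0
  have h1 : ∀ h, (2 - 2 * Real.cos (ω * h)) * (t * Real.exp (-(t * h))) =
      2 * t * Real.exp (-(t * h)) - 2 * t * (Real.exp (-(t * h)) * Real.cos (ω * h)) := by
    intro h; ring
  rw [← ofReal_integral_eq_lintegral_ofReal]
  · congr 1
    simp only [h1]
    rw [integral_sub (hi0.const_mul _) (hi.const_mul _), integral_const_mul, integral_const_mul,
      hI, hI0]
    have : t ^ 2 + ω ^ 2 ≠ 0 := by positivity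
    field_simp
    ring
  · simp only [h1]
    exact (hi0.const_mul _).sub (hi.const_mul _)
  · refine Filter.Eventually.of_forall fun h => ?_
    exact mul_nonneg (two_sub_two_cos_nonneg _) (by positivity)

theorem lintegral_mul_exp_neg {h : ℝ} (hh : 0 < h) :
    ∫⁻ t in Set.Ioi 0, ENNReal.ofReal (t * Real.exp (-(t * h))) = ENNReal.ofReal (1 / h ^ 2) := by
  have h1 := Real.integral_rpow_mul_exp_neg_mul_Ioi (a := 2) (r := h) (by norm_num) hh
  have h2 : ∀ t : ℝ, t ^ ((2 : ℝ) - 1) * Real.exp (-(h * t)) = t * Real.exp (-(t * h)) := by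
    intro t
    rw [show (2 : ℝ) - 1 = 1 by norm_num, Real.rpow_one, mul_comm h t]
  simp only [h2] at h1
  rw [Real.Gamma_two, mul_one, Real.rpow_two, div_pow, one_pow] at h1
  rw [← h1, ofReal_integral_eq_lintegral_ofReal]
  · refine not_imp_comm.1 integral_undef ?_
    rw [h1]; positivity
  · filter_upwards [ae_restrict_mem measurableSet_Ioi] with t ht
    have : (0 : ℝ) < t := ht
    simp only [Pi.zero_apply]; positivity

theorem lintegral_inv_sq_add_sq {ω : ℝ} (hω : 0 < ω) :
    ∫⁻ t in Set.Ioi 0, ENNReal.ofReal (2 * ω ^ 2 / (t ^ 2 + ω ^ 2)) = ENNReal.ofReal (π * ω) := by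
  have h1 : ∀ t : ℝ, 2 * ω ^ 2 / (t ^ 2 + ω ^ 2) = 2 * (1 + (ω⁻¹ * t) ^ 2)⁻¹ := by
    intro t
    have : t ^ 2 + ω ^ 2 ≠ 0 := by positivity
    field_simp
    ring
  simp only [h1]
  rw [← ofReal_integral_eq_lintegral_ofReal]
  · congr 1
    rw [integral_const_mul, integral_comp_mul_left_Ioi (fun t => (1 + t ^ 2)⁻¹) 0 (inv_pos.2 hω),
      integral_Ioi_inv_one_add_sq]
    simp
    ring
  · refine Integrable.restrict ?_
    refine Integrable.const_mul ?_ _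
    exact integrable_inv_one_add_sq.comp_mul_left' (inv_ne_zero hω.ne')
  · exact Filter.Eventually.of_forall fun t => by simp only [Pi.zero_apply]; positivity

/-- `∫₀^∞ (2 - 2 cos(ωh)) / h² dh = π|ω|`. -/
theorem lintegral_cos_div_sq (ω : ℝ) :
    ∫⁻ h in Set.Ioi 0, ENNReal.ofReal (1 / h ^ 2 * (2 - 2 * Real.cos (ω * h))) =
      ENNReal.ofReal (π * |ω|) := by
  rcases eq_or_ne ω 0 with rfl | hω
  · simp
  have h0 : ∀ h : ℝ, Real.cos (ω * h) = Real.cos (|ω| * h) := by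
    intro h
    rcases abs_choice ω with h | h <;> rw [h]
    rw [neg_mul, Real.cos_neg]
  have hω' := abs_pos.2 hω
  simp only [h0]
  calc _ = ∫⁻ h in Set.Ioi 0, ∫⁻ t in Set.Ioi 0,
        ENNReal.ofReal ((2 - 2 * Real.cos (|ω| * h)) * (t * Real.exp (-(t * h)))) := by
        refine setLIntegral_congr_fun measurableSet_Ioi fun h hh => ?_
        simp only [ENNReal.ofReal_mul (two_sub_two_cos_nonneg _)]
        rw [lintegral_const_mul _ (by fun_prop), lintegral_mul_exp_neg hh,
          ← ENNReal.ofReal_mul (two_sub_two_cos_nonneg _), mul_comm]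
    _ = ∫⁻ t in Set.Ioi 0, ∫⁻ h in Set.Ioi 0,
        ENNReal.ofReal ((2 - 2 * Real.cos (|ω| * h)) * (t * Real.exp (-(t * h)))) := by
        refine lintegral_lintegral_swap (Measurable.aemeasurable ?_)
        unfold Function.uncurry
        fun_prop
    _ = ∫⁻ t in Set.Ioi 0, ENNReal.ofReal (2 * |ω| ^ 2 / (t ^ 2 + |ω| ^ 2)) :=
        setLIntegral_congr_fun measurableSet_Ioi fun t ht => lintegral_cos_exp ht _
    _ = _ := lintegral_inv_sq_add_sq hω'

/-- The hyperbolic cotangent. -/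
def coth (x : ℝ) : ℝ := Real.cosh x / Real.sinh x

/-- The Mittag-Leffler expansion of the hyperbolic cotangent. -/
theorem hasSum_coth {Ω : ℝ} (hΩ : Ω ≠ 0) :
    HasSum (fun n : ℕ => 2 * Ω ^ 2 / ((n + 1 : ℝ) ^ 2 + Ω ^ 2)) (π * Ω * coth (π * Ω) - 1) := by
  have hx : (I * Ω : ℂ) ∈ Complex.integerComplement := by
    rintro ⟨n, hn⟩
    have := congrArg Complex.im hn
    simp at this
    exact hΩ this.symm
  have h1 := (summable_cotTerm hx).hasSum
  rw [show ∑' n, cotTerm (I * Ω) n = _ from (cot_series_rep' hx).symm] at h1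
  have h2 := h1.mul_left (I * Ω)
  have hΩ' : (Ω : ℂ) ≠ 0 := by exact_mod_cast hΩ
  have e1 : ∀ n : ℕ, I * Ω * cotTerm (I * Ω) n =
      ((2 * Ω ^ 2 / ((n + 1 : ℝ) ^ 2 + Ω ^ 2) : ℝ) : ℂ) := by
    intro n
    have hp : ((n + 1 : ℝ) ^ 2 + Ω ^ 2) ≠ 0 := by positivity
    have hp' : ((n + 1 : ℂ) ^ 2 + Ω ^ 2) ≠ 0 := by exact_mod_cast hp
    have ha : (I * Ω - (n + 1) : ℂ) ≠ 0 := fun h => by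
      have := congrArg Complex.im h
      simp at this
      exact hΩ this
    have hb : (I * Ω + (n + 1) : ℂ) ≠ 0 := fun h => by
      have := congrArg Complex.im h
      simp at this
      exact hΩ this
    push_cast
    rw [cotTerm]
    field_simp
    linear_combination (2 * (Ω : ℂ) * (n + 1) ^ 2) * I_sq
  have e2 : I * Ω * (π * Complex.cot (π * (I * Ω)) - 1 / (I * Ω)) =
      ((π * Ω * coth (π * Ω) - 1 : ℝ) : ℂ) := by
    have hs : (Real.sinh (π * Ω) : ℂ) ≠ 0 := by
      have : Real.sinh (π * Ω) ≠ 0 := fun h => by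
        rw [Real.sinh_eq_zero] at h
        exact hΩ ((mul_eq_zero.1 h).resolve_left Real.pi_ne_zero)
      exact_mod_cast this
    rw [Complex.cot, show (π * (I * Ω) : ℂ) = ((π * Ω : ℝ) : ℂ) * I by push_cast; ring,
      Complex.cos_mul_I, Complex.sin_mul_I, ← Complex.ofReal_sinh, ← Complex.ofReal_cosh, coth]
    push_cast
    have hs' : Complex.sinh (π * Ω) ≠ 0 := by
      rw [← ofReal_mul, ← Complex.ofReal_sinh]; exact hs
    field_simp
  simp only [e1] at h2
  rw [e2] at h2
  exact_mod_cast h2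

/-- The expansion `1 / (4 sinh²(h/2)) = ∑ n e^{-nh}`, which reduces the integrals against the
`1 / sinh²` kernel to Laplace transforms of `1 - cos`. -/
theorem tsum_mul_exp {h : ℝ} (hh : 0 < h) :
    ∑' n : ℕ, ENNReal.ofReal ((n + 1 : ℝ) * Real.exp (-((n + 1 : ℝ) * h))) =
      ENNReal.ofReal (1 / (4 * Real.sinh (h / 2) ^ 2)) := by
  have hr : ‖Real.exp (-h)‖ < 1 := by
    rw [Real.norm_eq_abs, abs_of_pos (Real.exp_pos _), Real.exp_lt_one_iff]; linarith
  have h1 := hasSum_coe_mul_geometric_of_norm_lt_one hr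
  rw [← hasSum_nat_add_iff' 1] at h1
  simp only [Finset.range_one, Finset.sum_singleton, Nat.cast_zero, zero_mul, sub_zero] at h1
  have e : ∀ n : ℕ, ((n + 1 : ℕ) : ℝ) * Real.exp (-h) ^ (n + 1) =
      (n + 1 : ℝ) * Real.exp (-((n + 1 : ℝ) * h)) := by
    intro n
    rw [← Real.exp_nat_mul]; push_cast; ring_nf
  simp only [e] at h1
  have e2 : Real.exp (-h) / (1 - Real.exp (-h)) ^ 2 = 1 / (4 * Real.sinh (h / 2) ^ 2) := by
    have h2 : Real.exp (-h) = Real.exp (-(h / 2)) ^ 2 := by rw [← Real.exp_nat_mul]; congr 1; push_cast; ring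
    have h3 : Real.exp (h / 2) * Real.exp (-(h / 2)) = 1 := by rw [← Real.exp_add]; simp
    have hlt : Real.exp (-(h / 2)) < 1 := by rw [Real.exp_lt_one_iff]; linarith
    have hgt : 1 < Real.exp (h / 2) := by rw [Real.one_lt_exp_iff]; linarith
    rw [Real.sinh_eq, h2]
    set a := Real.exp (-(h / 2))
    set b := Real.exp (h / 2)
    have ha : 0 < a := Real.exp_pos _
    have n1 : 1 - a ^ 2 ≠ 0 := by nlinarith
    have n2 : b - a ≠ 0 := by linarith
    rw [div_eq_div_iff (by positivity) (by positivity)]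
    have : 1 - a ^ 2 = a * (b - a) := by linear_combination (-1 : ℝ) * h3
    rw [this]; ring
  rw [e2] at h1
  rw [← h1.tsum_eq, ENNReal.ofReal_tsum_of_nonneg (fun n => by positivity) h1.summable]

/-- `∫₀^∞ (2 - 2 cos(Ωh)) / (4 sinh²(h/2)) dh = πΩ coth(πΩ) - 1`. -/
theorem lintegral_cos_div_sinh_sq {Ω : ℝ} (hΩ : Ω ≠ 0) :
    ∫⁻ h in Set.Ioi 0,
        ENNReal.ofReal (1 / (4 * Real.sinh (h / 2) ^ 2) * (2 - 2 * Real.cos (Ω * h))) =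
      ENNReal.ofReal (π * Ω * coth (π * Ω) - 1) := by
  have hs := hasSum_coth hΩ
  calc _ = ∫⁻ h in Set.Ioi 0, ∑' n : ℕ, ENNReal.ofReal ((2 - 2 * Real.cos (Ω * h)) *
          ((n + 1 : ℝ) * Real.exp (-((n + 1 : ℝ) * h)))) := by
        refine setLIntegral_congr_fun measurableSet_Ioi fun h hh => ?_
        simp only [ENNReal.ofReal_mul (two_sub_two_cos_nonneg _)]
        rw [ENNReal.tsum_mul_left, tsum_mul_exp hh, mul_comm,
          ENNReal.ofReal_mul (two_sub_two_cos_nonneg _)]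
    _ = ∑' n : ℕ, ∫⁻ h in Set.Ioi 0, ENNReal.ofReal ((2 - 2 * Real.cos (Ω * h)) *
          ((n + 1 : ℝ) * Real.exp (-((n + 1 : ℝ) * h)))) :=
        lintegral_tsum fun n => Measurable.aemeasurable (by fun_prop)
    _ = ∑' n : ℕ, ENNReal.ofReal (2 * Ω ^ 2 / ((n + 1 : ℝ) ^ 2 + Ω ^ 2)) :=
        tsum_congr fun n => lintegral_cos_exp (by positivity) _
    _ = _ := by
        rw [← hs.tsum_eq, ENNReal.ofReal_tsum_of_nonneg (fun n => by positivity) hs.summable]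

theorem lintegral_Ioi_comp_mul {a : ℝ} (ha : 0 < a) (F : ℝ → ENNReal) :
    ∫⁻ u in Set.Ioi 0, F u = ENNReal.ofReal a * ∫⁻ u in Set.Ioi 0, F (a * u) := by
  have h := lintegral_image_eq_lintegral_abs_deriv_mul (measurableSet_Ioi (a := (0 : ℝ)))
    (f := fun u => a * u) (f' := fun _ => a)
    (fun u _ => by simpa using ((hasDerivAt_id u).const_mul a).hasDerivWithinAt)
    (fun u _ v _ h => mul_left_cancel₀ ha.ne' h) F
  have h2 : (fun u => a * u) '' Set.Ioi (0 : ℝ) = Set.Ioi 0 := by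
    rw [Set.image_mul_left_Ioi ha, mul_zero]
  rw [h2] at h
  rw [h, lintegral_const_mul' _ _ ENNReal.ofReal_ne_top, abs_of_pos ha]

/-- `∫₀^∞ (2 - 2 cos(Ωh)) / sinh² h dh = πΩ coth(πΩ/2) - 2`. -/
theorem lintegral_cos_div_sinh_sq' {Ω : ℝ} (hΩ : Ω ≠ 0) :
    ∫⁻ h in Set.Ioi 0, ENNReal.ofReal (1 / Real.sinh h ^ 2 * (2 - 2 * Real.cos (Ω * h))) =
      ENNReal.ofReal (π * Ω * coth (π * Ω / 2) - 2) := by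
  have h := lintegral_cos_div_sinh_sq (Ω := Ω / 2) (by simpa using hΩ)
  rw [lintegral_Ioi_comp_mul two_pos, ← ENNReal.mul_right_inj (a := 2) (by simp) (by simp)] at h
  rw [← lintegral_const_mul' _ _ (by simp), ← lintegral_const_mul' _ _ (by simp)] at h
  have e : 2 * ENNReal.ofReal (π * (Ω / 2) * coth (π * (Ω / 2)) - 1) =
      ENNReal.ofReal (π * Ω * coth (π * Ω / 2) - 2) := by
    rw [show (2 : ENNReal) = ENNReal.ofReal 2 by simp, ← ENNReal.ofReal_mul (by norm_num)]
    congr 1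
    rw [show π * (Ω / 2) = π * Ω / 2 by ring]; ring
  rw [e] at h
  rw [← h]
  refine lintegral_congr fun x => ?_
  rw [show (2 : ENNReal) = ENNReal.ofReal 2 by simp, ← ENNReal.ofReal_mul (by norm_num),
    ← ENNReal.ofReal_mul (by norm_num)]
  congr 1
  rw [show 2 * x / 2 = x by ring, show Ω / 2 * (2 * x) = Ω * x by ring]
  ring

/-- `∫ 1/(4 cosh²(h/2)) dh = 1`. -/
theorem lintegral_inv_cosh_sq :
    ∫⁻ h, ENNReal.ofReal (1 / (4 * Real.cosh (h / 2) ^ 2)) = 1 := by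
  rw [lintegral_even _ fun h => by rw [neg_div, Real.cosh_neg]]
  have hd : ∀ h : ℝ, HasDerivAt (fun h => -(Real.exp h + 1)⁻¹)
      (1 / (4 * Real.cosh (h / 2) ^ 2)) h := by
    intro h
    have hp : Real.exp h + 1 ≠ 0 := by positivity
    have h1 : HasDerivAt (fun h => -(Real.exp h + 1)⁻¹) (-(-Real.exp h / (Real.exp h + 1) ^ 2)) h :=
      (((Real.hasDerivAt_exp h).add_const 1).inv hp).neg
    refine h1.congr_deriv ?_
    have e1 : Real.exp h = Real.exp (h / 2) ^ 2 := by
      rw [← Real.exp_nat_mul]; congr 1; push_cast; ring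
    have e2 : Real.exp (-(h / 2)) = (Real.exp (h / 2))⁻¹ := Real.exp_neg _
    rw [Real.cosh_eq, e2, e1]
    have := Real.exp_pos (h / 2)
    field_simp
    ring
  have hpos : ∀ h ∈ Set.Ioi (0 : ℝ), 0 ≤ 1 / (4 * Real.cosh (h / 2) ^ 2) := fun h _ => by positivity
  have hlim : Filter.Tendsto (fun h : ℝ => -(Real.exp h + 1)⁻¹) Filter.atTop (nhds (-0)) :=
    (Filter.Tendsto.inv_tendsto_atTop
      (Filter.tendsto_atTop_add_const_right _ _ Real.tendsto_exp_atTop)).neg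
  have hI := integral_Ioi_of_hasDerivAt_of_nonneg' (a := 0) (fun h _ => hd h) hpos hlim
  have hi := integrableOn_Ioi_deriv_of_nonneg' (a := 0) (fun h _ => hd h) hpos hlim
  rw [← ofReal_integral_eq_lintegral_ofReal hi
    ((ae_restrict_mem measurableSet_Ioi).mono fun h hh => hpos h hh), hI]
  norm_num
  rw [show (2 : ENNReal) = ENNReal.ofReal 2 by simp, ← ENNReal.ofReal_mul (by norm_num)]
  norm_num

end Kernels

/-! ### The one-particle norm of a field on a half-line in terms of its thermal modes -/

section Gagliardo

variable {f : ℝ → ℝ}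

theorem norm_sq_exp_sub_one (x : ℝ) : ‖Complex.exp (-(I * x)) - 1‖ ^ 2 = 2 - 2 * Real.cos x := by
  rw [← Complex.normSq_eq_norm_sq, Complex.normSq_apply, Complex.sub_re, Complex.sub_im,
    Complex.exp_re, Complex.exp_im]
  simp
  nlinarith [Real.sin_sq_add_cos_sq x]

/-- A Gagliardo-type double integral: Tonelli's theorem in the variable `h = v - u`, and
Plancherel's theorem for the difference `f(· + h) - f`. -/
theorem lintegral_gagliardo (hf : ContDiff ℝ (⊤ : ℕ∞) f) (hc : HasCompactSupport f) {k : ℝ → ℝ}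
    (hk : Measurable k) (hk0 : ∀ h, 0 ≤ k h) :
    ∫⁻ u, ∫⁻ v, ENNReal.ofReal (k (v - u) * (f v - f u) ^ 2) =
      ENNReal.ofReal (2 * π)⁻¹ * ∫⁻ ω, ENNReal.ofReal (‖ft f ω‖ ^ 2) *
        ∫⁻ h, ENNReal.ofReal (k h * (2 - 2 * Real.cos (ω * h))) := by
  have hfc := hf.continuous
  have hft := continuous_ft hfc hc
  have h2π : ENNReal.ofReal (2 * π)⁻¹ * ENNReal.ofReal (2 * π) = 1 := by
    rw [← ENNReal.ofReal_mul (by positivity), inv_mul_cancel₀ (by positivity), ENNReal.ofReal_one]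
  have key : ∀ h : ℝ, ∫⁻ u, ENNReal.ofReal ((f (u + h) - f u) ^ 2) =
      ENNReal.ofReal (2 * π)⁻¹ *
        ∫⁻ ω, ENNReal.ofReal (‖ft f ω‖ ^ 2) * ENNReal.ofReal (2 - 2 * Real.cos (ω * h)) := by
    intro h
    have hs : ContDiff ℝ (⊤ : ℕ∞) fun u => f (u + h) := hf.comp (by fun_prop)
    have hcs : HasCompactSupport fun u => f (u + h) :=
      hc.comp_homeomorph (Homeomorph.addRight h)
    have h1 := lintegral_norm_sq_ft (hs.sub hf) (hcs.sub hc)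
    have h2 : ∀ ω, ‖ft (fun u => f (u + h) - f u) ω‖ ^ 2 =
        ‖ft f ω‖ ^ 2 * (2 - 2 * Real.cos (ω * h)) := by
      intro ω
      rw [ft_sub hs.continuous hcs hfc hc, ft_translate, ← sub_one_mul, norm_mul, mul_pow, mul_comm,
        ← norm_sq_exp_sub_one]
      push_cast
      rw [mul_assoc]
    have h3 : ∀ ω, ENNReal.ofReal (‖ft f ω‖ ^ 2) * ENNReal.ofReal (2 - 2 * Real.cos (ω * h)) =
        ENNReal.ofReal (‖ft (fun u => f (u + h) - f u) ω‖ ^ 2) := fun ω => by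
      rw [h2, ENNReal.ofReal_mul (by positivity)]
    simp only [h3]
    erw [h1]
    rw [← mul_assoc, h2π, one_mul]
  calc _ = ∫⁻ u, ∫⁻ h, ENNReal.ofReal (k h * (f (u + h) - f u) ^ 2) := by
        refine lintegral_congr fun u => ?_
        rw [← lintegral_add_left_eq_self _ u]
        simp
    _ = ∫⁻ h, ∫⁻ u, ENNReal.ofReal (k h * (f (u + h) - f u) ^ 2) := by
        refine lintegral_lintegral_swap (Measurable.aemeasurable ?_)
        unfold Function.uncurry
        fun_prop
    _ = ∫⁻ h, ∫⁻ ω, ENNReal.ofReal (2 * π)⁻¹ * (ENNReal.ofReal (‖ft f ω‖ ^ 2) *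
          ENNReal.ofReal (k h * (2 - 2 * Real.cos (ω * h)))) := by
        refine lintegral_congr fun h => ?_
        simp only [ENNReal.ofReal_mul (hk0 h)]
        rw [lintegral_const_mul' _ _ ENNReal.ofReal_ne_top, key,
          lintegral_const_mul' _ _ ENNReal.ofReal_ne_top, mul_left_comm,
          ← lintegral_const_mul' _ _ ENNReal.ofReal_ne_top]
        congr 1
        refine lintegral_congr fun ω => ?_
        ring
    _ = ∫⁻ ω, ∫⁻ h, ENNReal.ofReal (2 * π)⁻¹ * (ENNReal.ofReal (‖ft f ω‖ ^ 2) *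
          ENNReal.ofReal (k h * (2 - 2 * Real.cos (ω * h)))) := by
        refine lintegral_lintegral_swap (Measurable.aemeasurable ?_)
        unfold Function.uncurry
        fun_prop
    _ = _ := by
        rw [← lintegral_const_mul' _ _ ENNReal.ofReal_ne_top]
        refine lintegral_congr fun ω => ?_
        rw [lintegral_const_mul' _ _ ENNReal.ofReal_ne_top,
          lintegral_const_mul' _ _ ENNReal.ofReal_ne_top]

theorem lintegral_inv_sq_mul_sub_sq (hf : ContDiff ℝ (⊤ : ℕ∞) f) (hc : HasCompactSupport f) :
    ∫⁻ u, ∫⁻ v, ENNReal.ofReal (1 / (v - u) ^ 2 * (f v - f u) ^ 2) =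
      2 * ∫⁻ ω in Set.Ioi 0, ENNReal.ofReal (ω * ‖ft f ω‖ ^ 2) := by
  rw [lintegral_gagliardo hf hc (k := fun h => 1 / h ^ 2) (by fun_prop) (fun h => by positivity),
    ← lintegral_const_mul' _ _ ENNReal.ofReal_ne_top]
  have h : ∀ ω : ℝ, ENNReal.ofReal (2 * π)⁻¹ * (ENNReal.ofReal (‖ft f ω‖ ^ 2) *
      ∫⁻ h, ENNReal.ofReal (1 / h ^ 2 * (2 - 2 * Real.cos (ω * h)))) =
      ENNReal.ofReal (|ω| * ‖ft f ω‖ ^ 2) := by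
    intro ω
    rw [lintegral_even _ (fun h => by simp), lintegral_cos_div_sq,
      show (2 : ENNReal) = ENNReal.ofReal 2 by simp, ← ENNReal.ofReal_mul (by norm_num),
      ← ENNReal.ofReal_mul (by positivity), ← ENNReal.ofReal_mul (by positivity)]
    congr 1
    field_simp
  simp only [h]
  rw [lintegral_even _ (fun ω => by rw [abs_neg, norm_ft_neg])]
  congr 1
  refine setLIntegral_congr_fun measurableSet_Ioi fun ω hω => ?_
  rw [abs_of_pos hω]

theorem lintegral_Ioi_exp (G : ℝ → ENNReal) :
    ∫⁻ u in Set.Ioi 0, G u = ∫⁻ τ, ENNReal.ofReal (Real.exp τ) * G (Real.exp τ) := by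
  have h := lintegral_image_eq_lintegral_deriv_mul_of_monotoneOn MeasurableSet.univ
    (f := Real.exp) (f' := Real.exp) (fun u _ => (Real.hasDerivAt_exp u).hasDerivWithinAt)
    (Real.exp_monotone.monotoneOn _) G
  rwa [Set.image_univ, Real.range_exp, setLIntegral_univ] at h

theorem exp_mul_exp_div_sub_sq (s t : ℝ) :
    Real.exp s * (Real.exp t * (1 / (Real.exp t - Real.exp s) ^ 2)) =
      1 / (4 * Real.sinh ((t - s) / 2) ^ 2) := by
  have e1 : Real.exp s = Real.exp (s / 2) ^ 2 := by
    rw [← Real.exp_nat_mul]; congr 1; push_cast; ring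
  have e2 : Real.exp t = Real.exp (t / 2) ^ 2 := by
    rw [← Real.exp_nat_mul]; congr 1; push_cast; ring
  have ha := Real.exp_pos (s / 2)
  have hb := Real.exp_pos (t / 2)
  rw [Real.sinh_eq, Real.exp_neg, e1, e2, sub_div t s, Real.exp_sub, inv_div]
  set a := Real.exp (s / 2)
  set b := Real.exp (t / 2)
  have h4 : 4 * ((b / a - a / b) / 2) ^ 2 = (b ^ 2 - a ^ 2) ^ 2 / (a ^ 2 * b ^ 2) := by
    field_simp
    ring
  rw [h4, one_div_div]
  ring

theorem exp_mul_exp_div_add_sq (s t : ℝ) :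
    Real.exp s * (Real.exp t * (1 / (Real.exp t + Real.exp s) ^ 2)) =
      1 / (4 * Real.cosh ((t - s) / 2) ^ 2) := by
  have e1 : Real.exp s = Real.exp (s / 2) ^ 2 := by
    rw [← Real.exp_nat_mul]; congr 1; push_cast; ring
  have e2 : Real.exp t = Real.exp (t / 2) ^ 2 := by
    rw [← Real.exp_nat_mul]; congr 1; push_cast; ring
  have ha := Real.exp_pos (s / 2)
  have hb := Real.exp_pos (t / 2)
  rw [Real.cosh_eq, Real.exp_neg, e1, e2, sub_div t s, Real.exp_sub, inv_div]
  set a := Real.exp (s / 2)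
  set b := Real.exp (t / 2)
  have h4 : 4 * ((b / a + a / b) / 2) ^ 2 = (b ^ 2 + a ^ 2) ^ 2 / (a ^ 2 * b ^ 2) := by
    field_simp
    ring
  rw [h4, one_div_div]
  ring

theorem lintegral_lintegral_exp {Φ : ℝ → ℝ → ENNReal} (hm : Measurable fun p : ℝ × ℝ => Φ p.1 p.2) :
    ∫⁻ u, ∫⁻ v, Φ u v = ∫⁻ s, ∫⁻ t, ENNReal.ofReal (Real.exp s) * (ENNReal.ofReal (Real.exp t) *
        ((Φ (Real.exp s) (Real.exp t) + Φ (Real.exp s) (-Real.exp t)) +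
          (Φ (-Real.exp s) (Real.exp t) + Φ (-Real.exp s) (-Real.exp t)))) := by
  have hm1 : ∀ u, Measurable (Φ u) := fun u => hm.comp measurable_prodMk_left
  have hm2 : ∀ u, Measurable fun v => Φ u (-v) := fun u => (hm1 u).comp measurable_neg
  have hm3 : Measurable fun p : ℝ × ℝ => Φ p.1 p.2 + Φ p.1 (-p.2) :=
    hm.add (hm.comp (measurable_fst.prodMk measurable_snd.neg))
  have h0 : ∀ u, ∫⁻ v, Φ u v = ∫⁻ v in Set.Ioi 0, (Φ u v + Φ u (-v)) := by
    intro u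
    rw [lintegral_real_eq_Ioi, lintegral_add_left (hm1 u)]
  calc _ = ∫⁻ u, ∫⁻ v in Set.Ioi 0, (Φ u v + Φ u (-v)) := lintegral_congr h0
    _ = ∫⁻ u in Set.Ioi 0, ∫⁻ v in Set.Ioi 0,
        ((Φ u v + Φ u (-v)) + (Φ (-u) v + Φ (-u) (-v))) := by
        rw [lintegral_real_eq_Ioi, ← lintegral_add_left hm3.lintegral_prod_right']
        refine lintegral_congr fun u => ?_
        exact (lintegral_add_left ((hm1 u).add (hm2 u)) _).symm
    _ = _ := by
        rw [lintegral_Ioi_exp]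
        refine lintegral_congr fun s => ?_
        rw [lintegral_Ioi_exp, lintegral_const_mul' _ _ ENNReal.ofReal_ne_top]

/-- The double integral over the line, as an integral over the logarithms of the distances from
the origin, to the right (`F (exp τ)`) and to the left (`F (-exp τ)`). -/
theorem lintegral_inv_sq_mul_sub_sq_exp {F : ℝ → ℝ} (hF : Continuous F) :
    ∫⁻ u, ∫⁻ v, ENNReal.ofReal (1 / (v - u) ^ 2 * (F v - F u) ^ 2) =
      ∫⁻ s, ∫⁻ t, ENNReal.ofReal (
        1 / (4 * Real.sinh ((t - s) / 2) ^ 2) *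
          ((F (Real.exp t) - F (Real.exp s)) ^ 2 + (F (-Real.exp t) - F (-Real.exp s)) ^ 2) +
        1 / (4 * Real.cosh ((t - s) / 2) ^ 2) *
          ((F (-Real.exp t) - F (Real.exp s)) ^ 2 + (F (Real.exp t) - F (-Real.exp s)) ^ 2)) := by
  rw [lintegral_lintegral_exp (Φ := fun u v => ENNReal.ofReal (1 / (v - u) ^ 2 * (F v - F u) ^ 2))
    (by fun_prop)]
  refine lintegral_congr fun s => lintegral_congr fun t => ?_
  rw [← ENNReal.ofReal_add (by positivity) (by positivity),
    ← ENNReal.ofReal_add (by positivity) (by positivity),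
    ← ENNReal.ofReal_add (by positivity) (by positivity),
    ← ENNReal.ofReal_mul (Real.exp_nonneg _), ← ENNReal.ofReal_mul (Real.exp_nonneg _),
    ← exp_mul_exp_div_sub_sq, ← exp_mul_exp_div_add_sq]
  congr 1
  rw [show (-Real.exp t - Real.exp s) ^ 2 = (Real.exp t + Real.exp s) ^ 2 by ring,
    show (Real.exp t - -Real.exp s) ^ 2 = (Real.exp t + Real.exp s) ^ 2 by ring,
    show (-Real.exp t - -Real.exp s) ^ 2 = (Real.exp t - Real.exp s) ^ 2 by ring]
  ring

theorem lintegral_cosh_mul_sq {ψ : ℝ → ℝ} (hψ : Continuous ψ) :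
    ∫⁻ s, ∫⁻ t, ENNReal.ofReal (1 / (4 * Real.cosh ((t - s) / 2) ^ 2) * (ψ t ^ 2 + ψ s ^ 2)) =
      2 * ∫⁻ s, ENNReal.ofReal (ψ s ^ 2) := by
  have h1 : ∀ s, ∫⁻ t, ENNReal.ofReal (1 / (4 * Real.cosh ((t - s) / 2) ^ 2) * ψ s ^ 2) =
      ENNReal.ofReal (ψ s ^ 2) := by
    intro s
    simp only [mul_comm _ (ψ s ^ 2), ENNReal.ofReal_mul (sq_nonneg (ψ s))]
    rw [lintegral_const_mul' _ _ ENNReal.ofReal_ne_top,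
      lintegral_sub_right_eq_self (fun h => ENNReal.ofReal (1 / (4 * Real.cosh (h / 2) ^ 2))) s,
      lintegral_inv_cosh_sq, mul_one]
  have h2 : ∀ t, ∫⁻ s, ENNReal.ofReal (1 / (4 * Real.cosh ((t - s) / 2) ^ 2) * ψ t ^ 2) =
      ENNReal.ofReal (ψ t ^ 2) := by
    intro t
    rw [← h1 t]
    refine lintegral_congr fun s => ?_
    rw [show (t - s) / 2 = -((s - t) / 2) by ring, Real.cosh_neg]
  have hK : Continuous fun p : ℝ × ℝ => 1 / (4 * Real.cosh ((p.2 - p.1) / 2) ^ 2) := by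
    refine Continuous.div continuous_const (by fun_prop) fun p => ?_
    have := Real.cosh_pos ((p.2 - p.1) / 2)
    positivity
  have hma : Measurable fun p : ℝ × ℝ =>
      ENNReal.ofReal (1 / (4 * Real.cosh ((p.2 - p.1) / 2) ^ 2) * ψ p.2 ^ 2) := by fun_prop
  calc _ = ∫⁻ s, ((∫⁻ t, ENNReal.ofReal (1 / (4 * Real.cosh ((t - s) / 2) ^ 2) * ψ t ^ 2)) +
        ∫⁻ t, ENNReal.ofReal (1 / (4 * Real.cosh ((t - s) / 2) ^ 2) * ψ s ^ 2)) := by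
        refine lintegral_congr fun s => ?_
        refine Eq.trans ?_ (lintegral_add_left (hma.comp (measurable_prodMk_left (x := s))) _)
        refine lintegral_congr fun t => ?_
        simp only [Function.comp_def]
        rw [mul_add, ENNReal.ofReal_add (by positivity) (by positivity)]
    _ = (∫⁻ s, ∫⁻ t, ENNReal.ofReal (1 / (4 * Real.cosh ((t - s) / 2) ^ 2) * ψ t ^ 2)) +
        ∫⁻ s, ENNReal.ofReal (ψ s ^ 2) := by
        simp only [h1]
        rw [lintegral_add_left hma.lintegral_prod_right']
    _ = _ := by
        rw [lintegral_lintegral_swap hma.aemeasurable]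
        simp only [h2]
        rw [two_mul]

theorem one_le_mul_coth {Ω : ℝ} (hΩ : Ω ≠ 0) : 1 ≤ π * Ω * coth (π * Ω) := by
  have := (hasSum_coth hΩ).nonneg fun n => by positivity
  linarith

/-- A test function of `u` supported in `(0, ∞)` is a test function of `τ = ln u`. -/
theorem comp_exp_test {f : ℝ → ℝ} (hf : ContDiff ℝ (⊤ : ℕ∞) f) {K : Set ℝ} (hK : IsCompact K)
    (hK0 : K ⊆ Set.Ioi 0) (hz : ∀ u ∉ K, f u = 0) :
    ContDiff ℝ (⊤ : ℕ∞) (fun τ => f (Real.exp τ)) ∧ HasCompactSupport fun τ => f (Real.exp τ) := by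
  refine ⟨hf.comp Real.contDiff_exp, HasCompactSupport.intro
    (hK.image_of_continuousOn (Real.continuousOn_log.mono fun u hu => (hK0 hu).ne')) fun τ hτ => ?_⟩
  exact hz _ fun h => hτ ⟨_, h, Real.log_exp τ⟩

/-- The one-particle norm of a field on the half-line is its thermal norm. -/
theorem lintegral_ft_eq_thermal {f : ℝ → ℝ} (hf : ContDiff ℝ (⊤ : ℕ∞) f) {K : Set ℝ}
    (hK : IsCompact K) (hK0 : K ⊆ Set.Ioi 0) (hz : ∀ u ∉ K, f u = 0) :
    ∫⁻ ω in Set.Ioi 0, ENNReal.ofReal (ω * ‖ft f ω‖ ^ 2) =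
      ∫⁻ Ω in Set.Ioi 0,
        ENNReal.ofReal (Ω * coth (π * Ω) * ‖ft (fun τ => f (Real.exp τ)) Ω‖ ^ 2) := by
  obtain ⟨hψ, hψc⟩ := comp_exp_test hf hK hK0 hz
  set ψ := fun τ => f (Real.exp τ) with hψd
  have h1 := lintegral_inv_sq_mul_sub_sq hf (HasCompactSupport.intro hK hz)
  rw [lintegral_inv_sq_mul_sub_sq_exp hf.continuous] at h1
  have hneg : ∀ t, f (-Real.exp t) = 0 := fun t => hz _ fun h => by
    have := hK0 h
    have h2 := Real.exp_pos t
    simp only [Set.mem_Ioi] at this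
    linarith
  simp only [hneg, sub_self, sub_zero, zero_sub, neg_sq, add_zero, ne_eq, OfNat.ofNat_ne_zero,
    not_false_eq_true, zero_pow] at h1
  have hψm := hψ.continuous
  have hm1 : Measurable fun p : ℝ × ℝ => ENNReal.ofReal (
      1 / (4 * Real.sinh ((p.2 - p.1) / 2) ^ 2) * (ψ p.2 - ψ p.1) ^ 2) := by fun_prop
  have h2 : ∫⁻ s, ∫⁻ t, ENNReal.ofReal (
        1 / (4 * Real.sinh ((t - s) / 2) ^ 2) * (f (Real.exp t) - f (Real.exp s)) ^ 2 +
        1 / (4 * Real.cosh ((t - s) / 2) ^ 2) * (f (Real.exp s) ^ 2 + f (Real.exp t) ^ 2)) =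
      (∫⁻ s, ∫⁻ t, ENNReal.ofReal (
        1 / (4 * Real.sinh ((t - s) / 2) ^ 2) * (ψ t - ψ s) ^ 2)) +
      ∫⁻ s, ∫⁻ t, ENNReal.ofReal (
        1 / (4 * Real.cosh ((t - s) / 2) ^ 2) * (ψ t ^ 2 + ψ s ^ 2)) := by
    rw [← lintegral_add_left hm1.lintegral_prod_right']
    refine lintegral_congr fun s => ?_
    refine Eq.trans ?_ (lintegral_add_left (hm1.comp (measurable_prodMk_left (x := s))) _)
    refine lintegral_congr fun t => ?_
    simp only [Function.comp_def]
    rw [← ENNReal.ofReal_add (by positivity) (by positivity), add_comm (ψ t ^ 2)]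
  have h2π : ENNReal.ofReal (2 * π)⁻¹ * ENNReal.ofReal (2 * π) = 1 := by
    rw [← ENNReal.ofReal_mul (by positivity), inv_mul_cancel₀ (by positivity), ENNReal.ofReal_one]
  have hP : ∫⁻ s, ENNReal.ofReal (ψ s ^ 2) =
      ENNReal.ofReal (2 * π)⁻¹ * ∫⁻ ω, ENNReal.ofReal (‖ft ψ ω‖ ^ 2) := by
    rw [lintegral_norm_sq_ft hψ hψc, ← mul_assoc, h2π, one_mul]
  have hftm := (continuous_ft hψm hψc).measurable
  rw [h2, lintegral_cosh_mul_sq hψm, hP, lintegral_gagliardo hψ hψc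
    (k := fun h => 1 / (4 * Real.sinh (h / 2) ^ 2)) (by fun_prop) (fun h => by positivity),
    mul_left_comm, ← mul_add, ← lintegral_const_mul' _ _ (by simp),
    ← lintegral_add_right _ (by fun_prop), ← lintegral_const_mul' _ _ ENNReal.ofReal_ne_top] at h1
  have h3 : ∀ Ω : ℝ, Ω ≠ 0 → ENNReal.ofReal (2 * π)⁻¹ * (ENNReal.ofReal (‖ft ψ Ω‖ ^ 2) *
      (∫⁻ h, ENNReal.ofReal (1 / (4 * Real.sinh (h / 2) ^ 2) * (2 - 2 * Real.cos (Ω * h)))) +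
        2 * ENNReal.ofReal (‖ft ψ Ω‖ ^ 2)) =
      ENNReal.ofReal (Ω * coth (π * Ω) * ‖ft ψ Ω‖ ^ 2) := by
    intro Ω hΩ
    have h1 := one_le_mul_coth hΩ
    rw [lintegral_even _ (fun h => by simp [neg_div]), lintegral_cos_div_sinh_sq hΩ,
      show (2 : ENNReal) = ENNReal.ofReal 2 by simp, ← ENNReal.ofReal_mul (by norm_num),
      ← ENNReal.ofReal_mul (by positivity), ← ENNReal.ofReal_mul (by norm_num),
      ← ENNReal.ofReal_add (mul_nonneg (by positivity) (by linarith)) (by positivity),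
      ← ENNReal.ofReal_mul (by positivity)]
    congr 1
    field_simp
    ring
  have h4 : ∫⁻ Ω, ENNReal.ofReal (2 * π)⁻¹ * (ENNReal.ofReal (‖ft ψ Ω‖ ^ 2) *
      (∫⁻ h, ENNReal.ofReal (1 / (4 * Real.sinh (h / 2) ^ 2) * (2 - 2 * Real.cos (Ω * h)))) +
        2 * ENNReal.ofReal (‖ft ψ Ω‖ ^ 2)) =
      ∫⁻ Ω, ENNReal.ofReal (Ω * coth (π * Ω) * ‖ft ψ Ω‖ ^ 2) := by
    refine lintegral_congr_ae ?_
    filter_upwards [Measure.ae_ne volume (0 : ℝ)] with Ω hΩ using h3 Ω hΩ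
  rw [h4, lintegral_even _ (fun Ω => by
    rw [norm_ft_neg, coth, coth, mul_neg, Real.cosh_neg, Real.sinh_neg, div_neg, neg_mul_neg])] at h1
  exact ((ENNReal.mul_right_inj (by simp) (by simp)).1 h1).symm

/-- For an odd field the pairs of points on opposite sides of the origin contribute a `1 / cosh²`
kernel, which combines with the `1 / sinh²` kernel of the pairs on one side. -/
theorem inv_sinh_sq_sub_inv_cosh_sq {h : ℝ} (hh : h ≠ 0) :
    1 / (4 * Real.sinh (h / 2) ^ 2) - 1 / (4 * Real.cosh (h / 2) ^ 2) = 1 / Real.sinh h ^ 2 := by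
  have hs : Real.sinh (h / 2) ≠ 0 := fun h0 => hh (by rw [Real.sinh_eq_zero] at h0; linarith)
  have hc := Real.cosh_pos (h / 2)
  have h1 : Real.sinh h = 2 * Real.sinh (h / 2) * Real.cosh (h / 2) := by
    rw [← Real.sinh_two_mul]; congr 1; ring
  have h2 := Real.cosh_sq_sub_sinh_sq (h / 2)
  rw [h1]
  field_simp
  linarith

/-- The one-particle norm of the odd field with given values on the half-line. -/
theorem lintegral_ft_odd_eq_thermal {f : ℝ → ℝ} (hf : ContDiff ℝ (⊤ : ℕ∞) f) {K : Set ℝ}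
    (hK : IsCompact K) (hK0 : K ⊆ Set.Ioi 0) (hz : ∀ u ∉ K, f u = 0) :
    ∫⁻ ω in Set.Ioi 0, ENNReal.ofReal (ω * ‖ft (fun u => f u - f (-u)) ω‖ ^ 2) =
      2 * ∫⁻ Ω in Set.Ioi 0,
        ENNReal.ofReal (Ω * coth (π * Ω / 2) * ‖ft (fun τ => f (Real.exp τ)) Ω‖ ^ 2) := by
  obtain ⟨hψ, hψc⟩ := comp_exp_test hf hK hK0 hz
  set ψ := fun τ => f (Real.exp τ) with hψd
  have hc := HasCompactSupport.intro hK hz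
  have hF : ContDiff ℝ (⊤ : ℕ∞) fun u => f u - f (-u) := hf.sub (hf.comp contDiff_neg)
  have hFc : HasCompactSupport fun u => f u - f (-u) :=
    hc.sub (hc.comp_homeomorph (Homeomorph.neg ℝ))
  have h1 := lintegral_inv_sq_mul_sub_sq hF hFc
  rw [lintegral_inv_sq_mul_sub_sq_exp hF.continuous] at h1
  have hneg : ∀ t, f (-Real.exp t) = 0 := fun t => hz _ fun h => by
    have := hK0 h
    have h2 := Real.exp_pos t
    simp only [Set.mem_Ioi] at this
    linarith
  simp only [neg_neg, hneg, sub_zero, zero_sub] at h1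
  have hψm := hψ.continuous
  have hm1 : Measurable fun p : ℝ × ℝ => 2 * ENNReal.ofReal (
      1 / Real.sinh (p.2 - p.1) ^ 2 * (ψ p.2 - ψ p.1) ^ 2) := by fun_prop
  have h2 : ∫⁻ s, ∫⁻ t, ENNReal.ofReal (
        1 / (4 * Real.sinh ((t - s) / 2) ^ 2) * ((f (Real.exp t) - f (Real.exp s)) ^ 2 +
          (-f (Real.exp t) - -f (Real.exp s)) ^ 2) +
        1 / (4 * Real.cosh ((t - s) / 2) ^ 2) * ((-f (Real.exp t) - f (Real.exp s)) ^ 2 +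
          (f (Real.exp t) - -f (Real.exp s)) ^ 2)) =
      2 * (∫⁻ s, ∫⁻ t, ENNReal.ofReal (
        1 / Real.sinh (t - s) ^ 2 * (ψ t - ψ s) ^ 2)) +
      4 * ∫⁻ s, ∫⁻ t, ENNReal.ofReal (
        1 / (4 * Real.cosh ((t - s) / 2) ^ 2) * (ψ t ^ 2 + ψ s ^ 2)) := by
    rw [← lintegral_const_mul' _ _ (by simp), ← lintegral_const_mul' _ _ (by simp)]
    simp only [← lintegral_const_mul' 2 _ (by simp : (2 : ENNReal) ≠ ⊤),
      ← lintegral_const_mul' 4 _ (by simp : (4 : ENNReal) ≠ ⊤)]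
    rw [← lintegral_add_left hm1.lintegral_prod_right']
    refine lintegral_congr fun s => ?_
    refine Eq.trans ?_ (lintegral_add_left (hm1.comp (measurable_prodMk_left (x := s))) _)
    refine lintegral_congr fun t => ?_
    simp only [Function.comp_def]
    rw [show (2 : ENNReal) = ENNReal.ofReal 2 by simp, show (4 : ENNReal) = ENNReal.ofReal 4 by simp,
      ← ENNReal.ofReal_mul (by norm_num), ← ENNReal.ofReal_mul (by norm_num),
      ← ENNReal.ofReal_add (by positivity) (by positivity)]
    congr 1
    rcases eq_or_ne t s with rfl | hts
    · simp [hψd]; ring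
    · rw [← inv_sinh_sq_sub_inv_cosh_sq (sub_ne_zero.2 hts)]
      simp only [hψd]
      ring
  have h2π : ENNReal.ofReal (2 * π)⁻¹ * ENNReal.ofReal (2 * π) = 1 := by
    rw [← ENNReal.ofReal_mul (by positivity), inv_mul_cancel₀ (by positivity), ENNReal.ofReal_one]
  have hP : ∫⁻ s, ENNReal.ofReal (ψ s ^ 2) =
      ENNReal.ofReal (2 * π)⁻¹ * ∫⁻ ω, ENNReal.ofReal (‖ft ψ ω‖ ^ 2) := by
    rw [lintegral_norm_sq_ft hψ hψc, ← mul_assoc, h2π, one_mul]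
  have hftm := (continuous_ft hψm hψc).measurable
  rw [h2, lintegral_cosh_mul_sq hψm, hP, lintegral_gagliardo hψ hψc
    (k := fun h => 1 / Real.sinh h ^ 2) (by fun_prop) (fun h => by positivity),
    mul_left_comm 2, ← mul_assoc 4, mul_left_comm (4 * 2), ← mul_add,
    ← lintegral_const_mul' _ _ (by simp),
    ← lintegral_const_mul' _ _ (by simp [ENNReal.mul_eq_top]),
    ← lintegral_add_right _ (by fun_prop), ← lintegral_const_mul' _ _ ENNReal.ofReal_ne_top] at h1
  have h3 : ∀ Ω : ℝ, Ω ≠ 0 → ENNReal.ofReal (2 * π)⁻¹ * (2 * (ENNReal.ofReal (‖ft ψ Ω‖ ^ 2) *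
      (∫⁻ h, ENNReal.ofReal (1 / Real.sinh h ^ 2 * (2 - 2 * Real.cos (Ω * h))))) +
        4 * 2 * ENNReal.ofReal (‖ft ψ Ω‖ ^ 2)) =
      ENNReal.ofReal (2 * (Ω * coth (π * Ω / 2) * ‖ft ψ Ω‖ ^ 2)) := by
    intro Ω hΩ
    have h1 := one_le_mul_coth (Ω := Ω / 2) (by simpa using hΩ)
    rw [← mul_div_assoc] at h1
    rw [lintegral_even _ (fun h => by simp), lintegral_cos_div_sinh_sq' hΩ,
      show (2 : ENNReal) = ENNReal.ofReal 2 by simp, show (4 : ENNReal) = ENNReal.ofReal 4 by simp,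
      ← ENNReal.ofReal_mul (by norm_num),
      ← ENNReal.ofReal_mul (by positivity), ← ENNReal.ofReal_mul (by norm_num),
      ← ENNReal.ofReal_mul (by norm_num), ← ENNReal.ofReal_mul (by norm_num),
      ← ENNReal.ofReal_add ?_ (by positivity),
      ← ENNReal.ofReal_mul (by positivity)]
    · congr 1
      field_simp
      ring
    · have : 0 ≤ π * Ω * coth (π * Ω / 2) - 2 := by linarith
      positivity
  have h4 : ∫⁻ Ω, ENNReal.ofReal (2 * π)⁻¹ * (2 * (ENNReal.ofReal (‖ft ψ Ω‖ ^ 2) *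
      (∫⁻ h, ENNReal.ofReal (1 / Real.sinh h ^ 2 * (2 - 2 * Real.cos (Ω * h))))) +
        4 * 2 * ENNReal.ofReal (‖ft ψ Ω‖ ^ 2)) =
      ∫⁻ Ω, ENNReal.ofReal (2 * (Ω * coth (π * Ω / 2) * ‖ft ψ Ω‖ ^ 2)) := by
    refine lintegral_congr_ae ?_
    filter_upwards [Measure.ae_ne volume (0 : ℝ)] with Ω hΩ using h3 Ω hΩ
  rw [h4, lintegral_even _ (fun Ω => by
    rw [norm_ft_neg, coth, coth, mul_neg, neg_div, Real.cosh_neg, Real.sinh_neg, div_neg,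
      neg_mul_neg])] at h1
  rw [← (ENNReal.mul_right_inj (by simp) (by simp)).1 h1]
  simp only [ENNReal.ofReal_mul (zero_le_two (α := ℝ))]
  rw [lintegral_const_mul' _ _ ENNReal.ofReal_ne_top]
  simp

end Gagliardo

/-! ### The symplectic form and the one-particle inner products -/

section SymplecticForm

variable {X : Type*} [MeasurableSpace X] {S : NullHorizon X} {c : NullCoordinate S}

theorem differentiableAt_u (c : NullCoordinate S) (x : X) (s : ℝ) :
    DifferentiableAt ℝ (c.u x) (c.param x s) := by
  have h1 : HasStrictDerivAt (c.param x) (deriv (c.param x) s) s :=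
    (c.contDiff_param x).contDiffAt.hasStrictDerivAt one_ne_zero
  have h0 := (c.deriv_param_pos x s).ne'
  have h2 := h1.to_localInverse h0
  refine (h2.hasDerivAt.congr_of_eventuallyEq ?_).differentiableAt
  have h3 := (h1.hasStrictFDerivAt_equiv h0).eventually_right_inverse
  filter_upwards [h3] with l hl
  rw [← hl, c.u_param]
  exact congrArg _ hl.symm

theorem differentiableAt_γ_rpow (c : NullCoordinate S) (x : X) (s r : ℝ) :
    DifferentiableAt ℝ (fun l => S.γ x l ^ r) (c.param x s) := by
  have hm := c.param_mem x s
  have h1 : DifferentiableAt ℝ (S.γ x) (c.param x s) :=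
    ((S.contDiffOn_γ x).contDiffAt ((S.isOpen_ray x).mem_nhds hm)).differentiableAt one_ne_zero
  exact h1.rpow_const (Or.inl (S.γ_pos x _ hm).ne')

theorem differentiableAt_field {ϕ : X → ℝ → ℝ} {x : X} (h : Differentiable ℝ (rescaled c ϕ x))
    (s : ℝ) : DifferentiableAt ℝ (ϕ x) (c.param x s) := by
  have hm := c.param_mem x s
  have h1 : DifferentiableAt ℝ (fun l => S.γ x l ^ (-(1 / 4) : ℝ) * rescaled c ϕ x (c.u x l))
      (c.param x s) :=
    (differentiableAt_γ_rpow c x s _).mul ((h _).comp _ (differentiableAt_u c x s))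
  refine h1.congr_of_eventuallyEq ?_
  filter_upwards [(S.isOpen_ray x).mem_nhds hm] with l hl
  rw [rescaled, c.param_u x l hl, ← mul_assoc, ← Real.rpow_add (S.γ_pos x l hl)]
  simp

/-- In terms of the rescaled fields, the area density and the parametrization of the rays drop out
of the symplectic form. -/
theorem symplecticForm_eq_rescaled {ϕ χ : X → ℝ → ℝ}
    (hϕ : ∀ x, Differentiable ℝ (rescaled c ϕ x)) (hχ : ∀ x, Differentiable ℝ (rescaled c χ x)) :
    symplecticForm S ϕ χ = ∫ x, (∫ s, (rescaled c ϕ x s * deriv (rescaled c χ x) s -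
      rescaled c χ x s * deriv (rescaled c ϕ x) s)) ∂S.μ := by
  unfold symplecticForm
  congr 1; funext x
  have himg : c.param x '' Set.univ = S.ray x := by
    ext l
    constructor
    · rintro ⟨s, -, rfl⟩
      exact c.param_mem x s
    · intro hl
      exact ⟨c.u x l, trivial, c.param_u x l hl⟩
  have hp : ∀ s, HasDerivAt (c.param x) (deriv (c.param x) s) s := fun s =>
    ((c.contDiff_param x).differentiable one_ne_zero s).hasDerivAt
  have hmono : Monotone (c.param x) :=
    monotone_of_deriv_nonneg ((c.contDiff_param x).differentiable one_ne_zero)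
      fun s => (c.deriv_param_pos x s).le
  rw [← himg, integral_image_eq_integral_deriv_smul_of_monotoneOn MeasurableSet.univ
    (fun s _ => (hp s).hasDerivWithinAt) (hmono.monotoneOn _), setIntegral_univ]
  congr 1; funext s
  have hd : ∀ ξ : X → ℝ → ℝ, Differentiable ℝ (rescaled c ξ x) → deriv (rescaled c ξ x) s =
      deriv (fun l => S.γ x l ^ (1 / 4 : ℝ)) (c.param x s) * deriv (c.param x) s *
        ξ x (c.param x s) + S.γ x (c.param x s) ^ (1 / 4 : ℝ) *
        (deriv (ξ x) (c.param x s) * deriv (c.param x) s) := by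
    intro ξ hξ
    have h1 := (differentiableAt_γ_rpow c x s (1 / 4)).hasDerivAt.comp s (hp s)
    have h2 := (differentiableAt_field hξ s).hasDerivAt.comp s (hp s)
    exact (h1.mul h2).deriv
  have hγ := S.γ_pos x _ (c.param_mem x s)
  have hsq : √(S.γ x (c.param x s)) =
      S.γ x (c.param x s) ^ (1 / 4 : ℝ) * S.γ x (c.param x s) ^ (1 / 4 : ℝ) := by
    rw [← Real.rpow_add hγ, Real.sqrt_eq_rpow]; norm_num
  rw [hd ϕ (hϕ x), hd χ (hχ x), hsq, smul_eq_mul]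
  simp only [rescaled]
  ring

end SymplecticForm

section OneParticle

variable {X : Type*} [MeasurableSpace X] {μ : Measure X}

theorem testFields_hasCompactSupport {U : Set ℝ} {φ : X → ℝ → ℝ} (hφ : φ ∈ testFields μ U) (x : X) :
    HasCompactSupport (φ x) := by
  obtain ⟨-, -, ⟨K, hK, -, hz⟩, -⟩ := hφ
  exact HasCompactSupport.intro hK (hz x)

theorem testFields_contDiff {U : Set ℝ} {φ : X → ℝ → ℝ} (hφ : φ ∈ testFields μ U) (x : X) :
    ContDiff ℝ (⊤ : ℕ∞) (φ x) := hφ.2.1 x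

theorem amplitude_eq {X : Type*} (φ : X → ℝ → ℝ) (p : ℝ × X) :
    amplitude φ p = √(2 * p.1) * ft (φ p.2) p.1 := rfl

variable [SigmaFinite μ]

theorem integral_modeMeasure {F : ℝ × X → ℝ} (hF : Integrable F (modeMeasure μ)) :
    ∫ p, F p ∂(modeMeasure μ) = ∫ x, 1 / (2 * π) * (∫ ω in Set.Ioi 0, F (ω, x)) ∂μ := by
  unfold modeMeasure at hF ⊢
  rw [integral_prod_symm _ hF]
  congr 1; funext x
  rw [integral_smul_nnreal_measure, NNReal.smul_def, Real.coe_toNNReal _ (by positivity), smul_eq_mul]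

theorem lintegral_modeMeasure {F : ℝ × X → ENNReal} (hF : AEMeasurable F (modeMeasure μ)) :
    ∫⁻ p, F p ∂(modeMeasure μ) =
      ∫⁻ x, ENNReal.ofReal (1 / (2 * π)) * (∫⁻ ω in Set.Ioi 0, F (ω, x)) ∂μ := by
  unfold modeMeasure at hF ⊢
  rw [lintegral_prod_symm _ hF]
  congr 1; funext x
  rw [lintegral_smul_measure]
  rfl

theorem integral_mul_deriv_symm {f g : ℝ → ℝ} (hf : ContDiff ℝ (⊤ : ℕ∞) f)
    (hc : HasCompactSupport f) (hg : ContDiff ℝ (⊤ : ℕ∞) g) (hd : HasCompactSupport g) :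
    ∫ s, (f s * deriv g s - g s * deriv f s) = 2 * ∫ s, f s * deriv g s := by
  have hdf := (smooth_deriv hf).2.continuous
  have hdg := (smooth_deriv hg).2.continuous
  have hfc := hf.continuous
  have hgc := hg.continuous
  have i1 : Integrable fun s => f s * deriv g s :=
    Continuous.integrable_of_hasCompactSupport (by fun_prop) hc.mul_right
  have i2 : Integrable fun s => g s * deriv f s :=
    Continuous.integrable_of_hasCompactSupport (by fun_prop) hd.mul_right
  have i3 : Integrable fun s => f s * g s :=
    Continuous.integrable_of_hasCompactSupport (by fun_prop) hc.mul_right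
  have h := integral_mul_deriv_eq_deriv_mul_of_integrable (u := f) (v := g)
    (fun s _ => ((smooth_deriv hf).1 s).hasDerivAt) (fun s _ => ((smooth_deriv hg).1 s).hasDerivAt)
    i1 (i2.congr (Filter.Eventually.of_forall fun s => mul_comm _ _)) i3
  rw [integral_sub i1 i2, h]
  have : ∫ s, deriv f s * g s = ∫ s, g s * deriv f s := by
    congr 1; funext s; exact mul_comm _ _
  rw [this]; ring

/-- The imaginary part of the one-particle inner product is the symplectic form. -/
theorem im_inner_modes (φ χ : testFields μ Set.univ) :
    (inner ℂ (modes φ) (modes χ)).im = ∫ x, (∫ s, φ.1 x s * deriv (χ.1 x) s) ∂μ := by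
  have hi := L2.integrable_inner (𝕜 := ℂ) (modes φ) (modes χ)
  have hae : ∀ᵐ p ∂(modeMeasure μ), RCLike.im (inner ℂ (modes φ p) (modes χ p)) =
      ((starRingEnd ℂ) (amplitude φ.1 p) * amplitude χ.1 p).im := by
    filter_upwards [(memLp_amplitude φ.2).coeFn_toLp, (memLp_amplitude χ.2).coeFn_toLp]
      with p h1 h2
    rw [modes, modes, h1, h2, RCLike.inner_apply, mul_comm]; rfl
  rw [L2.inner_def, ← RCLike.im_eq_complex_im, ← integral_im hi, integral_congr_ae hae,
    integral_modeMeasure (hi.im.congr hae)]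
  congr 1; funext x
  have h1 : ∀ ω ∈ Set.Ioi (0 : ℝ),
      ((starRingEnd ℂ) (amplitude φ.1 (ω, x)) * amplitude χ.1 (ω, x)).im =
      2 * (ω * ((starRingEnd ℂ) (ft (φ.1 x) ω) * ft (χ.1 x) ω).im) := by
    intro ω hω
    rw [amplitude_eq, amplitude_eq, map_mul, conj_ofReal, mul_mul_mul_comm, ← ofReal_mul,
      Real.mul_self_sqrt (mul_nonneg zero_le_two (le_of_lt hω)), Complex.im_ofReal_mul, mul_assoc]
  rw [setIntegral_congr_fun measurableSet_Ioi h1, integral_const_mul,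
    integral_Ioi_im_ft_mul_ft (testFields_contDiff φ.2 x) (testFields_hasCompactSupport φ.2 x)
      (testFields_contDiff χ.2 x) (testFields_hasCompactSupport χ.2 x)]
  have := Real.pi_ne_zero
  field_simp

end OneParticle

section Modes

variable {X : Type*} [MeasurableSpace X] {S : NullHorizon X} {c : NullCoordinate S}

theorem symplecticForm_eq {f g : X → ℝ → ℝ} (hf : rescaled c f ∈ testFields S.μ Set.univ)
    (hg : rescaled c g ∈ testFields S.μ Set.univ) :
    symplecticForm S f g =
      2 * ∫ x, (∫ s, rescaled c f x s * deriv (rescaled c g x) s) ∂S.μ := by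
  rw [symplecticForm_eq_rescaled (c := c) (fun x => (smooth_deriv (testFields_contDiff hf x)).1)
    (fun x => (smooth_deriv (testFields_contDiff hg x)).1), ← integral_const_mul]
  congr 1; funext x
  exact integral_mul_deriv_symm (testFields_contDiff hf x) (testFields_hasCompactSupport hf x)
    (testFields_contDiff hg x) (testFields_hasCompactSupport hg x)

theorem symplecticForm_eq_im_modesU (f g : FullPhase c) :
    symplecticForm S f.1 g.1 = 2 * (inner ℂ (modesU f) (modesU g)).im := by
  rw [symplecticForm_eq f.2.1 g.2.1, modesU, modesU, im_inner_modes]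

theorem integral_mul_deriv_comp_exp {f g : ℝ → ℝ} (hg : Differentiable ℝ g)
    (hz : ∀ u ≤ 0, f u = 0) :
    ∫ τ, f (Real.exp τ) * deriv (fun τ => g (Real.exp τ)) τ = ∫ u, f u * deriv g u := by
  rw [← setIntegral_eq_integral_of_forall_compl_eq_zero (s := Set.Ioi 0) (f := fun u => f u * deriv g u)
    (fun u hu => by rw [hz u (not_lt.1 hu), zero_mul])]
  have h := integral_image_eq_integral_deriv_smul_of_monotoneOn MeasurableSet.univ
    (f := Real.exp) (f' := Real.exp) (fun u _ => (Real.hasDerivAt_exp u).hasDerivWithinAt)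
    (Real.exp_monotone.monotoneOn _) (fun u => f u * deriv g u)
  rw [Set.image_univ, Real.range_exp, setIntegral_univ] at h
  rw [h]
  congr 1; funext τ
  have : deriv (fun τ => g (Real.exp τ)) τ = deriv g (Real.exp τ) * Real.exp τ :=
    ((hg _).hasDerivAt.comp τ (Real.hasDerivAt_exp τ)).deriv
  rw [this, smul_eq_mul]; ring

theorem HalfPhase.eq_zero_of_nonpos (f : HalfPhase c) (x : X) {u : ℝ} (hu : u ≤ 0) :
    rescaled c f.1 x u = 0 := by
  obtain ⟨-, -, ⟨K, -, hKU, hz⟩, -⟩ := f.2.1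
  exact hz x u fun h => absurd (hKU h) (not_lt.2 hu)

theorem symplecticForm_eq_im_modesTau (f g : HalfPhase c) :
    symplecticForm S f.1 g.1 = 2 * (inner ℂ (modesTau f) (modesTau g)).im := by
  change symplecticForm S f.toFull.1 g.toFull.1 = _
  rw [symplecticForm_eq f.toFull.2.1 g.toFull.2.1, modesTau, modesTau, im_inner_modes]
  congr 2; funext x
  exact (integral_mul_deriv_comp_exp (smooth_deriv (testFields_contDiff g.2.1 x)).1
    fun u hu => f.eq_zero_of_nonpos x hu).symm

end Modes

/-! ### Thermal modes -/

section Linearity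

variable {X : Type*} [MeasurableSpace X] {μ : Measure X} {U : Set ℝ}

theorem ft_add {f g : ℝ → ℝ} (hf : Continuous f) (hc : HasCompactSupport f) (hg : Continuous g)
    (hd : HasCompactSupport g) (ω : ℝ) : ft (f + g) ω = ft f ω + ft g ω := by
  rw [ft, ft, ft, ← integral_add (integrable_exp_mul_of_compact hf hc ω)
    (integrable_exp_mul_of_compact hg hd ω)]
  congr 1; funext u
  simp only [Pi.add_apply]
  push_cast; ring

theorem ft_smul (r : ℝ) (f : ℝ → ℝ) (ω : ℝ) : ft (r • f) ω = r * ft f ω := by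
  rw [ft, ft, ← integral_const_mul]
  congr 1; funext u
  simp only [Pi.smul_apply, smul_eq_mul]
  push_cast; ring

theorem amplitude_add {φ χ : X → ℝ → ℝ} (hφ : φ ∈ testFields μ U) (hχ : χ ∈ testFields μ U)
    (p : ℝ × X) : amplitude (φ + χ) p = amplitude φ p + amplitude χ p := by
  rw [amplitude_eq, amplitude_eq, amplitude_eq, Pi.add_apply,
    ft_add (testFields_contDiff hφ _).continuous (testFields_hasCompactSupport hφ _)
    (testFields_contDiff hχ _).continuous (testFields_hasCompactSupport hχ _), mul_add]

theorem amplitude_smul {X : Type*} (r : ℝ) (φ : X → ℝ → ℝ) (p : ℝ × X) :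
    amplitude (r • φ) p = r * amplitude φ p := by
  rw [amplitude_eq, amplitude_eq, Pi.smul_apply, ft_smul]
  ring

end Linearity

section Weighted

variable {X : Type*} [MeasurableSpace X] {S : NullHorizon X} {c : NullCoordinate S}

theorem rescaled_add (f g : X → ℝ → ℝ) : rescaled c (f + g) = rescaled c f + rescaled c g := by
  ext x s; simp [rescaled, mul_add]

theorem rescaled_smul (r : ℝ) (f : X → ℝ → ℝ) : rescaled c (r • f) = r • rescaled c f := by
  ext x s; simp only [rescaled, Pi.smul_apply, smul_eq_mul]; ring

theorem modesU_add (f g : FullPhase c) : modesU (f + g) = modesU f + modesU g := by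
  rw [modesU, modesU, modesU, modes, modes, modes, ← MemLp.toLp_add]
  refine MemLp.toLp_congr _ _ (Filter.Eventually.of_forall fun p => ?_)
  change amplitude (rescaled c (f.1 + g.1)) p = _
  rw [rescaled_add, amplitude_add f.2.1 g.2.1]
  rfl

theorem tauField_add (f g : HalfPhase c) : (tauField (f + g)).1 = (tauField f).1 + (tauField g).1 := by
  ext x s
  change rescaled c (f.1 + g.1) x (Real.exp s) = _
  rw [rescaled_add]; rfl

theorem tauField_smul (r : ℝ) (f : HalfPhase c) : (tauField (r • f)).1 = r • (tauField f).1 := by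
  ext x s
  change rescaled c (r • f.1) x (Real.exp s) = _
  rw [rescaled_smul]; rfl

/-- A weight `w(Ω)` for which all the weighted thermal amplitudes `w(Ω) a_τ(Ω, x)` of the fields on
the half-horizon are square-integrable. -/
def IsWeight (c : NullCoordinate S) (w : ℝ → ℝ) : Prop :=
  ∀ f : HalfPhase c, MemLp (fun p : ℝ × X => (w p.1 : ℂ) * amplitude (tauField f).1 p) 2
    (modeMeasure S.μ)

/-- The weighted thermal amplitudes `w(Ω) a_τ(Ω, x)`, as a real-linear map into the one-particle
space. -/
def weightedModes {w : ℝ → ℝ} (hw : IsWeight c w) : HalfPhase c →ₗ[ℝ] Lp ℂ 2 (modeMeasure S.μ) where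
  toFun f := (hw f).toLp
  map_add' f g := by
    rw [← MemLp.toLp_add]
    refine MemLp.toLp_congr _ _ (Filter.Eventually.of_forall fun p => ?_)
    simp only [Pi.add_apply]
    rw [tauField_add, amplitude_add (tauField f).2 (tauField g).2, mul_add]
  map_smul' r f := by
    rw [RingHom.id_apply, ← MemLp.toLp_const_smul]
    refine MemLp.toLp_congr _ _ (Filter.Eventually.of_forall fun p => ?_)
    simp only [Pi.smul_apply, real_smul]
    rw [tauField_smul, amplitude_smul]
    ring

theorem isWeight_one (c : NullCoordinate S) : IsWeight c fun _ => 1 := fun f => by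
  simpa using memLp_amplitude (tauField f).2

/-- The thermal amplitudes, as a real-linear map. -/
def modesTauL (c : NullCoordinate S) : HalfPhase c →ₗ[ℝ] Lp ℂ 2 (modeMeasure S.μ) :=
  weightedModes (isWeight_one c)

theorem modesTauL_apply (f : HalfPhase c) : modesTauL c f = modesTau f := by
  change (isWeight_one c f).toLp = (memLp_amplitude (tauField f).2).toLp
  refine MemLp.toLp_congr _ _ (Filter.Eventually.of_forall fun p => ?_)
  simp

theorem aestronglyMeasurable_weighted {w : ℝ → ℝ} (hw : Measurable w) (f : HalfPhase c) :
    AEStronglyMeasurable (fun p : ℝ × X => (w p.1 : ℂ) * amplitude (tauField f).1 p)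
      (modeMeasure S.μ) := by
  refine AEStronglyMeasurable.mul ?_ (memLp_amplitude (tauField f).2).1
  have : Measurable fun p : ℝ × X => (w p.1 : ℂ) := by fun_prop
  exact this.aestronglyMeasurable

theorem modeMeasure_ae_pos (μ : Measure X) [SigmaFinite μ] : ∀ᵐ p ∂(modeMeasure μ), 0 < p.1 := by
  unfold modeMeasure
  have h : ∀ᵐ ω : ℝ ∂((1 / (2 * π)).toNNReal • volume.restrict (Set.Ioi 0)), 0 < ω :=
    Measure.ae_smul_measure (ae_restrict_mem measurableSet_Ioi) _
  exact Measure.quasiMeasurePreserving_fst.ae h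

theorem lintegral_norm_sq_amplitude {μ : Measure X} [SigmaFinite μ] {φ : X → ℝ → ℝ}
    {w : ℝ → ℝ} (hm : AEStronglyMeasurable (fun p : ℝ × X => (w p.1 : ℂ) * amplitude φ p)
      (modeMeasure μ)) :
    ∫⁻ p, ENNReal.ofReal (‖(w p.1 : ℂ) * amplitude φ p‖ ^ 2) ∂(modeMeasure μ) =
      ∫⁻ x, ENNReal.ofReal (1 / (2 * π)) *
        (2 * ∫⁻ ω in Set.Ioi 0, ENNReal.ofReal (ω * w ω ^ 2 * ‖ft (φ x) ω‖ ^ 2)) ∂μ := by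
  rw [lintegral_modeMeasure (F := fun p => ENNReal.ofReal (‖(w p.1 : ℂ) * amplitude φ p‖ ^ 2))
    (hm.norm.pow 2).aemeasurable.ennreal_ofReal]
  congr 1; funext x
  rw [← lintegral_const_mul' 2 _ (by simp)]
  congr 1
  refine setLIntegral_congr_fun measurableSet_Ioi fun ω hω => ?_
  rw [show (2 : ENNReal) = ENNReal.ofReal 2 by simp, ← ENNReal.ofReal_mul (by norm_num)]
  congr 1
  rw [amplitude_eq, norm_mul, norm_mul, Complex.norm_real, Complex.norm_real, mul_pow, mul_pow,
    Real.norm_eq_abs, Real.norm_eq_abs, sq_abs, sq_abs,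
    Real.sq_sqrt (mul_nonneg zero_le_two (le_of_lt hω))]
  ring

theorem integral_norm_sq_eq_toReal {α : Type*} [MeasurableSpace α] {ν : Measure α} {F : α → ℂ}
    (hF : AEStronglyMeasurable F ν) :
    ∫ p, ‖F p‖ ^ 2 ∂ν = (∫⁻ p, ENNReal.ofReal (‖F p‖ ^ 2) ∂ν).toReal :=
  integral_eq_lintegral_of_nonneg_ae (Filter.Eventually.of_forall fun _ => sq_nonneg _)
    (hF.norm.pow 2)

theorem norm_sq_toLp {α : Type*} [MeasurableSpace α] {ν : Measure α} {F : α → ℂ}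
    (hF : MemLp F 2 ν) : ‖hF.toLp‖ ^ 2 = ∫ p, ‖F p‖ ^ 2 ∂ν := by
  have h : (inner ℂ hF.toLp hF.toLp).re = ‖hF.toLp‖ ^ 2 := by
    rw [inner_self_ofReal, ofReal_re]
  rw [← h, L2.inner_def, ← RCLike.re_eq_complex_re, ← integral_re (L2.integrable_inner _ _)]
  refine integral_congr_ae ?_
  filter_upwards [hF.coeFn_toLp] with p hp
  rw [hp, inner_self_eq_norm_sq]

theorem memLp_two_of_lintegral {α : Type*} [MeasurableSpace α] {ν : Measure α} {F : α → ℂ}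
    (hF : AEStronglyMeasurable F ν) (h : ∫⁻ p, ENNReal.ofReal (‖F p‖ ^ 2) ∂ν ≠ ⊤) :
    MemLp F 2 ν := by
  rw [memLp_two_iff_integrable_sq_norm hF]
  refine ⟨hF.norm.pow 2, ?_⟩
  rw [hasFiniteIntegral_iff_ofReal (Filter.Eventually.of_forall fun _ => sq_nonneg _)]
  exact lt_top_iff_ne_top.2 h

theorem lintegral_ne_top_of_memLp {α : Type*} [MeasurableSpace α] {ν : Measure α} {F : α → ℂ}
    (hF : MemLp F 2 ν) : ∫⁻ p, ENNReal.ofReal (‖F p‖ ^ 2) ∂ν ≠ ⊤ := by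
  have h := (memLp_two_iff_integrable_sq_norm hF.1).1 hF
  exact (hasFiniteIntegral_iff_ofReal (Filter.Eventually.of_forall fun _ => sq_nonneg _)).1
    h.2 |>.ne

theorem coth_pos {x : ℝ} (hx : 0 < x) : 0 < coth x :=
  div_pos (Real.cosh_pos _) (Real.sinh_pos_iff.2 hx)

/-- `√coth(πΩ)`, the weight of the `u`-vacuum state. -/
def vacuumWeight (Ω : ℝ) : ℝ := √(coth (π * Ω))

/-- `√coth(πΩ/2)`, the weight of the vacuum wavefunctional. -/
def waveWeight (Ω : ℝ) : ℝ := √(coth (π * Ω / 2))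

theorem measurable_vacuumWeight : Measurable vacuumWeight := by
  unfold vacuumWeight coth; fun_prop

theorem measurable_waveWeight : Measurable waveWeight := by
  unfold waveWeight coth; fun_prop

theorem lintegral_vacuumWeight (f : HalfPhase c) :
    ∫⁻ p, ENNReal.ofReal (‖(vacuumWeight p.1 : ℂ) * amplitude (tauField f).1 p‖ ^ 2)
        ∂(modeMeasure S.μ) =
      ∫⁻ p, ENNReal.ofReal (‖amplitude (rescaled c f.1) p‖ ^ 2) ∂(modeMeasure S.μ) := by
  have hm : AEStronglyMeasurable (amplitude (rescaled c f.1)) (modeMeasure S.μ) :=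
    (memLp_amplitude f.toFull.2.1).1
  have h2 := lintegral_norm_sq_amplitude (φ := rescaled c f.1) (w := fun _ => 1)
    (μ := S.μ) (by simpa using hm)
  simp only [ofReal_one, one_mul, one_pow, mul_one] at h2
  rw [lintegral_norm_sq_amplitude (aestronglyMeasurable_weighted measurable_vacuumWeight f), h2]
  congr 1; funext x
  obtain ⟨-, hs, ⟨K, hK, hKU, hz⟩, -⟩ := f.2.1
  rw [lintegral_ft_eq_thermal (hs x) hK hKU (hz x)]
  congr 2
  refine setLIntegral_congr_fun measurableSet_Ioi fun Ω hΩ => ?_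
  simp only [vacuumWeight]
  rw [Real.sq_sqrt (coth_pos (mul_pos Real.pi_pos hΩ)).le]
  rfl

theorem isWeight_vacuumWeight (c : NullCoordinate S) : IsWeight c vacuumWeight := fun f => by
  refine memLp_two_of_lintegral (aestronglyMeasurable_weighted measurable_vacuumWeight f) ?_
  rw [lintegral_vacuumWeight]
  exact lintegral_ne_top_of_memLp (memLp_amplitude f.toFull.2.1)

/-- The amplitudes `√coth(πΩ) a_τ(Ω, x)`. -/
def vacuumModes (c : NullCoordinate S) : HalfPhase c →ₗ[ℝ] Lp ℂ 2 (modeMeasure S.μ) :=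
  weightedModes (isWeight_vacuumWeight c)

/-- The one-particle norm in the `u`-vacuum is the thermal norm. -/
theorem norm_sq_modesU (f : HalfPhase c) : ‖modesU f.toFull‖ ^ 2 = ‖vacuumModes c f‖ ^ 2 := by
  refine (norm_sq_toLp (memLp_amplitude f.toFull.2.1)).trans ?_
  refine Eq.trans ?_ (norm_sq_toLp (isWeight_vacuumWeight c f)).symm
  rw [integral_norm_sq_eq_toReal (memLp_amplitude f.toFull.2.1).1,
    integral_norm_sq_eq_toReal (isWeight_vacuumWeight c f).1, lintegral_vacuumWeight]
  rfl

theorem oddExtension_eq (f : HalfPhase c) :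
    oddExtension (rescaled c f.1) = fun x u => rescaled c f.1 x u - rescaled c f.1 x (-u) := by
  funext x u
  rw [oddExtension]
  split_ifs with h
  · rw [f.eq_zero_of_nonpos x (u := -u) (by linarith), sub_zero]
  · rw [f.eq_zero_of_nonpos x (u := u) (by linarith), zero_sub]

theorem comp_neg_mem_testFields {μ : Measure X} {φ : X → ℝ → ℝ} (hφ : φ ∈ testFields μ Set.univ) :
    (fun x u => φ x (-u)) ∈ testFields μ Set.univ := by
  obtain ⟨hm, hs, ⟨K, hK, hKU, hz⟩, C, hC, hb⟩ := hφ
  refine ⟨hm.comp (measurable_fst.prodMk measurable_snd.neg), fun x => (hs x).comp contDiff_neg,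
    ⟨-K, hK.neg, Set.subset_univ _, fun x u hu => hz x _ fun h => hu (by simpa using h)⟩, C, hC,
    fun x u => ?_⟩
  have e : ∀ g : ℝ → ℝ, deriv (fun u => g (-u)) = fun u => -deriv g (-u) := fun g =>
    funext fun v => deriv_comp_neg g v
  rw [e, deriv.fun_neg, e (deriv (φ x)), abs_neg, neg_neg]
  exact hb x (-u)

theorem oddExtension_mem_testFields (f : HalfPhase c) :
    oddExtension (rescaled c f.1) ∈ testFields S.μ Set.univ := by
  rw [oddExtension_eq]
  exact sub_mem f.toFull.2.1 (comp_neg_mem_testFields f.toFull.2.1)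

theorem lintegral_waveWeight (f : HalfPhase c) :
    2 * ∫⁻ p, ENNReal.ofReal (‖(waveWeight p.1 : ℂ) * amplitude (tauField f).1 p‖ ^ 2)
        ∂(modeMeasure S.μ) =
      ∫⁻ p, ENNReal.ofReal (‖amplitude (oddExtension (rescaled c f.1)) p‖ ^ 2)
        ∂(modeMeasure S.μ) := by
  have hm := (memLp_amplitude (oddExtension_mem_testFields f)).1
  have h2 := lintegral_norm_sq_amplitude (φ := oddExtension (rescaled c f.1)) (w := fun _ => 1)
    (μ := S.μ) (by simpa using hm)
  simp only [ofReal_one, one_mul, one_pow, mul_one] at h2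
  rw [lintegral_norm_sq_amplitude (aestronglyMeasurable_weighted measurable_waveWeight f), h2,
    ← lintegral_const_mul' _ _ (by simp)]
  congr 1; funext x
  obtain ⟨-, hs, ⟨K, hK, hKU, hz⟩, -⟩ := f.2.1
  have h3 := lintegral_ft_odd_eq_thermal (hs x) hK hKU (hz x)
  rw [oddExtension_eq, h3, mul_left_comm]
  congr 3
  refine setLIntegral_congr_fun measurableSet_Ioi fun Ω hΩ => ?_
  simp only [waveWeight]
  rw [Real.sq_sqrt (coth_pos (half_pos (mul_pos Real.pi_pos hΩ))).le]
  rfl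

theorem isWeight_waveWeight (c : NullCoordinate S) : IsWeight c waveWeight := fun f => by
  refine memLp_two_of_lintegral (aestronglyMeasurable_weighted measurable_waveWeight f) ?_
  intro h
  have h2 := lintegral_waveWeight f
  rw [h] at h2
  exact lintegral_ne_top_of_memLp (memLp_amplitude (oddExtension_mem_testFields f))
    (h2.symm.trans (by simp))

/-- The amplitudes `√coth(πΩ/2) a_τ(Ω, x)`. -/
def waveModes (c : NullCoordinate S) : HalfPhase c →ₗ[ℝ] Lp ℂ 2 (modeMeasure S.μ) :=
  weightedModes (isWeight_waveWeight c)

theorem ft_odd {F : ℝ → ℝ} (hF : Continuous F) (hc : HasCompactSupport F) (hodd : ∀ u, F (-u) = -F u)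
    (ω : ℝ) : ft F ω = I * (∫ u, Real.sin (ω * u) * F u : ℝ) := by
  have h1 : ft F (-ω) = -ft F ω := by
    rw [ft, ft, ← integral_neg, ← integral_neg_eq_self]
    congr 1; funext u
    rw [hodd]
    push_cast
    rw [show I * -(ω : ℂ) * -u = I * ω * u by ring]
    ring
  have hre : (ft F ω).re = 0 := by
    have h2 := congrArg Complex.re h1
    rw [ft_neg, conj_re, neg_re] at h2
    linarith
  have him : (ft F ω).im = ∫ u, Real.sin (ω * u) * F u := by
    rw [ft, ← RCLike.im_eq_complex_im, ← integral_im (integrable_exp_mul_of_compact hF hc ω)]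
    congr 1; funext u
    rw [RCLike.im_eq_complex_im, Complex.im_mul_ofReal, Complex.exp_im]
    simp
  apply Complex.ext
  · simpa using hre
  · simpa using him

theorem sineTransform_oddExtension (f : HalfPhase c) (p : ℝ × X) :
    amplitude (oddExtension (rescaled c f.1)) p =
      I * ((√2)⁻¹ * sineTransform (oddExtension (rescaled c f.1)) p : ℝ) := by
  have h := oddExtension_mem_testFields f
  rw [amplitude_eq, ft_odd (testFields_contDiff h p.2).continuous
    (testFields_hasCompactSupport h p.2) (fun u => by rw [oddExtension_eq]; simp), sineTransform,
    Real.sqrt_mul zero_le_two]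
  have h2 : √2 * √2 = (2 : ℝ) := Real.mul_self_sqrt zero_le_two
  have h3 : (√2)⁻¹ * (2 * √p.1 * ∫ u, Real.sin (p.1 * u) * oddExtension (rescaled c f.1) p.2 u) =
      √2 * √p.1 * ∫ u, Real.sin (p.1 * u) * oddExtension (rescaled c f.1) p.2 u := by
    have : √2 ≠ (0 : ℝ) := by positivity
    field_simp
    rw [sq, h2]
  rw [h3]
  push_cast; ring

/-- The `u`-amplitudes of the odd extension of a field on the half-horizon. -/
def oddModes (f : HalfPhase c) : Lp ℂ 2 (modeMeasure S.μ) :=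
  modes ⟨_, oddExtension_mem_testFields f⟩

theorem oddModes_add (f g : HalfPhase c) : oddModes (f + g) = oddModes f + oddModes g := by
  rw [oddModes, oddModes, oddModes, modes, modes, modes, ← MemLp.toLp_add]
  refine MemLp.toLp_congr _ _ (Filter.Eventually.of_forall fun p => ?_)
  have h : oddExtension (rescaled c (f + g).1) =
      oddExtension (rescaled c f.1) + oddExtension (rescaled c g.1) := by
    rw [oddExtension_eq, oddExtension_eq, oddExtension_eq]
    change (fun x u => rescaled c (f.1 + g.1) x u - rescaled c (f.1 + g.1) x (-u)) = _
    rw [rescaled_add]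
    funext x u
    simp only [Pi.add_apply]
    ring
  simp only [h]
  exact amplitude_add (oddExtension_mem_testFields f) (oddExtension_mem_testFields g) p

theorem norm_sq_oddModes (f : HalfPhase c) : ‖oddModes f‖ ^ 2 = 2 * ‖waveModes c f‖ ^ 2 := by
  have hm := memLp_amplitude (oddExtension_mem_testFields f)
  refine (norm_sq_toLp hm).trans ?_
  refine Eq.trans ?_ (congrArg (2 * ·) (norm_sq_toLp (isWeight_waveWeight c f)).symm)
  rw [integral_norm_sq_eq_toReal hm.1, integral_norm_sq_eq_toReal (isWeight_waveWeight c f).1,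
    ← lintegral_waveWeight, ENNReal.toReal_mul]
  rfl

theorem re_inner_eq_norm_sq {H : Type*} [NormedAddCommGroup H] [InnerProductSpace ℂ H] (x y : H) :
    (inner ℂ x y).re = (‖x + y‖ ^ 2 - ‖x‖ ^ 2 - ‖y‖ ^ 2) / 2 := by
  have := norm_add_sq (𝕜 := ℂ) x y
  rw [RCLike.re_eq_complex_re] at this
  linarith

theorem sinePairing_eq (f g : HalfPhase c) :
    sinePairing f g = 4 * (inner ℂ (waveModes c f) (waveModes c g)).re := by
  have h1 : sinePairing f g = 2 * (inner ℂ (oddModes f) (oddModes g)).re := by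
    rw [L2.inner_def, ← RCLike.re_eq_complex_re, ← integral_re (L2.integrable_inner _ _),
      ← integral_const_mul]
    refine integral_congr_ae ?_
    filter_upwards [(memLp_amplitude (oddExtension_mem_testFields f)).coeFn_toLp,
      (memLp_amplitude (oddExtension_mem_testFields g)).coeFn_toLp] with p hp hq
    rw [oddModes, oddModes, modes, modes, hp, hq, sineTransform_oddExtension,
      sineTransform_oddExtension, RCLike.re_eq_complex_re, RCLike.inner_apply,
      map_mul (starRingEnd ℂ), conj_I, conj_ofReal]
    set a := sineTransform (oddExtension (rescaled c f.1)) p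
    set b := sineTransform (oddExtension (rescaled c g.1)) p
    have h0 : I * (((√2)⁻¹ * b : ℝ) : ℂ) * (-I * (((√2)⁻¹ * a : ℝ) : ℂ)) =
        (((√2)⁻¹ * b * ((√2)⁻¹ * a) : ℝ) : ℂ) := by
      push_cast
      linear_combination (-((√2 : ℝ) : ℂ)⁻¹ * b * (((√2 : ℝ) : ℂ)⁻¹ * a)) * I_mul_I
    rw [h0, ofReal_re]
    have h2 : √2 * √2 = (2 : ℝ) := Real.mul_self_sqrt zero_le_two
    have : √2 ≠ (0 : ℝ) := by positivity
    field_simp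
    rw [sq, h2]
  rw [h1, re_inner_eq_norm_sq, re_inner_eq_norm_sq, ← oddModes_add, ← map_add, norm_sq_oddModes,
    norm_sq_oddModes, norm_sq_oddModes]
  ring

theorem toFull_add (f g : HalfPhase c) : (f + g).toFull = f.toFull + g.toFull := rfl

theorem re_inner_modesU (f g : HalfPhase c) : (inner ℂ (modesU f.toFull) (modesU g.toFull)).re =
    (inner ℂ (vacuumModes c f) (vacuumModes c g)).re := by
  rw [re_inner_eq_norm_sq, re_inner_eq_norm_sq, ← modesU_add, ← map_add, ← toFull_add,
    norm_sq_modesU, norm_sq_modesU, norm_sq_modesU]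

/-- The inner product of `u`-modes in terms of thermal modes. -/
theorem inner_modesU (f g : HalfPhase c) : inner ℂ (modesU f.toFull) (modesU g.toFull) =
    ((inner ℂ (vacuumModes c f) (vacuumModes c g)).re : ℂ) +
      (inner ℂ (modesTau f) (modesTau g)).im * I := by
  rw [← Complex.re_add_im (inner ℂ (modesU f.toFull) (modesU g.toFull)), re_inner_modesU]
  congr 3
  have h1 := symplecticForm_eq_im_modesTau f g
  have h2 := symplecticForm_eq_im_modesU f.toFull g.toFull
  change symplecticForm S f.1 g.1 = _ at h2
  linarith

theorem rescaled_translate (t : ℝ) (f : HalfPhase c) :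
    rescaled c (translate t f).1 = fun x u => rescaled c f.1 x (Real.exp (-t) * u) :=
  rescaled_ofRescaled c fun x u => rescaled c f.1 x (Real.exp (-t) * u)

theorem amplitude_translate (t : ℝ) (f : HalfPhase c) (p : ℝ × X) :
    amplitude (tauField (translate t f)).1 p =
      Complex.exp (I * t * p.1) * amplitude (tauField f).1 p := by
  rw [amplitude_eq, amplitude_eq]
  have h : (tauField (translate t f)).1 p.2 = fun τ => (tauField f).1 p.2 (τ + -t) := by
    funext τ
    change rescaled c (translate t f).1 p.2 (Real.exp τ) = rescaled c f.1 p.2 (Real.exp (τ + -t))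
    rw [rescaled_translate, add_comm, Real.exp_add]
  rw [h, ft_translate]
  push_cast
  rw [show -(I * (p.1 : ℂ) * -t) = I * t * p.1 by ring]
  ring

/-- The phase `e^{itΩ}` of the translation by `t`. -/
def phase (X : Type*) [MeasurableSpace X] (t : ℝ) : Multiplier (ℝ × X) :=
  ⟨fun p => Complex.exp (I * t * p.1), by fun_prop, fun p => by
    simp only
    rw [show I * t * (p.1 : ℂ) = ((t * p.1 : ℝ) : ℂ) * I by push_cast; ring,
      Complex.norm_exp_ofReal_mul_I]⟩

theorem norm_phase (t : ℝ) (p : ℝ × X) : ‖(phase X t).1 p‖ = 1 := by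
  change ‖Complex.exp (I * t * p.1)‖ = 1
  rw [show I * t * (p.1 : ℂ) = ((t * p.1 : ℝ) : ℂ) * I by push_cast; ring,
    Complex.norm_exp_ofReal_mul_I]

theorem conj_phase (t : ℝ) : (phase X t).conj = phase X (-t) := by
  refine Subtype.ext (funext fun p => ?_)
  change (starRingEnd ℂ) (Complex.exp (I * t * p.1)) = Complex.exp (I * (-t : ℝ) * p.1)
  rw [← Complex.exp_conj]
  simp

theorem weightedModes_translate {w : ℝ → ℝ} (hw : IsWeight c w) (t : ℝ) (f : HalfPhase c) :
    weightedModes hw (translate t f) = (phase X t).toCLM (weightedModes hw f) := by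
  refine Lp.ext ?_
  filter_upwards [(hw (translate t f)).coeFn_toLp, (hw f).coeFn_toLp,
    (phase X t).coeFn_toCLM (weightedModes hw f)] with p h1 h2 h3
  refine h1.trans (Eq.trans ?_ h3.symm)
  rw [amplitude_translate, show weightedModes hw f p = _ from h2, mul_left_comm]
  rfl

theorem modesTau_translate (t : ℝ) (f : HalfPhase c) :
    modesTau (translate t f) = (phase X t).toCLM (modesTau f) := by
  rw [← modesTauL_apply, ← modesTauL_apply]
  exact weightedModes_translate _ t f

end Weighted

/-! ### Density of the fields in the one-particle space -/

section FourierUniqueness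

open FourierTransform in
/-- An integrable function whose Fourier transform vanishes is zero. -/
theorem ae_eq_zero_of_fourier_eq_zero {L : ℝ → ℂ} (hL : Integrable L) (h : ∀ ξ, 𝓕 L ξ = 0) :
    ∀ᵐ ω, L ω = 0 := by
  refine ae_eq_zero_of_integral_contDiff_smul_eq_zero hL.locallyIntegrable fun g hg hc => ?_
  set G := toSchwartz hg hc
  have h1 : ∫ ξ, 𝓕 (𝓕⁻ G) ξ • L ξ = ∫ x, (𝓕⁻ G) x • 𝓕 L x := by
    have h2 := VectorFourier.integral_fourierIntegral_smul_eq_flip (L := innerₗ ℝ)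
      Real.continuous_fourierChar continuous_inner ((𝓕⁻ G).integrable (μ := volume)) hL
    rw [flip_innerₗ] at h2
    exact h2
  simp only [h, smul_zero, integral_zero] at h1
  rw [← h1]
  congr 1; funext ξ
  rw [FourierTransform.fourier_fourierInv_eq]
  exact (RCLike.real_smul_eq_coe_smul (K := ℂ) _ _)

open FourierTransform in
/-- A function on `(0, ∞)` is zero if the real parts of all its Fourier coefficients vanish. -/
theorem ae_eq_zero_of_re_integral_exp {κ : ℝ → ℂ} (hκ : IntegrableOn κ (Set.Ioi 0))
    (h : ∀ t : ℝ, (∫ ω in Set.Ioi (0 : ℝ), Complex.exp (I * t * ω) * κ ω).re = 0) :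
    ∀ᵐ ω ∂(volume.restrict (Set.Ioi 0)), κ ω = 0 := by
  set K : ℝ → ℂ := (Set.Ioi 0).indicator κ with hK
  have hKi : Integrable K := hκ.integrable_indicator measurableSet_Ioi
  set L : ℝ → ℂ := fun ω => K ω + (starRingEnd ℂ) (K (-ω)) with hL
  have hKc : Integrable fun ω => (starRingEnd ℂ) (K (-ω)) :=
    (LinearIsometryEquiv.integrable_comp_iff Complex.conjLIE).2 hKi.comp_neg
  have hLi : Integrable L := hKi.add hKc
  have hexp : ∀ {F : ℝ → ℂ}, Integrable F → ∀ t : ℝ,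
      Integrable fun ω : ℝ => Complex.exp (I * t * ω) * F ω := by
    intro F hF t
    refine (hF.norm).mono' ?_ (Filter.Eventually.of_forall fun ω => ?_)
    · exact (Continuous.aestronglyMeasurable (by fun_prop)).mul hF.1
    · rw [norm_mul, show I * t * (ω : ℂ) = ((t * ω : ℝ) : ℂ) * I by push_cast; ring,
        Complex.norm_exp_ofReal_mul_I, one_mul]
  have hint : ∀ t : ℝ, ∫ ω : ℝ, Complex.exp (I * t * ω) * L ω = 0 := by
    intro t
    have e1 : ∫ ω : ℝ, Complex.exp (I * t * ω) * K ω =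
        ∫ ω in Set.Ioi (0 : ℝ), Complex.exp (I * t * ω) * κ ω := by
      rw [← integral_indicator measurableSet_Ioi]
      congr 1; funext ω
      simp only [hK, Set.indicator]
      split_ifs <;> simp
    have e2 : ∫ ω : ℝ, Complex.exp (I * t * ω) * (starRingEnd ℂ) (K (-ω)) =
        (starRingEnd ℂ) (∫ ω : ℝ, Complex.exp (I * t * ω) * K ω) := by
      rw [← integral_conj, ← integral_neg_eq_self]
      congr 1; funext ω
      rw [map_mul, ← Complex.exp_conj, neg_neg]
      simp
    simp only [hL, mul_add]
    rw [integral_add (hexp hKi t) (hexp hKc t), e2, e1, Complex.add_conj, h t]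
    simp
  have hfour : ∀ ξ, 𝓕 L ξ = 0 := by
    intro ξ
    rw [Real.fourier_real_eq_integral_exp_smul, ← hint (-2 * π * ξ)]
    congr 1; funext ω
    rw [smul_eq_mul]
    congr 2
    push_cast; ring
  have h0 := ae_eq_zero_of_fourier_eq_zero hLi hfour
  filter_upwards [ae_restrict_of_ae h0, ae_restrict_mem measurableSet_Ioi] with ω h1 h2
  have h3 : -ω ∉ Set.Ioi (0 : ℝ) := by
    simp only [Set.mem_Ioi] at h2 ⊢
    linarith
  simpa [hL, hK, Set.indicator_of_mem h2, Set.indicator_of_notMem h3] using h1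

/-- A function on a product whose integrals over all rectangles vanish is zero. -/
theorem ae_eq_zero_of_setIntegral_prod {α β : Type*} [MeasurableSpace α] [MeasurableSpace β]
    {ν : Measure (α × β)} {F : α × β → ℂ} (hF : Integrable F ν)
    (h : ∀ A B, MeasurableSet A → MeasurableSet B → ∫ p in A ×ˢ B, F p ∂ν = 0) : F =ᵐ[ν] 0 := by
  have hT : ∫ p, F p ∂ν = 0 := by
    have := h Set.univ Set.univ MeasurableSet.univ MeasurableSet.univ
    rwa [Set.univ_prod_univ, setIntegral_univ] at this
  have key : ∀ s, MeasurableSet s → ∫ p in s, F p ∂ν = 0 := by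
    intro s hs
    induction s, hs using MeasurableSpace.induction_on_inter generateFrom_prod.symm
      isPiSystem_prod with
    | empty => simp
    | basic t ht =>
      obtain ⟨A, hA, B, hB, rfl⟩ := ht
      exact h A B hA hB
    | compl t ht ih =>
      have h2 := integral_add_compl ht hF
      rw [ih, hT, zero_add] at h2
      exact h2
    | iUnion f hd hm ih =>
      rw [integral_iUnion hm hd hF.integrableOn]
      simp [ih]
  exact hF.ae_eq_zero_of_forall_setIntegral_eq_zero fun s hs _ => key s hs

end FourierUniqueness

section TestFields

variable {X : Type*} [MeasurableSpace X] {S : NullHorizon X} {c : NullCoordinate S}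

/-- The function `η(ln u)` on the line, extended by zero to `u ≤ 0`. -/
def compLog (η : ℝ → ℝ) (u : ℝ) : ℝ := if 0 < u then η (Real.log u) else 0

theorem compLog_exp (η : ℝ → ℝ) (τ : ℝ) : compLog η (Real.exp τ) = η τ := by
  rw [compLog, if_pos (Real.exp_pos τ), Real.log_exp]

theorem compLog_eq_zero {η : ℝ → ℝ} {u : ℝ} (hu : u ∉ Real.exp '' tsupport η) : compLog η u = 0 := by
  rw [compLog]
  split_ifs with h
  · exact image_eq_zero_of_notMem_tsupport fun h2 => hu ⟨_, h2, Real.exp_log h⟩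
  · rfl

theorem contDiff_compLog {η : ℝ → ℝ} (hη : ContDiff ℝ (⊤ : ℕ∞) η) (hc : HasCompactSupport η) :
    ContDiff ℝ (⊤ : ℕ∞) (compLog η) := by
  rw [contDiff_iff_contDiffAt]
  intro u
  have hK : IsCompact (Real.exp '' tsupport η) := hc.isCompact.image Real.continuous_exp
  by_cases hu : 0 < u
  · have h1 : ContDiffAt ℝ (⊤ : ℕ∞) (fun u => η (Real.log u)) u :=
      hη.contDiffAt.comp u (Real.contDiffAt_log.2 hu.ne')
    refine h1.congr_of_eventuallyEq ?_
    filter_upwards [lt_mem_nhds hu] with v hv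
    rw [compLog, if_pos hv]
  · have h1 : u ∉ Real.exp '' tsupport η := by
      rintro ⟨τ, -, rfl⟩
      exact hu (Real.exp_pos τ)
    refine (contDiffAt_const (c := (0 : ℝ))).congr_of_eventuallyEq ?_
    filter_upwards [hK.isClosed.isOpen_compl.mem_nhds h1] with v hv
    exact compLog_eq_zero hv

theorem indicator_mul_mem_testFields {μ : Measure X} {A : Set X} (hA : MeasurableSet A)
    (hμ : μ A ≠ ⊤) {ζ : ℝ → ℝ} (hζ : ContDiff ℝ (⊤ : ℕ∞) ζ) {K : Set ℝ} (hK : IsCompact K)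
    {U : Set ℝ} (hKU : K ⊆ U) (hz : ∀ u ∉ K, ζ u = 0) :
    (fun x u => A.indicator (fun _ => (1 : ℝ)) x * ζ u) ∈ testFields μ U := by
  have hc : HasCompactSupport ζ := HasCompactSupport.intro hK hz
  have h1 := (smooth_deriv hζ).2
  have h2 := (smooth_deriv h1).2
  obtain ⟨B0, hB0⟩ := hc.exists_bound_of_continuous hζ.continuous
  obtain ⟨B1, hB1⟩ := hc.deriv.exists_bound_of_continuous h1.continuous
  obtain ⟨B2, hB2⟩ := hc.deriv.deriv.exists_bound_of_continuous h2.continuous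
  refine ⟨?_, fun x => contDiff_const.mul hζ, ⟨K, hK, hKU, fun x u hu => by simp [hz u hu]⟩,
    A.indicator fun _ => B0 ⊔ B1 ⊔ B2, memLp_indicator_const 2 hA _ (Or.inr hμ), fun x u => ?_⟩
  · have := hζ.continuous.measurable
    exact ((measurable_const.indicator hA).comp measurable_fst).mul (this.comp measurable_snd)
  · have e1 : deriv (fun u => A.indicator (fun _ => (1 : ℝ)) x * ζ u) =
        fun u => A.indicator (fun _ => (1 : ℝ)) x * deriv ζ u :=
      funext fun v => deriv_const_mul _ ((smooth_deriv hζ).1 v)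
    have e2 : deriv (fun u => A.indicator (fun _ => (1 : ℝ)) x * deriv ζ u) u =
        A.indicator (fun _ => (1 : ℝ)) x * deriv (deriv ζ) u :=
      deriv_const_mul _ ((smooth_deriv h1).1 u)
    rw [e1, e2]
    by_cases hx : x ∈ A
    · simp only [Set.indicator_of_mem hx, one_mul]
      exact ⟨(hB0 u).trans (le_sup_left.trans le_sup_left),
        (hB1 u).trans (le_sup_right.trans le_sup_left), (hB2 u).trans le_sup_right⟩
    · simp [Set.indicator_of_notMem hx]

/-- The field on the half-horizon given by `1_A(x) η(τ)`. -/
def productField (c : NullCoordinate S) {A : Set X} (hA : MeasurableSet A) (hμ : S.μ A ≠ ⊤)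
    {η : ℝ → ℝ} (hη : ContDiff ℝ (⊤ : ℕ∞) η) (hc : HasCompactSupport η) : HalfPhase c :=
  ⟨ofRescaled c fun x u => A.indicator (fun _ => (1 : ℝ)) x * compLog η u, by
    refine ⟨?_, fun x l hl => if_neg hl⟩
    rw [rescaled_ofRescaled]
    refine indicator_mul_mem_testFields hA hμ (contDiff_compLog hη hc)
      (hc.isCompact.image Real.continuous_exp) ?_ fun u hu => compLog_eq_zero hu
    rintro _ ⟨τ, -, rfl⟩
    exact Real.exp_pos τ⟩

theorem amplitude_productField {A : Set X} (hA : MeasurableSet A) (hμ : S.μ A ≠ ⊤)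
    {η : ℝ → ℝ} (hη : ContDiff ℝ (⊤ : ℕ∞) η) (hc : HasCompactSupport η) (p : ℝ × X) :
    amplitude (tauField (productField c hA hμ hη hc)).1 p =
      A.indicator (fun _ => (1 : ℂ)) p.2 * (√(2 * p.1) * ft η p.1) := by
  have h : (tauField (productField c hA hμ hη hc)).1 p.2 =
      A.indicator (fun _ => (1 : ℝ)) p.2 • η := by
    funext τ
    change rescaled c (ofRescaled c fun x u => A.indicator (fun _ => (1 : ℝ)) x * compLog η u)
      p.2 (Real.exp τ) = _
    rw [rescaled_ofRescaled, compLog_exp]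
    rfl
  rw [amplitude_eq, h, ft_smul]
  by_cases hx : p.2 ∈ A
  · simp [Set.indicator_of_mem hx]
  · simp [Set.indicator_of_notMem hx]

/-- The measure `dω/2π` on the positive frequencies. -/
def frequencyMeasure : Measure ℝ := (1 / (2 * π)).toNNReal • volume.restrict (Set.Ioi 0)

theorem ae_frequencyMeasure {p : ℝ → Prop} :
    (∀ᵐ ω ∂frequencyMeasure, p ω) ↔ ∀ᵐ ω ∂(volume.restrict (Set.Ioi 0)), p ω := by
  have h : ((1 / (2 * π)).toNNReal : ENNReal) ≠ 0 := by
    have : 0 < 1 / (2 * π) := by positivity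
    simpa using Real.pi_pos
  exact Measure.ae_ennreal_smul_measure_iff h

instance : SigmaFinite frequencyMeasure := by
  unfold frequencyMeasure; infer_instance

theorem modeMeasure_eq (μ : Measure X) : modeMeasure μ = frequencyMeasure.prod μ := rfl

theorem integral_frequencyMeasure (F : ℝ → ℂ) :
    ∫ ω, F ω ∂frequencyMeasure = ((1 / (2 * π) : ℝ) : ℂ) * ∫ ω in Set.Ioi 0, F ω := by
  rw [frequencyMeasure, integral_smul_nnreal_measure, NNReal.smul_def,
    Real.coe_toNNReal _ (by positivity), real_smul]

theorem integrable_frequencyMeasure {F : ℝ → ℂ} (hF : Integrable F frequencyMeasure) :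
    IntegrableOn F (Set.Ioi 0) := by
  have h : ((1 / (2 * π)).toNNReal : ENNReal) ≠ 0 := by
    have : 0 < 1 / (2 * π) := by positivity
    simpa using Real.pi_pos
  exact (integrable_smul_measure h (by simp)).1 hF

theorem ft_comp_mul {η : ℝ → ℝ} {a : ℝ} (ha : 0 < a) (ω : ℝ) :
    ft (fun τ => η (a * τ)) ω = (a⁻¹ : ℝ) * ft η (ω / a) := by
  have h := Measure.integral_comp_mul_left
    (fun u : ℝ => Complex.exp (I * (ω / a : ℝ) * u) * η u) a
  rw [abs_of_pos (inv_pos.2 ha), real_smul] at h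
  rw [ft, ft, ← h]
  congr 1; funext τ
  have : (a : ℂ) ≠ 0 := by exact_mod_cast ha.ne'
  congr 2
  push_cast
  field_simp

/-- If `h` is orthogonal (as a vector of a real Hilbert space) to all weighted modes, its
integrals over `{ω} × A` vanish up to the factor `ft η ω`. -/
theorem setIntegral_mul_ft_eq_zero {w : ℝ → ℝ} (hw : IsWeight c w)
    (hpos : ∀ Ω, 0 < Ω → 0 < w Ω) {h : Lp ℂ 2 (modeMeasure S.μ)}
    (horth : ∀ s, (inner ℂ (weightedModes hw s) h).re = 0) {A : Set X} (hA : MeasurableSet A)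
    (hμ : S.μ A ≠ ⊤) {η : ℝ → ℝ} (hη : ContDiff ℝ (⊤ : ℕ∞) η) (hc : HasCompactSupport η) :
    ∀ᵐ ω ∂frequencyMeasure, ft η ω ≠ 0 → ∫ x in A, h (ω, x) ∂S.μ = 0 := by
  set P : ℝ × X → ℂ := fun p => (w p.1 * √(2 * p.1) * (starRingEnd ℂ) (ft η p.1)) *
    A.indicator (fun x => h (p.1, x)) p.2 with hP
  have hηt : ∀ t : ℝ, ContDiff ℝ (⊤ : ℕ∞) fun τ => η (τ + t) := fun t => hη.comp (by fun_prop)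
  have hct : ∀ t : ℝ, HasCompactSupport fun τ => η (τ + t) := fun t =>
    hc.comp_homeomorph (Homeomorph.addRight t)
  have hinner : ∀ t : ℝ, ∀ᵐ p ∂(modeMeasure S.μ),
      inner ℂ (weightedModes hw (productField c hA hμ (hηt t) (hct t)) p) (h p) =
      Complex.exp (I * t * p.1) * P p := by
    intro t
    filter_upwards [(hw (productField c hA hμ (hηt t) (hct t))).coeFn_toLp] with p hp
    rw [show weightedModes hw _ p = _ from hp, amplitude_productField, ft_translate,
      RCLike.inner_apply]
    simp only [map_mul, conj_ofReal, ← Complex.exp_conj, hP]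
    by_cases hx : p.2 ∈ A
    · simp [Set.indicator_of_mem hx]; ring_nf
    · simp [Set.indicator_of_notMem hx]
  have hPi : ∀ t : ℝ, Integrable (fun p : ℝ × X => Complex.exp (I * t * p.1) * P p)
      (frequencyMeasure.prod S.μ) := fun t =>
    (L2.integrable_inner (𝕜 := ℂ) _ _).congr (hinner t)
  have hκ : ∀ t ω : ℝ, ∫ x, Complex.exp (I * t * ω) * P (ω, x) ∂S.μ =
      Complex.exp (I * t * ω) * ((w ω * √(2 * ω) * (starRingEnd ℂ) (ft η ω)) *
        ∫ x in A, h (ω, x) ∂S.μ) := by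
    intro t ω
    rw [integral_const_mul, ← integral_indicator hA]
    congr 1
    simp only [hP]
    rw [integral_const_mul]
  have hz := ae_eq_zero_of_re_integral_exp (κ := fun ω => (w ω * √(2 * ω) *
      (starRingEnd ℂ) (ft η ω)) * ∫ x in A, h (ω, x) ∂S.μ) ?_ ?_
  · rw [ae_frequencyMeasure]
    filter_upwards [hz, ae_restrict_mem measurableSet_Ioi] with ω h1 h2 h3
    have h4 : (w ω : ℂ) ≠ 0 := by exact_mod_cast (hpos ω h2).ne'
    have h5 : ((√(2 * ω) : ℝ) : ℂ) ≠ 0 := by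
      have : 0 < √(2 * ω) := Real.sqrt_pos.2 (mul_pos two_pos h2)
      exact_mod_cast this.ne'
    refine (mul_eq_zero.1 h1).resolve_left (mul_ne_zero (mul_ne_zero h4 h5) ?_)
    simpa using h3
  · refine integrable_frequencyMeasure ?_
    refine (hPi 0).integral_prod_left.congr (Filter.Eventually.of_forall fun ω => ?_)
    simp only [hκ]
    simp
  · intro t
    have h1 := horth (productField c hA hμ (hηt t) (hct t))
    rw [L2.inner_def, integral_congr_ae (hinner t), modeMeasure_eq, integral_prod _ (hPi t)] at h1
    simp only [hκ] at h1
    rw [integral_frequencyMeasure, Complex.re_ofReal_mul] at h1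
    refine (mul_eq_zero.1 h1).resolve_left ?_
    positivity

theorem setIntegral_eq_zero_of_orthogonal {w : ℝ → ℝ} (hw : IsWeight c w)
    (hpos : ∀ Ω, 0 < Ω → 0 < w Ω) {h : Lp ℂ 2 (modeMeasure S.μ)}
    (horth : ∀ s, (inner ℂ (weightedModes hw s) h).re = 0) {A : Set X} (hA : MeasurableSet A)
    (hμ : S.μ A ≠ ⊤) : ∀ᵐ ω ∂frequencyMeasure, ∫ x in A, h (ω, x) ∂S.μ = 0 := by
  let η : ContDiffBump (0 : ℝ) := ⟨1, 2, one_pos, one_lt_two⟩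
  have hη : ContDiff ℝ (⊤ : ℕ∞) η := η.contDiff
  have hηc : HasCompactSupport η := η.hasCompactSupport
  have h0 : ft η 0 ≠ 0 := by
    have : ft η 0 = ((∫ u, η u : ℝ) : ℂ) := by
      rw [ft, ← integral_complex_ofReal]; simp
    rw [this]
    exact_mod_cast η.integral_pos.ne'
  have hall : ∀ᵐ ω ∂frequencyMeasure, ∀ k : ℕ, ft (fun τ => η (((k : ℝ) + 1) * τ)) ω ≠ 0 →
      ∫ x in A, h (ω, x) ∂S.μ = 0 := by
    refine ae_all_iff.2 fun k => ?_
    have hk : ((k : ℝ) + 1) ≠ 0 := by positivity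
    have h1 : ContDiff ℝ (⊤ : ℕ∞) fun τ => η (((k : ℝ) + 1) * τ) := hη.comp (by fun_prop)
    have h2 : HasCompactSupport fun τ => η (((k : ℝ) + 1) * τ) :=
      hηc.comp_homeomorph (Homeomorph.mulLeft₀ _ hk)
    exact setIntegral_mul_ft_eq_zero hw hpos horth hA hμ h1 h2
  filter_upwards [hall] with ω hω
  -- the dilated bump functions have Fourier transforms that are nonzero on ever larger intervals
  have hlim : Filter.Tendsto (fun k : ℕ => ft η (ω / ((k : ℝ) + 1))) Filter.atTop
      (nhds (ft η 0)) := by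
    refine ((continuous_ft hη.continuous hηc).tendsto 0).comp ?_
    exact tendsto_const_div_atTop_nhds_zero_nat ω |>.comp (Filter.tendsto_add_atTop_nat 1) |>.congr
      fun k => by simp
  obtain ⟨k, hk⟩ := (hlim.eventually_ne h0).exists
  refine hω k ?_
  rw [ft_comp_mul (by positivity)]
  refine mul_ne_zero ?_ hk
  have : (((k : ℝ) + 1)⁻¹) ≠ 0 := by positivity
  exact_mod_cast this

theorem eq_zero_of_orthogonal {w : ℝ → ℝ} (hw : IsWeight c w)
    (hpos : ∀ Ω, 0 < Ω → 0 < w Ω) {h : Lp ℂ 2 (modeMeasure S.μ)}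
    (horth : ∀ s, (inner ℂ (weightedModes hw s) h).re = 0) : h = 0 := by
  refine (Lp.eq_zero_iff_ae_eq_zero).2 ?_
  let R : ℕ → Set (ℝ × X) := fun n => Set.Ioc 0 (n : ℝ) ×ˢ spanningSets S.μ n
  have hRm : ∀ n, MeasurableSet (R n) := fun n =>
    measurableSet_Ioc.prod (measurableSet_spanningSets S.μ n)
  have hfin : ∀ n, (modeMeasure S.μ) (R n) < ⊤ := by
    intro n
    rw [modeMeasure_eq, Measure.prod_prod]
    refine ENNReal.mul_lt_top ?_ (measure_spanningSets_lt_top S.μ n)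
    rw [frequencyMeasure, Measure.smul_apply]
    refine ENNReal.mul_lt_top (by simp) ?_
    exact (Measure.restrict_apply_le _ _).trans_lt measure_Ioc_lt_top
  have hint : ∀ n, IntegrableOn h (R n) (modeMeasure S.μ) := by
    intro n
    have : Fact ((modeMeasure S.μ) (R n) < ⊤) := ⟨hfin n⟩
    exact ((Lp.memLp h).restrict (R n)).integrable one_le_two
  have hzero : ∀ n, (R n).indicator h =ᵐ[modeMeasure S.μ] 0 := by
    intro n
    refine ae_eq_zero_of_setIntegral_prod ((hint n).integrable_indicator (hRm n)) fun A B hA hB => ?_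
    rw [setIntegral_indicator (hRm n), Set.prod_inter_prod]
    have hB' : S.μ (B ∩ spanningSets S.μ n) ≠ ⊤ :=
      ((measure_mono Set.inter_subset_right).trans_lt (measure_spanningSets_lt_top S.μ n)).ne
    refine (setIntegral_prod (μ := frequencyMeasure) (ν := S.μ) (fun p => h p) ?_).trans ?_
    rotate_left
    · refine integral_eq_zero_of_ae (ae_restrict_of_ae ?_)
      exact setIntegral_eq_zero_of_orthogonal hw hpos horth
        (hB.inter (measurableSet_spanningSets S.μ n)) hB'
    · exact (hint n).mono_set (Set.prod_mono Set.inter_subset_right Set.inter_subset_right)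
  filter_upwards [ae_all_iff.2 hzero, modeMeasure_ae_pos S.μ] with p h1 h2
  obtain ⟨n, hn⟩ := exists_nat_ge p.1
  obtain ⟨k, hk⟩ : ∃ k, p.2 ∈ spanningSets S.μ k := by
    have := Set.mem_univ p.2
    rw [← iUnion_spanningSets S.μ] at this
    exact Set.mem_iUnion.1 this
  have hmem : p ∈ R (max n k) :=
    ⟨⟨h2, hn.trans (by exact_mod_cast le_max_left n k)⟩,
      monotone_spanningSets S.μ (le_max_right n k) hk⟩
  have := h1 (max n k)
  rwa [Set.indicator_of_mem hmem] at this

theorem real_inner_eq_re {α : Type*} [MeasurableSpace α] {ν : Measure α} (f g : Lp ℂ 2 ν) :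
    inner ℝ f g = (inner ℂ f g).re := by
  rw [L2.inner_def, L2.inner_def, ← RCLike.re_eq_complex_re,
    ← integral_re (L2.integrable_inner _ _)]
  rfl

/-- The weighted modes of the fields on the half-horizon are dense in the one-particle space. -/
theorem exists_weightedModes_near {w : ℝ → ℝ} (hw : IsWeight c w)
    (hpos : ∀ Ω, 0 < Ω → 0 < w Ω) (y : Lp ℂ 2 (modeMeasure S.μ)) {ε : ℝ} (hε : 0 < ε) :
    ∃ s, ‖weightedModes hw s - y‖ < ε := by
  have htop : (LinearMap.range (weightedModes hw)).topologicalClosure = ⊤ := by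
    rw [Submodule.topologicalClosure_eq_top_iff, Submodule.eq_bot_iff]
    intro h hh
    refine eq_zero_of_orthogonal hw hpos fun s => ?_
    rw [← real_inner_eq_re]
    exact (Submodule.mem_orthogonal _ _).1 hh _ ⟨s, rfl⟩
  have hy : y ∈ closure (Set.range (weightedModes hw)) := by
    have h1 : y ∈ (LinearMap.range (weightedModes hw)).topologicalClosure := by
      rw [htop]; trivial
    rwa [← SetLike.mem_coe, Submodule.topologicalClosure_coe, LinearMap.coe_range] at h1
  obtain ⟨_, ⟨s, rfl⟩, hs⟩ := Metric.mem_closure_iff.1 hy ε hε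
  exact ⟨s, by rwa [dist_comm, dist_eq_norm] at hs⟩

end TestFields

/-! ### Gaussian integrals in finite dimension -/

section Gaussian

open Matrix

variable {m : ℕ}

/-- The quadratic form `k ↦ kᵀ A k` of a real matrix at a complex vector. -/
def complexForm (A : Matrix (Fin m) (Fin m) ℝ) (k : Fin m → ℂ) : ℂ :=
  k ⬝ᵥ A.map (fun x : ℝ => (x : ℂ)) *ᵥ k

open scoped MatrixOrder in
theorem exists_eq_transpose_mul_self {A : Matrix (Fin m) (Fin m) ℝ} (hA : A.PosDef) :
    ∃ B : Matrix (Fin m) (Fin m) ℝ, A = Bᵀ * B ∧ B.det ≠ 0 := by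
  obtain ⟨B, hB⟩ := CStarAlgebra.nonneg_iff_eq_star_mul_self.mp hA.posSemidef.nonneg
  have hB' : A = Bᵀ * B := hB
  refine ⟨B, hB', fun h => hA.det_pos.ne' ?_⟩
  rw [hB', det_mul, h, mul_zero]

theorem integral_comp_mulVec {B : Matrix (Fin m) (Fin m) ℝ} (hB : B.det ≠ 0)
    (F : (Fin m → ℝ) → ℂ) :
    ∫ r, F r = (|B.det| : ℝ) * ∫ r, F (B *ᵥ r) := by
  have h := Real.map_matrix_volume_pi_eq_smul_volume_pi hB
  have hc : Function.Injective (toLin' B) := by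
    rw [toLin'_apply']
    exact mulVec_injective_iff_isUnit.2 ((isUnit_iff_isUnit_det B).2 hB.isUnit)
  have hemb : MeasurableEmbedding (toLin' B) :=
    (LinearMap.isClosedEmbedding_of_injective (LinearMap.ker_eq_bot.2 hc)).measurableEmbedding
  have h2 := hemb.integral_map (μ := (volume : Measure (Fin m → ℝ))) F
  rw [h, integral_smul_measure, ENNReal.toReal_ofReal (abs_nonneg _), real_smul] at h2
  simp only [toLin'_apply] at h2
  rw [← h2, ← mul_assoc, ← ofReal_mul, abs_inv, mul_inv_cancel₀ (abs_ne_zero.2 hB)]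
  simp

/-- The Gaussian integral with a complex linear term. -/
theorem integral_gaussian {A : Matrix (Fin m) (Fin m) ℝ} (hA : A.PosDef) :
    ∃ Z : ℝ, 0 < Z ∧ ∀ k : Fin m → ℂ,
      ∫ r : Fin m → ℝ, Complex.exp (-((r ⬝ᵥ A *ᵥ r : ℝ) : ℂ) + ∑ i, k i * r i) =
        Z * Complex.exp (complexForm A⁻¹ k / 4) := by
  obtain ⟨B, rfl, hB⟩ := exists_eq_transpose_mul_self hA
  have hBi : B⁻¹.det ≠ 0 := by
    rw [det_nonsing_inv, Ring.inverse_eq_inv']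
    exact inv_ne_zero hB
  have hBB : B * B⁻¹ = 1 := mul_nonsing_inv _ hB.isUnit
  refine ⟨|B⁻¹.det| * π ^ (m / 2 : ℝ), by positivity, fun k => ?_⟩
  rw [integral_comp_mulVec hBi]
  have hq : ∀ r : Fin m → ℝ, (B⁻¹ *ᵥ r) ⬝ᵥ (Bᵀ * B) *ᵥ (B⁻¹ *ᵥ r) = ∑ i, r i ^ 2 := by
    intro r
    rw [← mulVec_mulVec, mulVec_mulVec r B, hBB, one_mulVec, mulVec_transpose,
      dotProduct_comm, ← dotProduct_mulVec, mulVec_mulVec, hBB, one_mulVec]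
    simp [dotProduct, sq]
  set c : Fin m → ℂ := k ᵥ* B⁻¹.map (fun x : ℝ => (x : ℂ)) with hc
  have hl : ∀ r : Fin m → ℝ, ∑ i, k i * ((B⁻¹ *ᵥ r) i : ℝ) = ∑ i, c i * r i := by
    intro r
    have h1 : (fun i => (((B⁻¹ *ᵥ r) i : ℝ) : ℂ)) =
        B⁻¹.map (fun x : ℝ => (x : ℂ)) *ᵥ fun i => (r i : ℂ) := by
      funext i
      simp [mulVec, dotProduct]
    change k ⬝ᵥ (fun i => (((B⁻¹ *ᵥ r) i : ℝ) : ℂ)) = c ⬝ᵥ fun i => (r i : ℂ)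
    rw [h1, dotProduct_mulVec]
  have hform : complexForm (Bᵀ * B)⁻¹ k = ∑ i, c i ^ 2 := by
    have h1 : (Bᵀ * B)⁻¹.map (fun x : ℝ => (x : ℂ)) =
        B⁻¹.map (fun x : ℝ => (x : ℂ)) * (B⁻¹.map (fun x : ℝ => (x : ℂ)))ᵀ := by
      rw [Matrix.mul_inv_rev, ← transpose_nonsing_inv, ← transpose_map]
      exact Matrix.map_mul (f := Complex.ofRealHom)
    rw [complexForm, h1, dotProduct_mulVec, ← vecMul_vecMul, ← hc, vecMul_transpose,
      dotProduct_comm, dotProduct_mulVec, ← hc]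
    simp [dotProduct, sq]
  have hG := GaussianFourier.integral_cexp_neg_mul_sum_add (b := 1) (ι := Fin m) (by simp) c
  simp only [hq, hl, hform]
  have e1 : ∀ r : Fin m → ℝ, Complex.exp (-((∑ i, r i ^ 2 : ℝ) : ℂ) + ∑ i, c i * r i) =
      Complex.exp (-1 * ∑ i, (r i : ℂ) ^ 2 + ∑ i, c i * r i) := by
    intro r; push_cast; ring_nf
  simp only [e1]
  rw [hG, Fintype.card_fin, mul_one, div_one]
  push_cast
  rw [Complex.ofReal_cpow Real.pi_pos.le]
  push_cast
  ring

theorem dotProduct_mulVec_symm {A : Matrix (Fin m) (Fin m) ℝ} (hA : Aᵀ = A) (x y : Fin m → ℝ) :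
    x ⬝ᵥ A *ᵥ y = y ⬝ᵥ A *ᵥ x := by
  rw [dotProduct_mulVec, dotProduct_comm, ← mulVec_transpose, hA]

theorem form_add {A : Matrix (Fin m) (Fin m) ℝ} (hA : Aᵀ = A) (x y : Fin m → ℝ) :
    (x + y) ⬝ᵥ A *ᵥ (x + y) = x ⬝ᵥ A *ᵥ x + 2 * (x ⬝ᵥ A *ᵥ y) + y ⬝ᵥ A *ᵥ y := by
  rw [mulVec_add, dotProduct_add, add_dotProduct, add_dotProduct, dotProduct_mulVec_symm hA y x]
  ring

/-- The values of a quadratic form at complex vectors, by polarization of its real values. -/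
theorem complexForm_add_mul_I {A : Matrix (Fin m) (Fin m) ℝ} (hA : Aᵀ = A) (x y : Fin m → ℝ) :
    complexForm A (fun i => (x i : ℂ) + y i * I) =
      ((x ⬝ᵥ A *ᵥ x - y ⬝ᵥ A *ᵥ y : ℝ) : ℂ) + ((2 * (x ⬝ᵥ A *ᵥ y) : ℝ) : ℂ) * I := by
  have h1 : (fun i => (x i : ℂ) + y i * I) = (fun i => (x i : ℂ)) + I • fun i => (y i : ℂ) := by
    funext i; simp [mul_comm]
  have h2 : ∀ u v : Fin m → ℝ, (fun i => (u i : ℂ)) ⬝ᵥ A.map (fun x : ℝ => (x : ℂ)) *ᵥ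
      (fun i => (v i : ℂ)) = ((u ⬝ᵥ A *ᵥ v : ℝ) : ℂ) := by
    intro u v; simp [dotProduct, mulVec]
  rw [complexForm, h1, mulVec_add, mulVec_smul, dotProduct_add, add_dotProduct, add_dotProduct,
    dotProduct_smul, dotProduct_smul, smul_dotProduct, smul_dotProduct, h2, h2, h2, h2,
    dotProduct_mulVec_symm hA y x]
  simp only [smul_eq_mul]
  push_cast
  linear_combination ((y ⬝ᵥ A *ᵥ y : ℝ) : ℂ) * I_mul_I

theorem transpose_eq_of_posDef {A : Matrix (Fin m) (Fin m) ℝ} (hA : A.PosDef) : Aᵀ = A := by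
  have := hA.isHermitian
  rwa [IsHermitian, conjTranspose_eq_transpose_of_trivial] at this

/-- The maximum of the concave function `r ↦ k·r - rᵀ A r` is `kᵀ A⁻¹ k / 4`: it is attained. -/
theorem exists_form_inv_eq {A : Matrix (Fin m) (Fin m) ℝ} (hA : A.PosDef) (k : Fin m → ℝ) :
    ∃ r, (k ⬝ᵥ A⁻¹ *ᵥ k) / 4 = k ⬝ᵥ r - r ⬝ᵥ A *ᵥ r := by
  refine ⟨(1 / 2 : ℝ) • (A⁻¹ *ᵥ k), ?_⟩
  have h : A * A⁻¹ = 1 := mul_nonsing_inv _ ((isUnit_iff_isUnit_det A).1 hA.isUnit)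
  rw [mulVec_smul, mulVec_mulVec, h, one_mulVec, dotProduct_smul, dotProduct_smul,
    smul_dotProduct, dotProduct_comm (A⁻¹ *ᵥ k) k]
  simp only [smul_eq_mul]
  ring

/-- The maximum of the concave function `r ↦ k·r - rᵀ A r` is `kᵀ A⁻¹ k / 4`: it is a bound. -/
theorem le_form_inv {A : Matrix (Fin m) (Fin m) ℝ} (hA : A.PosDef) (k r : Fin m → ℝ) :
    k ⬝ᵥ r - r ⬝ᵥ A *ᵥ r ≤ (k ⬝ᵥ A⁻¹ *ᵥ k) / 4 := by
  have h : A * A⁻¹ = 1 := mul_nonsing_inv _ ((isUnit_iff_isUnit_det A).1 hA.isUnit)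
  have ht := transpose_eq_of_posDef hA
  have h0 := hA.posSemidef.dotProduct_mulVec_nonneg (r - (1 / 2 : ℝ) • (A⁻¹ *ᵥ k))
  rw [star_trivial, sub_eq_add_neg, form_add ht, mulVec_neg, mulVec_smul, mulVec_mulVec, h,
    one_mulVec] at h0
  simp only [dotProduct_neg, neg_dotProduct, dotProduct_smul, smul_dotProduct, smul_eq_mul,
    dotProduct_comm r k, dotProduct_comm (A⁻¹ *ᵥ k) k] at h0
  linarith

end Gaussian

/-! ### Symplectic frames -/

section Frames

variable {X : Type*} [MeasurableSpace X] {S : NullHorizon X} {c : NullCoordinate S}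

theorem symplecticForm_eq_im (f g : HalfPhase c) : symplecticForm S f.1 g.1 =
    2 * (inner ℂ (modesTauL c f) (modesTauL c g)).im := by
  rw [modesTauL_apply, modesTauL_apply, symplecticForm_eq_im_modesTau]

theorem real_smul_Lp {α : Type*} [MeasurableSpace α] {ν : Measure α} (r : ℝ) (f : Lp ℂ 2 ν) :
    r • f = (r : ℂ) • f := by
  refine Lp.ext ?_
  filter_upwards [Lp.coeFn_smul r f, Lp.coeFn_smul (r : ℂ) f] with p h1 h2
  rw [h1, h2, Pi.smul_apply, Pi.smul_apply, real_smul, smul_eq_mul]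

/-- The symplectic form of the half-horizon as a bilinear form. -/
def symplecticBilin (c : NullCoordinate S) : LinearMap.BilinForm ℝ (HalfPhase c) :=
  LinearMap.mk₂ ℝ (fun f g => symplecticForm S f.1 g.1)
    (fun f f' g => by
      simp only [symplecticForm_eq_im, map_add, inner_add_left, Complex.add_im]; ring)
    (fun r f g => by
      simp only [symplecticForm_eq_im, map_smul, smul_eq_mul]
      rw [real_smul_Lp, inner_smul_left, conj_ofReal, Complex.im_ofReal_mul]; ring)
    (fun f g g' => by
      simp only [symplecticForm_eq_im, map_add, inner_add_right, Complex.add_im]; ring)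
    (fun r f g => by
      simp only [symplecticForm_eq_im, map_smul, smul_eq_mul]
      rw [real_smul_Lp, inner_smul_right, Complex.im_ofReal_mul]; ring)

theorem symplecticBilin_apply (f g : HalfPhase c) :
    symplecticBilin c f g = symplecticForm S f.1 g.1 := rfl

theorem symplecticBilin_swap (f g : HalfPhase c) :
    symplecticBilin c f g = -symplecticBilin c g f := by
  rw [symplecticBilin_apply, symplecticBilin_apply, symplecticForm_eq_im, symplecticForm_eq_im,
    ← inner_conj_symm, Complex.conj_im]
  ring

theorem symplecticBilin_self (f : HalfPhase c) : symplecticBilin c f f = 0 := by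
  have := symplecticBilin_swap f f
  linarith

variable {m : ℕ}

theorem combine_cons (f : HalfPhase c) (v : Fin m → HalfPhase c) (t : ℝ) (r : Fin m → ℝ) :
    combine (Fin.cons f v : Fin (m + 1) → HalfPhase c) (Fin.cons t r : Fin (m + 1) → ℝ) =
      t • f + combine v r := by
  simp [combine, Fin.sum_univ_succ]

/-- Bilinear forms in coordinates. -/
theorem dotProduct_bilin (B : LinearMap.BilinForm ℝ (HalfPhase c)) (v : Fin m → HalfPhase c)
    (r s : Fin m → ℝ) :
    r ⬝ᵥ (Matrix.of fun i j => B (v i) (v j)).mulVec s = B (combine v r) (combine v s) := by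
  simp only [combine, map_sum, map_smul, LinearMap.sum_apply, LinearMap.smul_apply, smul_eq_mul,
    dotProduct, Matrix.mulVec, Matrix.of_apply, Finset.mul_sum]
  rw [Finset.sum_comm]
  refine Finset.sum_congr rfl fun i _ => Finset.sum_congr rfl fun j _ => ?_
  ring

theorem vecMul_bilin (B : LinearMap.BilinForm ℝ (HalfPhase c)) (v : Fin m → HalfPhase c)
    (r : Fin m → ℝ) (j : Fin m) :
    Matrix.vecMul r (Matrix.of fun i j => B (v i) (v j)) j = B (combine v r) (v j) := by
  simp [combine, Matrix.vecMul, dotProduct]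

theorem isSymplecticFrame_iff {v : Fin m → HalfPhase c} : IsSymplecticFrame v ↔
    ∀ r, (∀ j, symplecticBilin c (combine v r) (v j) = 0) → r = 0 := by
  have h := Matrix.exists_vecMul_eq_zero_iff
    (M := Matrix.of fun i j => symplecticBilin c (v i) (v j))
  have h2 : ∀ r, Matrix.vecMul r (Matrix.of fun i j => symplecticBilin c (v i) (v j)) = 0 ↔
      ∀ j, symplecticBilin c (combine v r) (v j) = 0 := fun r => by
    rw [funext_iff]
    simp only [vecMul_bilin, Pi.zero_apply]
  rw [IsSymplecticFrame]
  change (Matrix.of fun i j => symplecticBilin c (v i) (v j)).det ≠ 0 ↔ _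
  rw [Ne, ← h]
  push Not
  refine forall_congr' fun r => ?_
  rw [← h2]
  tauto

/-- Every field has a symplectic projection onto the span of a symplectic frame. -/
theorem IsSymplecticFrame.exists_projection {v : Fin m → HalfPhase c} (hv : IsSymplecticFrame v)
    (f : HalfPhase c) :
    ∃ r, ∀ j, symplecticBilin c (combine v r) (v j) = symplecticBilin c f (v j) := by
  refine ⟨Matrix.vecMul (fun j => symplecticBilin c f (v j))
    (Matrix.of fun i j => symplecticBilin c (v i) (v j))⁻¹, fun j => ?_⟩
  have hdet : IsUnit (Matrix.of fun i j => symplecticBilin c (v i) (v j)).det := hv.isUnit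
  rw [← vecMul_bilin, Matrix.vecMul_vecMul, Matrix.nonsing_inv_mul _ hdet, Matrix.vecMul_one]

theorem symplecticBilin_combine_eq_zero {v : Fin m → HalfPhase c} {f : HalfPhase c}
    (h : ∀ j, symplecticBilin c f (v j) = 0) (r : Fin m → ℝ) :
    symplecticBilin c f (combine v r) = 0 := by
  simp [combine, h]

/-- Every finite set of fields is contained, up to the kernel of the symplectic form, in the span
of a symplectic frame: a field that is not yet in the span is added to the frame, after symplectic
projection, together with a field conjugate to it. -/
theorem exists_symplecticFrame (F : Finset (HalfPhase c)) :
    ∃ (m : ℕ) (v : Fin m → HalfPhase c), IsSymplecticFrame v ∧ Contains v F := by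
  classical
  induction F using Finset.induction_on with
  | empty =>
    refine ⟨0, Fin.elim0, ?_, by simp [Contains]⟩
    rw [IsSymplecticFrame, Matrix.det_isEmpty]
    exact one_ne_zero
  | insert f F hf ih =>
    obtain ⟨m, v, hv, hF⟩ := ih
    obtain ⟨r, hr⟩ := hv.exists_projection f
    set f' := f - combine v r with hf'
    have hf'v : ∀ j, symplecticBilin c f' (v j) = 0 := fun j => by
      rw [hf', map_sub, LinearMap.sub_apply, hr, sub_self]
    by_cases hker : ∀ h, symplecticBilin c f' h = 0
    · refine ⟨m, v, hv, fun g hg => ?_⟩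
      rcases Finset.mem_insert.1 hg with rfl | hg
      · refine ⟨r, fun h => ?_⟩
        have := hker h
        rw [hf', map_sub, LinearMap.sub_apply, sub_eq_zero] at this
        exact this.symm
      · exact hF g hg
    · push Not at hker
      obtain ⟨h, hh⟩ := hker
      obtain ⟨s, hs⟩ := hv.exists_projection h
      set h' := h - combine v s with hh'
      have hh'v : ∀ j, symplecticBilin c h' (v j) = 0 := fun j => by
        rw [hh', map_sub, LinearMap.sub_apply, hs, sub_self]
      have hfh : symplecticBilin c f' h' ≠ 0 := by
        rw [hh', map_sub, symplecticBilin_combine_eq_zero hf'v, sub_zero]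
        exact hh
      refine ⟨m + 2, Fin.cons f' (Fin.cons h' v : Fin (m + 1) → HalfPhase c), ?_, fun g hg => ?_⟩
      · rw [isSymplecticFrame_iff]
        intro q hq
        obtain ⟨a, q1, rfl⟩ : ∃ a q1, q = (Fin.cons a q1 : Fin (m + 2) → ℝ) :=
          ⟨q 0, Fin.tail q, (Fin.cons_self_tail q).symm⟩
        obtain ⟨b, q2, rfl⟩ : ∃ b q2, q1 = (Fin.cons b q2 : Fin (m + 1) → ℝ) :=
          ⟨q1 0, Fin.tail q1, (Fin.cons_self_tail q1).symm⟩
        rw [combine_cons, combine_cons] at hq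
        have hv0 : ∀ u, (∀ j, symplecticBilin c u (v j) = 0) →
            symplecticBilin c (combine v q2) u = 0 := fun u hu => by
          rw [symplecticBilin_swap, symplecticBilin_combine_eq_zero hu, neg_zero]
        have e0 := hq 0
        have e1 := hq 1
        have e2 : ∀ j, symplecticBilin c (a • f' + (b • h' + combine v q2)) (v j) = 0 := fun j => by
          simpa using hq j.succ.succ
        rw [Fin.cons_zero] at e0
        rw [show (1 : Fin (m + 2)) = Fin.succ 0 from rfl, Fin.cons_succ, Fin.cons_zero] at e1
        simp only [map_add, map_smul, LinearMap.add_apply, LinearMap.smul_apply, smul_eq_mul,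
          symplecticBilin_self, hv0 _ hf'v, hv0 _ hh'v, mul_zero, add_zero, zero_add,
          symplecticBilin_swap h' f', mul_neg, neg_eq_zero, mul_eq_zero, hfh, or_false] at e0 e1
        simp only [map_add, map_smul, LinearMap.add_apply, LinearMap.smul_apply, smul_eq_mul,
          hf'v, hh'v, mul_zero, zero_add] at e2
        rw [e0, e1, isSymplecticFrame_iff.1 hv q2 e2]
        funext i
        refine Fin.cases rfl (fun i => Fin.cases rfl (fun i => rfl) i) i
      · rcases Finset.mem_insert.1 hg with rfl | hg
        · refine ⟨Fin.cons 1 (Fin.cons 0 r : Fin (m + 1) → ℝ), fun u => ?_⟩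
          rw [combine_cons, combine_cons, one_smul, zero_smul, zero_add, hf', sub_add_cancel]
        · obtain ⟨q, hq⟩ := hF g hg
          refine ⟨Fin.cons 0 (Fin.cons 0 q : Fin (m + 1) → ℝ), fun u => ?_⟩
          rw [combine_cons, combine_cons, zero_smul, zero_smul, zero_add, zero_add]
          exact hq u

/-- The symplectic frames, directed by the finite sets of fields they contain: convergence along
this filter is convergence as the set of modes grows. -/
def frameFilter (c : NullCoordinate S) : Filter (Σ m : ℕ, Fin m → HalfPhase c) :=
  ⨅ F : Finset (HalfPhase c), Filter.principal {V | IsSymplecticFrame V.2 ∧ Contains V.2 F}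

theorem hasBasis_frameFilter (c : NullCoordinate S) : (frameFilter c).HasBasis (fun _ => True)
    fun F : Finset (HalfPhase c) => {V | IsSymplecticFrame V.2 ∧ Contains V.2 F} := by
  classical
  refine Filter.hasBasis_iInf_principal fun F F' => ⟨F ∪ F', ?_, ?_⟩
  · exact fun V hV => ⟨hV.1, fun f hf => hV.2 f (Finset.mem_union_left _ hf)⟩
  · exact fun V hV => ⟨hV.1, fun f hf => hV.2 f (Finset.mem_union_right _ hf)⟩

instance (c : NullCoordinate S) : (frameFilter c).NeBot := by
  rw [(hasBasis_frameFilter c).neBot_iff]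
  intro F _
  obtain ⟨m, v, hv, hF⟩ := exists_symplecticFrame F
  exact ⟨⟨m, v⟩, hv, hF⟩

theorem tendsto_frameFilter {E : Type*} [SeminormedAddCommGroup E]
    {q : (Σ m : ℕ, Fin m → HalfPhase c) → E} {l : E} :
    Filter.Tendsto q (frameFilter c) (nhds l) ↔ ∀ ε > 0, ∃ F : Finset (HalfPhase c),
      ∀ (m : ℕ) (v : Fin m → HalfPhase c), IsSymplecticFrame v → Contains v F →
        ‖q ⟨m, v⟩ - l‖ < ε := by
  rw [(hasBasis_frameFilter c).tendsto_iff Metric.nhds_basis_ball]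
  simp only [Metric.mem_ball, dist_eq_norm, Set.mem_ofPred_eq, true_and]
  refine forall₂_congr fun ε _ => exists_congr fun F => ⟨fun h m v hv hF => h ⟨m, v⟩ ⟨hv, hF⟩,
    fun h V hV => h V.1 V.2 hV.1 hV.2⟩

theorem eventually_isSymplecticFrame (c : NullCoordinate S) :
    ∀ᶠ V in frameFilter c, IsSymplecticFrame V.2 :=
  (hasBasis_frameFilter c).eventually_iff.2 ⟨∅, trivial, fun _ hV => hV.1⟩

theorem eventually_represents (f : HalfPhase c) :
    ∀ᶠ V in frameFilter c, IsSymplecticFrame V.2 ∧ ∃ r, Represents V.2 r f :=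
  (hasBasis_frameFilter c).eventually_iff.2
    ⟨{f}, trivial, fun _ hV => ⟨hV.1, hV.2 f (Finset.mem_singleton_self f)⟩⟩

end Frames

/-! ### The weights of the wavefunctional and of the thermal density operator -/

section Weights

variable {X : Type*} [MeasurableSpace X] {S : NullHorizon X} {c : NullCoordinate S}

/-- Multiplication by a function of the frequency with values in `[0, 1]`. -/
def frequencyMultiplier (X : Type*) [MeasurableSpace X] (b : ℝ → ℝ) (hb : Measurable b)
    (h0 : ∀ Ω, 0 ≤ b Ω) (h1 : ∀ Ω, b Ω ≤ 1) : Multiplier (ℝ × X) :=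
  ⟨fun p => (b p.1 : ℂ), by fun_prop, fun p => by
    rw [Complex.norm_real, Real.norm_eq_abs, abs_of_nonneg (h0 _)]; exact h1 _⟩

theorem boltzmann_pos (Ω : ℝ) : 0 < Real.exp (-(π * |Ω|)) := Real.exp_pos _

theorem boltzmann_le_one (Ω : ℝ) : Real.exp (-(π * |Ω|)) ≤ 1 :=
  Real.exp_le_one_iff.2 (neg_nonpos.2 (by positivity))

/-- Multiplication by `e^{-πΩ}` (extended evenly to `Ω < 0`). -/
def boltzmann (X : Type*) [MeasurableSpace X] : Multiplier (ℝ × X) :=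
  frequencyMultiplier X (fun Ω => Real.exp (-(π * |Ω|))) (by fun_prop)
    (fun Ω => (boltzmann_pos Ω).le) boltzmann_le_one

/-- Multiplication by `√tanh(πΩ/2)`, the inverse of the weight of the vacuum wavefunctional. -/
def sqrtTanh (X : Type*) [MeasurableSpace X] : Multiplier (ℝ × X) :=
  frequencyMultiplier X
    (fun Ω => √((1 - Real.exp (-(π * |Ω|))) / (1 + Real.exp (-(π * |Ω|))))) (by fun_prop)
    (fun Ω => Real.sqrt_nonneg _) fun Ω => Real.sqrt_le_one.2 (by
      have := boltzmann_pos Ω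
      rw [div_le_one (by linarith)]; linarith)

/-- Multiplication by `√(1 - e^{-2πΩ})`. -/
def sqrtOneSub (X : Type*) [MeasurableSpace X] : Multiplier (ℝ × X) :=
  frequencyMultiplier X (fun Ω => √(1 - Real.exp (-(π * |Ω|)) ^ 2)) (by fun_prop)
    (fun Ω => Real.sqrt_nonneg _) fun Ω => Real.sqrt_le_one.2 (by
      have := boltzmann_pos Ω
      nlinarith)

theorem conj_frequencyMultiplier (b : ℝ → ℝ) (hb : Measurable b) (h0 : ∀ Ω, 0 ≤ b Ω)
    (h1 : ∀ Ω, b Ω ≤ 1) : (frequencyMultiplier X b hb h0 h1).conj =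
      frequencyMultiplier X b hb h0 h1 := by
  refine Subtype.ext (funext fun p => ?_)
  exact conj_ofReal _

theorem coth_eq {x : ℝ} (hx : 0 < x) : coth x =
    (1 + Real.exp (-x) ^ 2) / (1 - Real.exp (-x) ^ 2) := by
  have h1 : Real.exp (-x) < 1 := Real.exp_lt_one_iff.2 (by linarith)
  have h0 := Real.exp_pos (-x)
  have h2 : 0 < 1 - Real.exp (-x) ^ 2 := by nlinarith
  have h3 : Real.sinh x ≠ 0 := (Real.sinh_pos_iff.2 hx).ne'
  have h4 : Real.exp x = (Real.exp (-x))⁻¹ := by rw [Real.exp_neg, inv_inv]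
  rw [coth, div_eq_div_iff h3 h2.ne', Real.cosh_eq, Real.sinh_eq, h4]
  field_simp

theorem sqrtTanh_mul_waveWeight {Ω : ℝ} (hΩ : 0 < Ω) :
    √((1 - Real.exp (-(π * |Ω|))) / (1 + Real.exp (-(π * |Ω|)))) * waveWeight Ω = 1 := by
  have hx : 0 < π * Ω / 2 := by positivity
  have h0 := Real.exp_pos (-(π * Ω))
  have h1 : Real.exp (-(π * Ω)) < 1 := Real.exp_lt_one_iff.2 (by have := mul_pos Real.pi_pos hΩ; linarith)
  have he : Real.exp (-(π * Ω / 2)) ^ 2 = Real.exp (-(π * Ω)) := by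
    rw [← Real.exp_nat_mul]; congr 1; push_cast; ring
  have h2 : 0 < 1 - Real.exp (-(π * Ω)) := by linarith
  have h3 : 0 < 1 + Real.exp (-(π * Ω)) := by linarith
  rw [waveWeight, abs_of_pos hΩ, ← Real.sqrt_mul (div_pos h2 h3).le, coth_eq hx, he,
    div_mul_div_comm, mul_comm, div_self (mul_pos h3 h2).ne', Real.sqrt_one]

theorem modesTauL_eq (f : HalfPhase c) :
    modesTauL c f = (sqrtTanh X).toCLM (waveModes c f) := by
  refine Lp.ext ?_
  filter_upwards [(isWeight_one c f).coeFn_toLp, (isWeight_waveWeight c f).coeFn_toLp,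
    (sqrtTanh X).coeFn_toCLM (waveModes c f), modeMeasure_ae_pos S.μ] with p h1 h2 h3 h4
  rw [h3, show waveModes c f p = _ from h2, show modesTauL c f p = _ from h1]
  change _ = ((√((1 - Real.exp (-(π * |p.1|))) / (1 + Real.exp (-(π * |p.1|)))) : ℝ) : ℂ) * _
  rw [← mul_assoc, ← ofReal_mul, sqrtTanh_mul_waveWeight h4]

theorem norm_sq_eq_integral {α : Type*} [MeasurableSpace α] {ν : Measure α} (f : Lp ℂ 2 ν) :
    ‖f‖ ^ 2 = ∫ p, ‖f p‖ ^ 2 ∂ν := by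
  have h := norm_sq_toLp (Lp.memLp f)
  rwa [Lp.toLp_coeFn] at h

theorem integrable_norm_sq {α : Type*} [MeasurableSpace α] {ν : Measure α} (f : Lp ℂ 2 ν) :
    Integrable (fun p => ‖f p‖ ^ 2) ν :=
  (memLp_two_iff_integrable_sq_norm (Lp.aestronglyMeasurable f)).1 (Lp.memLp f)

/-- `2 coth x = tanh(x/2) + coth(x/2)`, in terms of the norms with these weights. -/
theorem norm_sq_vacuumModes (f : HalfPhase c) : ‖vacuumModes c f‖ ^ 2 =
    (‖(sqrtTanh X).toCLM (modesTauL c f)‖ ^ 2 + ‖waveModes c f‖ ^ 2) / 2 := by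
  rw [norm_sq_eq_integral, norm_sq_eq_integral, norm_sq_eq_integral,
    ← integral_add (integrable_norm_sq _) (integrable_norm_sq _), ← integral_div]
  refine integral_congr_ae ?_
  filter_upwards [(isWeight_one c f).coeFn_toLp, (isWeight_waveWeight c f).coeFn_toLp,
    (isWeight_vacuumWeight c f).coeFn_toLp,
    (sqrtTanh X).coeFn_toCLM (modesTauL c f), modeMeasure_ae_pos S.μ] with p h1 h2 h3 h4 h5
  rw [h4, show waveModes c f p = _ from h2, show vacuumModes c f p = _ from h3,
    show modesTauL c f p = _ from h1]
  change _ = (‖((√((1 - Real.exp (-(π * |p.1|))) / (1 + Real.exp (-(π * |p.1|)))) : ℝ) : ℂ) * _‖ ^ 2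
    + _) / 2
  have hx : 0 < π * p.1 := mul_pos Real.pi_pos h5
  have h0 := Real.exp_pos (-(π * p.1))
  have h1 : Real.exp (-(π * p.1)) < 1 := Real.exp_lt_one_iff.2 (by linarith)
  have he : Real.exp (-(π * p.1 / 2)) ^ 2 = Real.exp (-(π * p.1)) := by
    rw [← Real.exp_nat_mul]; congr 1; push_cast; ring
  have h2 : 0 < 1 - Real.exp (-(π * p.1)) := by linarith
  have h3 : 0 < 1 + Real.exp (-(π * p.1)) := by linarith
  simp only [norm_mul, Complex.norm_real, Real.norm_eq_abs, mul_pow, sq_abs, ofReal_one,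
    one_mul, vacuumWeight, waveWeight]
  rw [abs_of_pos h5, Real.sq_sqrt (div_pos h2 h3).le, Real.sq_sqrt (coth_pos hx).le,
    Real.sq_sqrt (coth_pos (half_pos hx)).le, coth_eq hx, coth_eq (half_pos hx), he]
  have h6 : 1 - Real.exp (-(π * p.1)) ^ 2 ≠ 0 := by nlinarith
  field_simp
  ring

/-- A field in the kernel of the symplectic form has no modes. -/
theorem modesTauL_eq_zero {f : HalfPhase c} (h : ∀ g, symplecticBilin c f g = 0) :
    modesTauL c f = 0 := by
  have h1 : I • modesTauL c f = 0 := by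
    refine eq_zero_of_orthogonal (isWeight_one c) (fun _ _ => one_pos) fun g => ?_
    have h2 := h g
    rw [symplecticBilin_swap, symplecticBilin_apply, symplecticForm_eq_im] at h2
    change (inner ℂ (modesTauL c g) (I • modesTauL c f)).re = 0
    rw [inner_smul_right, Complex.I_mul_re]
    linarith
  exact (smul_eq_zero.1 h1).resolve_left I_ne_zero

theorem waveModes_eq_zero {f : HalfPhase c} (h : modesTauL c f = 0) : waveModes c f = 0 := by
  refine Lp.ext ?_
  have h0 := Lp.coeFn_zero ℂ 2 (modeMeasure S.μ)
  filter_upwards [(isWeight_one c f).coeFn_toLp, (isWeight_waveWeight c f).coeFn_toLp, h0]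
    with p h1 h2 h3
  have h4 : modesTauL c f p = _ := h1
  rw [h, h3] at h4
  rw [show waveModes c f p = _ from h2, h3]
  simp only [ofReal_one, one_mul] at h4
  rw [← h4]
  simp

theorem Represents.symplecticBilin_sub {m : ℕ} {v : Fin m → HalfPhase c} {r : Fin m → ℝ}
    {f : HalfPhase c} (h : Represents v r f) (g : HalfPhase c) :
    symplecticBilin c (combine v r - f) g = 0 := by
  rw [map_sub, LinearMap.sub_apply, sub_eq_zero]
  exact h g

theorem Represents.modesTauL_eq {m : ℕ} {v : Fin m → HalfPhase c} {r : Fin m → ℝ}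
    {f : HalfPhase c} (h : Represents v r f) : modesTauL c (combine v r) = modesTauL c f := by
  rw [← sub_eq_zero, ← map_sub]
  exact modesTauL_eq_zero h.symplecticBilin_sub

theorem Represents.waveModes_eq {m : ℕ} {v : Fin m → HalfPhase c} {r : Fin m → ℝ}
    {f : HalfPhase c} (h : Represents v r f) : waveModes c (combine v r) = waveModes c f := by
  rw [← sub_eq_zero, ← map_sub]
  exact waveModes_eq_zero (modesTauL_eq_zero h.symplecticBilin_sub)

end Weights

/-! ### The quadratic forms of finitely many modes and their limits -/

section Forms

open Matrix

variable {X : Type*} [MeasurableSpace X] {S : NullHorizon X} {c : NullCoordinate S} {m : ℕ}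

/-- The bilinear form `t Re ⟪L f, L g⟫` of a real-linear map `L` into the one-particle space. -/
def reForm (t : ℝ) (L : HalfPhase c →ₗ[ℝ] Lp ℂ 2 (modeMeasure S.μ)) :
    LinearMap.BilinForm ℝ (HalfPhase c) :=
  LinearMap.mk₂ ℝ (fun f g => t * (inner ℂ (L f) (L g)).re)
    (fun f f' g => by
      simp only [map_add, inner_add_left, Complex.add_re]; ring)
    (fun r f g => by
      simp only [map_smul, smul_eq_mul]
      rw [real_smul_Lp, inner_smul_left, conj_ofReal, Complex.re_ofReal_mul]; ring)
    (fun f g g' => by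
      simp only [map_add, inner_add_right, Complex.add_re]; ring)
    (fun r f g => by
      simp only [map_smul, smul_eq_mul]
      rw [real_smul_Lp, inner_smul_right, Complex.re_ofReal_mul]; ring)

theorem reForm_self (t : ℝ) (L : HalfPhase c →ₗ[ℝ] Lp ℂ 2 (modeMeasure S.μ)) (f : HalfPhase c) :
    reForm t L f f = t * ‖L f‖ ^ 2 := by
  change t * (inner ℂ (L f) (L f)).re = _
  rw [inner_self_ofReal, ofReal_re]

/-- The matrix `Ω(vᵢ, vⱼ)`. -/
def symplecticMatrix (v : Fin m → HalfPhase c) : Matrix (Fin m) (Fin m) ℝ :=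
  of fun i j => symplecticBilin c (v i) (v j)

/-- The matrix `t Re ⟪L vᵢ, L vⱼ⟫`. -/
def gramMatrix (t : ℝ) (L : HalfPhase c →ₗ[ℝ] Lp ℂ 2 (modeMeasure S.μ))
    (v : Fin m → HalfPhase c) : Matrix (Fin m) (Fin m) ℝ :=
  of fun i j => reForm t L (v i) (v j)

theorem gramMatrix_form (t : ℝ) (L : HalfPhase c →ₗ[ℝ] Lp ℂ 2 (modeMeasure S.μ))
    (v : Fin m → HalfPhase c) (r : Fin m → ℝ) :
    r ⬝ᵥ gramMatrix t L v *ᵥ r = t * ‖L (combine v r)‖ ^ 2 := by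
  rw [gramMatrix, dotProduct_bilin, reForm_self]

theorem gramMatrix_isHermitian (t : ℝ) (L : HalfPhase c →ₗ[ℝ] Lp ℂ 2 (modeMeasure S.μ))
    (v : Fin m → HalfPhase c) : (gramMatrix t L v).IsHermitian := by
  refine Matrix.ext fun i j => ?_
  change t * (inner ℂ (L (v j)) (L (v i))).re = t * (inner ℂ (L (v i)) (L (v j))).re
  rw [← inner_conj_symm, Complex.conj_re]

theorem gramMatrix_posSemidef {t : ℝ} (ht : 0 ≤ t)
    (L : HalfPhase c →ₗ[ℝ] Lp ℂ 2 (modeMeasure S.μ)) (v : Fin m → HalfPhase c) :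
    (gramMatrix t L v).PosSemidef :=
  .of_dotProduct_mulVec_nonneg (gramMatrix_isHermitian t L v) fun r => by
    rw [star_trivial, gramMatrix_form]; positivity

/-- The matrix of `2‖waveModes f‖²`, the exponent of the vacuum wavefunctional. -/
def waveMatrix (v : Fin m → HalfPhase c) : Matrix (Fin m) (Fin m) ℝ :=
  gramMatrix 2 (waveModes c) v

/-- The exponent of the symplectic Fourier transform of the vacuum wavefunctional. -/
def dualMatrix (v : Fin m → HalfPhase c) : Matrix (Fin m) (Fin m) ℝ :=
  (1 / 4 : ℝ) • (symplecticMatrix v * (waveMatrix v)⁻¹ * (symplecticMatrix v)ᵀ)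

/-- The exponent of the vacuum matrix element of the Weyl quantization. -/
def weylMatrix (v : Fin m → HalfPhase c) : Matrix (Fin m) (Fin m) ℝ :=
  dualMatrix v + gramMatrix (1 / 2) (modesTauL c) v

theorem waveMatrix_posDef {v : Fin m → HalfPhase c} (hv : IsSymplecticFrame v) :
    (waveMatrix v).PosDef := by
  refine .of_dotProduct_mulVec_pos (gramMatrix_isHermitian _ _ v) fun r hr => ?_
  rw [star_trivial, waveMatrix, gramMatrix_form]
  have h : waveModes c (combine v r) ≠ 0 := by
    intro h0
    refine hr (isSymplecticFrame_iff.1 hv r fun j => ?_)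
    rw [symplecticBilin_apply, symplecticForm_eq_im, modesTauL_eq (combine v r), h0]
    simp
  have := norm_pos_iff.2 h
  positivity

theorem dualMatrix_form (v : Fin m → HalfPhase c) (r : Fin m → ℝ) :
    r ⬝ᵥ dualMatrix v *ᵥ r = ((r ᵥ* symplecticMatrix v) ⬝ᵥ (waveMatrix v)⁻¹ *ᵥ
      (r ᵥ* symplecticMatrix v)) / 4 := by
  rw [dualMatrix, smul_mulVec, dotProduct_smul, ← mulVec_mulVec, ← mulVec_mulVec,
    dotProduct_mulVec, mulVec_transpose, smul_eq_mul]
  ring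

theorem dualMatrix_posDef {v : Fin m → HalfPhase c} (hv : IsSymplecticFrame v) :
    (dualMatrix v).PosDef := by
  have hJ : IsUnit (symplecticMatrix v) :=
    (isUnit_iff_isUnit_det _).2 (IsUnit.mk0 _ hv)
  have h := (waveMatrix_posDef hv).inv.mul_mul_conjTranspose_same
    (vecMul_injective_iff_isUnit.2 hJ)
  rw [conjTranspose_eq_transpose_of_trivial] at h
  exact h.smul (by norm_num)

theorem weylMatrix_posDef {v : Fin m → HalfPhase c} (hv : IsSymplecticFrame v) :
    (weylMatrix v).PosDef :=
  (dualMatrix_posDef hv).add_posSemidef (gramMatrix_posSemidef (by norm_num) _ v)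

theorem vecMul_symplecticMatrix (v : Fin m → HalfPhase c) (r s : Fin m → ℝ) :
    (r ᵥ* symplecticMatrix v) ⬝ᵥ s = symplecticBilin c (combine v r) (combine v s) := by
  rw [← dotProduct_mulVec, symplecticMatrix, dotProduct_bilin]

theorem le_dualMatrix {v : Fin m → HalfPhase c} (hv : IsSymplecticFrame v) (r s : Fin m → ℝ) :
    symplecticBilin c (combine v r) (combine v s) - 2 * ‖waveModes c (combine v s)‖ ^ 2 ≤
      r ⬝ᵥ dualMatrix v *ᵥ r := by
  rw [dualMatrix_form, ← gramMatrix_form 2, ← vecMul_symplecticMatrix]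
  exact le_form_inv (waveMatrix_posDef hv) _ s

/-- The symplectic form in terms of the weighted modes. -/
theorem symplecticBilin_eq_weighted (f g : HalfPhase c) : symplecticBilin c f g =
    2 * (inner ℂ ((sqrtTanh X).toCLM (modesTauL c f)) (waveModes c g)).im := by
  rw [symplecticBilin_apply, symplecticForm_eq_im, modesTauL_eq g, Multiplier.inner_toCLM_left,
    sqrtTanh, conj_frequencyMultiplier]

theorem dualMatrix_le {v : Fin m → HalfPhase c} (hv : IsSymplecticFrame v) (r : Fin m → ℝ) :
    r ⬝ᵥ dualMatrix v *ᵥ r ≤ ‖(sqrtTanh X).toCLM (modesTauL c (combine v r))‖ ^ 2 / 2 := by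
  obtain ⟨s, hs⟩ := exists_form_inv_eq (waveMatrix_posDef hv) (r ᵥ* symplecticMatrix v)
  rw [dualMatrix_form, hs, vecMul_symplecticMatrix, waveMatrix, gramMatrix_form,
    symplecticBilin_eq_weighted]
  set a := (sqrtTanh X).toCLM (modesTauL c (combine v r))
  set d := waveModes c (combine v s)
  have h1 : (inner ℂ a d).im ≤ ‖a‖ * ‖d‖ :=
    (Complex.abs_im_le_norm _ |> (le_abs_self _).trans).trans (norm_inner_le_norm a d)
  nlinarith [sq_nonneg (‖a‖ - 2 * ‖d‖)]

/-- The linear term `Re ⟪modesTau vᵢ, y⟫`. -/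
def response (v : Fin m → HalfPhase c) (y : Lp ℂ 2 (modeMeasure S.μ)) (i : Fin m) : ℝ :=
  (inner ℂ (modesTauL c (v i)) y).re

theorem response_dotProduct (v : Fin m → HalfPhase c) (y : Lp ℂ 2 (modeMeasure S.μ))
    (r : Fin m → ℝ) : response v y ⬝ᵥ r = (inner ℂ (modesTauL c (combine v r)) y).re := by
  have h : ∀ i, (inner ℂ (r i • modesTauL c (v i)) y).re =
      (inner ℂ (modesTauL c (v i)) y).re * r i := fun i => by
    rw [real_smul_Lp, inner_smul_left, conj_ofReal, Complex.re_ofReal_mul, mul_comm]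
  simp only [combine, map_sum, map_smul, sum_inner, Complex.re_sum, h]
  rfl

theorem response_add (v : Fin m → HalfPhase c) (y z : Lp ℂ 2 (modeMeasure S.μ)) :
    response v (y + z) = response v y + response v z := by
  funext i
  simp [response, inner_add_right]

theorem le_weylForm {v : Fin m → HalfPhase c} (hv : IsSymplecticFrame v)
    (y : Lp ℂ 2 (modeMeasure S.μ)) (r : Fin m → ℝ) :
    (inner ℂ (modesTauL c (combine v r)) y).re -
        ‖(sqrtTanh X).toCLM (modesTauL c (combine v r))‖ ^ 2 / 2 -
        ‖modesTauL c (combine v r)‖ ^ 2 / 2 ≤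
      response v y ⬝ᵥ (weylMatrix v)⁻¹ *ᵥ response v y / 4 := by
  refine le_trans ?_ (le_form_inv (weylMatrix_posDef hv) _ r)
  rw [response_dotProduct, weylMatrix, add_mulVec, dotProduct_add, gramMatrix_form]
  linarith [dualMatrix_le hv r]

/-- The dual bound: the exponent of the wavefunctional bounds its Legendre transform. -/
theorem weylForm_le {v : Fin m → HalfPhase c} (hv : IsSymplecticFrame v)
    (y : Lp ℂ 2 (modeMeasure S.μ)) (s : Fin m → ℝ) :
    response v y ⬝ᵥ (weylMatrix v)⁻¹ *ᵥ response v y / 4 ≤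
      ‖y + (2 * I) • modesTauL c (combine v s)‖ ^ 2 / 2 + 2 * ‖waveModes c (combine v s)‖ ^ 2 := by
  obtain ⟨r, hr⟩ := exists_form_inv_eq (weylMatrix_posDef hv) (response v y)
  rw [hr, response_dotProduct, weylMatrix, add_mulVec, dotProduct_add, gramMatrix_form]
  have h1 := le_dualMatrix hv r s
  rw [symplecticBilin_apply, symplecticForm_eq_im] at h1
  set a := modesTauL c (combine v r)
  set b := modesTauL c (combine v s)
  have h2 : (inner ℂ a (y + (2 * I) • b)).re = (inner ℂ a y).re - 2 * (inner ℂ a b).im := by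
    rw [inner_add_right, inner_smul_right, Complex.add_re, Complex.mul_re]
    simp
    ring
  have h3 : (inner ℂ a (y + (2 * I) • b)).re ≤ ‖a‖ * ‖y + (2 * I) • b‖ :=
    (Complex.abs_re_le_norm _ |> (le_abs_self _).trans).trans (norm_inner_le_norm a _)
  nlinarith [sq_nonneg (‖a‖ - ‖y + (2 * I) • b‖)]

theorem exists_weightedModes_mem {w : ℝ → ℝ} (hw : IsWeight c w) (hpos : ∀ Ω, 0 < Ω → 0 < w Ω)
    {U : Set (Lp ℂ 2 (modeMeasure S.μ))} (hU : IsOpen U) {y : Lp ℂ 2 (modeMeasure S.μ)}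
    (hy : y ∈ U) : ∃ s, weightedModes hw s ∈ U := by
  obtain ⟨ε, hε, h⟩ := Metric.isOpen_iff.1 hU y hy
  obtain ⟨s, hs⟩ := exists_weightedModes_near hw hpos y hε
  exact ⟨s, h (by rwa [Metric.mem_ball, dist_eq_norm])⟩

theorem waveWeight_pos (Ω : ℝ) (hΩ : 0 < Ω) : 0 < waveWeight Ω :=
  Real.sqrt_pos.2 (coth_pos (half_pos (mul_pos Real.pi_pos hΩ)))

theorem sqrtTanh_apply (p : ℝ × X) : (sqrtTanh X).1 p =
    (√((1 - Real.exp (-(π * |p.1|))) / (1 + Real.exp (-(π * |p.1|)))) : ℝ) := rfl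

theorem sqrtOneSub_apply (p : ℝ × X) : (sqrtOneSub X).1 p =
    (√(1 - Real.exp (-(π * |p.1|)) ^ 2) : ℝ) := rfl

theorem boltzmann_apply (p : ℝ × X) : (boltzmann X).1 p = (Real.exp (-(π * |p.1|)) : ℝ) := rfl

theorem sqrtTanh_sq (y : Lp ℂ 2 (modeMeasure S.μ)) :
    (sqrtTanh X).toCLM ((sqrtTanh X).toCLM (y + (boltzmann X).toCLM y)) =
      y - (boltzmann X).toCLM y := by
  refine Lp.ext ?_
  filter_upwards [(sqrtTanh X).coeFn_toCLM ((sqrtTanh X).toCLM (y + (boltzmann X).toCLM y)),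
    (sqrtTanh X).coeFn_toCLM (y + (boltzmann X).toCLM y), (boltzmann X).coeFn_toCLM y,
    Lp.coeFn_add y ((boltzmann X).toCLM y), Lp.coeFn_sub y ((boltzmann X).toCLM y)]
    with p h1 h2 h3 h4 h5
  rw [h1, h2, h4, h5, Pi.add_apply, Pi.sub_apply, h3, sqrtTanh_apply, boltzmann_apply]
  have h0 := boltzmann_pos p.1
  have h6 := boltzmann_le_one p.1
  set e := Real.exp (-(π * |p.1|))
  have h7 : ((√((1 - e) / (1 + e)) : ℝ) : ℂ) * (√((1 - e) / (1 + e)) : ℝ) =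
      (1 - e : ℂ) / (1 + e) := by
    rw [← ofReal_mul, Real.mul_self_sqrt (div_nonneg (by linarith) (by linarith))]
    push_cast; ring
  have h8 : (1 + e : ℂ) ≠ 0 := by
    have : 1 + e ≠ 0 := by positivity
    exact_mod_cast this
  rw [← mul_assoc, h7]
  field_simp

theorem sqrtTanh_sqrtOneSub (y : Lp ℂ 2 (modeMeasure S.μ)) :
    (sqrtTanh X).toCLM ((sqrtOneSub X).toCLM y) = y - (boltzmann X).toCLM y := by
  refine Lp.ext ?_
  filter_upwards [(sqrtTanh X).coeFn_toCLM ((sqrtOneSub X).toCLM y),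
    (sqrtOneSub X).coeFn_toCLM y, (boltzmann X).coeFn_toCLM y,
    Lp.coeFn_sub y ((boltzmann X).toCLM y)] with p h1 h2 h3 h5
  rw [h1, h2, h5, Pi.sub_apply, h3, sqrtTanh_apply, sqrtOneSub_apply, boltzmann_apply]
  have h0 := boltzmann_pos p.1
  have h6 := boltzmann_le_one p.1
  set e := Real.exp (-(π * |p.1|))
  have h7 : √((1 - e) / (1 + e)) * √(1 - e ^ 2) = 1 - e := by
    rw [← Real.sqrt_mul (div_nonneg (by linarith) (by linarith)),
      show (1 - e) / (1 + e) * (1 - e ^ 2) = (1 - e) ^ 2 by field_simp; ring,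
      Real.sqrt_sq (by linarith)]
  rw [← mul_assoc, ← ofReal_mul, h7]
  push_cast; ring

theorem sqrtOneSub_sq (y : Lp ℂ 2 (modeMeasure S.μ)) :
    (sqrtOneSub X).toCLM ((sqrtOneSub X).toCLM y) =
      y - (boltzmann X).toCLM ((boltzmann X).toCLM y) := by
  refine Lp.ext ?_
  filter_upwards [(sqrtOneSub X).coeFn_toCLM ((sqrtOneSub X).toCLM y),
    (sqrtOneSub X).coeFn_toCLM y, (boltzmann X).coeFn_toCLM ((boltzmann X).toCLM y),
    (boltzmann X).coeFn_toCLM y,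
    Lp.coeFn_sub y ((boltzmann X).toCLM ((boltzmann X).toCLM y))] with p h1 h2 h3 h4 h5
  rw [h1, h2, h5, Pi.sub_apply, h3, h4, sqrtOneSub_apply, boltzmann_apply]
  have h0 := boltzmann_pos p.1
  have h6 := boltzmann_le_one p.1
  set e := Real.exp (-(π * |p.1|))
  rw [← mul_assoc, ← ofReal_mul, Real.mul_self_sqrt (by nlinarith)]
  push_cast; ring

theorem norm_sq_frequencyMultiplier {b : ℝ → ℝ} {hb : Measurable b} {h0 : ∀ Ω, 0 ≤ b Ω}
    {h1 : ∀ Ω, b Ω ≤ 1} (y : Lp ℂ 2 (modeMeasure S.μ)) :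
    ‖(frequencyMultiplier X b hb h0 h1).toCLM y‖ ^ 2 = (inner ℂ y
      ((frequencyMultiplier X b hb h0 h1).toCLM ((frequencyMultiplier X b hb h0 h1).toCLM y))).re := by
  rw [← ofReal_re (‖_‖ ^ 2), ← inner_self_ofReal, Multiplier.inner_toCLM_left,
    conj_frequencyMultiplier]

/-- The limit of the quadratic form of the Weyl quantization as the set of modes grows: it lies
between two dual variational problems whose common optimal value is `⟪y, (1 + e^{-πΩ}) y⟫ / 4`,
attained at `(1 + e^{-πΩ}) y / 2` and at `i √(1 - e^{-2πΩ}) y / 4`. -/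
theorem tendsto_weylForm (y : Lp ℂ 2 (modeMeasure S.μ)) :
    Filter.Tendsto (fun V : Σ m : ℕ, Fin m → HalfPhase c =>
      response V.2 y ⬝ᵥ (weylMatrix V.2)⁻¹ *ᵥ response V.2 y / 4) (frameFilter c)
      (nhds ((‖y‖ ^ 2 + (inner ℂ y ((boltzmann X).toCLM y)).re) / 4)) := by
  set E := (boltzmann X).toCLM y with hE
  rw [tendsto_order]
  constructor
  · intro l hl
    let F : Lp ℂ 2 (modeMeasure S.μ) → ℝ := fun x =>
      (inner ℂ x y).re - ‖(sqrtTanh X).toCLM x‖ ^ 2 / 2 - ‖x‖ ^ 2 / 2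
    have hF : Continuous F := by
      have : Continuous fun x : Lp ℂ 2 (modeMeasure S.μ) => (inner ℂ x y).re :=
        Complex.continuous_re.comp (continuous_id.inner continuous_const)
      fun_prop
    have hopt : F ((1 / 2 : ℂ) • (y + E)) = (‖y‖ ^ 2 + (inner ℂ y E).re) / 4 := by
      have h1 : ‖(sqrtTanh X).toCLM (y + E)‖ ^ 2 = (inner ℂ (y + E) (y - E)).re := by
        rw [sqrtTanh, norm_sq_frequencyMultiplier, ← sqrtTanh_sq]; rfl
      have h2 : ‖y + E‖ ^ 2 = (inner ℂ (y + E) (y + E)).re := by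
        rw [inner_self_ofReal, ofReal_re]
      have h3 : ∀ x : Lp ℂ 2 (modeMeasure S.μ), ‖(1 / 2 : ℂ) • x‖ ^ 2 = ‖x‖ ^ 2 / 4 := by
        intro x; rw [norm_smul]; norm_num; ring
      have h4 : ‖y‖ ^ 2 = (inner ℂ y y).re := by rw [inner_self_ofReal, ofReal_re]
      have h5 : (inner ℂ E y).re = (inner ℂ y E).re := by
        rw [← inner_conj_symm, Complex.conj_re]
      have h6 : (inner ℂ ((1 / 2 : ℂ) • (y + E)) y).re = (inner ℂ (y + E) y).re / 2 := by
        rw [inner_smul_left, show (starRingEnd ℂ) (1 / 2 : ℂ) = ((1 / 2 : ℝ) : ℂ) by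
          rw [show (1 / 2 : ℂ) = ((1 / 2 : ℝ) : ℂ) by norm_num, conj_ofReal],
          Complex.re_ofReal_mul]
        ring
      simp only [F, map_smul]
      rw [h3, h3, h1, h2, h6, h4]
      simp only [inner_add_left, inner_add_right, inner_sub_right, Complex.add_re, Complex.sub_re,
        h5]
      ring
    obtain ⟨f, hf⟩ := exists_weightedModes_mem (isWeight_one c) (fun _ _ => one_pos)
      (isOpen_lt continuous_const hF) (show l < F ((1 / 2 : ℂ) • (y + E)) by rwa [hopt])
    filter_upwards [eventually_represents f] with V hV
    obtain ⟨hV, r, hr⟩ := hV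
    refine lt_of_lt_of_le hf (le_trans (le_of_eq ?_) (le_weylForm hV y r))
    rw [hr.modesTauL_eq]; rfl
  · intro l hl
    let F : Lp ℂ 2 (modeMeasure S.μ) → ℝ := fun x =>
      ‖y + (2 * I) • (sqrtTanh X).toCLM x‖ ^ 2 / 2 + 2 * ‖x‖ ^ 2
    have hF : Continuous F := by fun_prop
    have hopt : F ((I / 4) • (sqrtOneSub X).toCLM y) = (‖y‖ ^ 2 + (inner ℂ y E).re) / 4 := by
      have h1 : ‖(sqrtOneSub X).toCLM y‖ ^ 2 = ‖y‖ ^ 2 - ‖E‖ ^ 2 := by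
        rw [sqrtOneSub, norm_sq_frequencyMultiplier]
        change (inner ℂ y ((sqrtOneSub X).toCLM ((sqrtOneSub X).toCLM y))).re = _
        rw [sqrtOneSub_sq, hE, boltzmann, norm_sq_frequencyMultiplier, inner_sub_right,
          Complex.sub_re, inner_self_ofReal, ofReal_re]
      have h2 : y + (2 * I) • (sqrtTanh X).toCLM ((I / 4) • (sqrtOneSub X).toCLM y) =
          (1 / 2 : ℂ) • (y + E) := by
        rw [map_smul, sqrtTanh_sqrtOneSub, smul_smul,
          show 2 * I * (I / 4) = -(1 / 2 : ℂ) by linear_combination (1 / 2 : ℂ) * I_mul_I, ← hE]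
        module
      have h3 : ‖(1 / 2 : ℂ) • (y + E)‖ ^ 2 = ‖y + E‖ ^ 2 / 4 := by
        rw [norm_smul]; norm_num; ring
      have h4 : ‖(I / 4) • (sqrtOneSub X).toCLM y‖ ^ 2 = ‖(sqrtOneSub X).toCLM y‖ ^ 2 / 16 := by
        rw [norm_smul]; norm_num; ring
      have h5 := re_inner_eq_norm_sq y E
      simp only [F]
      rw [h2, h3, h4, h1, h5]
      ring
    obtain ⟨f, hf⟩ := exists_weightedModes_mem (isWeight_waveWeight c) waveWeight_pos
      (isOpen_lt hF continuous_const) (show F ((I / 4) • (sqrtOneSub X).toCLM y) < l by rwa [hopt])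
    filter_upwards [eventually_represents f] with V hV
    obtain ⟨hV, s, hs⟩ := hV
    refine lt_of_le_of_lt ((weylForm_le hV y s).trans (le_of_eq ?_)) hf
    rw [hs.modesTauL_eq, hs.waveModes_eq, modesTauL_eq]; rfl

/-- The limit of the exponent of the symplectic Fourier transform of the vacuum wavefunctional. -/
theorem exists_finset_dualMatrix (f : HalfPhase c) {ε : ℝ} (hε : 0 < ε) :
    ∃ F : Finset (HalfPhase c), ∀ (m : ℕ) (v : Fin m → HalfPhase c), IsSymplecticFrame v →
      Contains v F → ∀ s, Represents v s f →
        |s ⬝ᵥ dualMatrix v *ᵥ s - ‖(sqrtTanh X).toCLM (modesTauL c f)‖ ^ 2 / 2| < ε := by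
  set a := (sqrtTanh X).toCLM (modesTauL c f) with ha
  let F : Lp ℂ 2 (modeMeasure S.μ) → ℝ := fun x => 2 * (inner ℂ a x).im - 2 * ‖x‖ ^ 2
  have hF : Continuous F := by
    have : Continuous fun x : Lp ℂ 2 (modeMeasure S.μ) => (inner ℂ a x).im :=
      Complex.continuous_im.comp (continuous_const.inner continuous_id)
    fun_prop
  -- the supremum over the unrestricted modes is attained at `i a / 2`
  have hopt : F ((I / 2) • a) = ‖a‖ ^ 2 / 2 := by
    simp only [F]
    rw [inner_smul_right, inner_self_ofReal, norm_smul, show I / 2 * ((‖a‖ ^ 2 : ℝ) : ℂ) =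
      ((‖a‖ ^ 2 / 2 : ℝ) : ℂ) * I by push_cast; ring, Complex.im_ofReal_mul, I_im]
    norm_num
    ring
  obtain ⟨g, hg⟩ := exists_weightedModes_mem (isWeight_waveWeight c) waveWeight_pos
    (isOpen_lt continuous_const hF)
    (show ‖a‖ ^ 2 / 2 - ε < F ((I / 2) • a) by rw [hopt]; linarith)
  refine ⟨{g}, fun m v hv hF s hs => ?_⟩
  obtain ⟨r, hr⟩ := hF g (Finset.mem_singleton_self g)
  have h1 := dualMatrix_le hv s
  have h2 := le_dualMatrix hv s r
  rw [symplecticBilin_eq_weighted, hs.modesTauL_eq, hr.waveModes_eq] at h2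
  rw [hs.modesTauL_eq] at h1
  have h3 : ‖a‖ ^ 2 / 2 - ε < 2 * (inner ℂ a (waveModes c g)).im - 2 * ‖waveModes c g‖ ^ 2 := hg
  rw [← ha] at h1 h2
  rw [abs_lt]
  constructor <;> linarith

end Forms

/-! ### The vacuum wavefunctional and its Wigner–Weyl transform -/

section Wave

open Matrix

variable {X : Type*} [MeasurableSpace X] {S : NullHorizon X} {c : NullCoordinate S} {m : ℕ}

theorem norm_sq_add_smul (x y : Lp ℂ 2 (modeMeasure S.μ)) (t : ℝ) :
    ‖x + t • y‖ ^ 2 = ‖x‖ ^ 2 + t * (2 * (inner ℂ y x).re) + t ^ 2 * ‖y‖ ^ 2 := by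
  have h := re_inner_eq_norm_sq x ((t : ℂ) • y)
  rw [inner_smul_right, Complex.re_ofReal_mul, ← inner_conj_symm, Complex.conj_re, norm_smul,
    Complex.norm_real, mul_pow, Real.norm_eq_abs, sq_abs] at h
  rw [real_smul_Lp]
  linarith

theorem isVacuumWavefunctional_exp (c : NullCoordinate S) : IsVacuumWavefunctional
    fun f : HalfPhase c => ((Real.exp (-(2 * ‖waveModes c f‖ ^ 2)) : ℝ) : ℂ) := by
  refine ⟨fun h => ?_, fun h f => ?_⟩
  · have := congrFun h 0
    simp at this
  · have h1 : HasDerivAt (fun t : ℝ => -(2 * ‖waveModes c (f + t • h)‖ ^ 2))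
        (-(sinePairing h f)) 0 := by
      simp only [map_add, map_smul, norm_sq_add_smul, sinePairing_eq]
      set R := (inner ℂ (waveModes c h) (waveModes c f)).re
      have h2 := (((((hasDerivAt_id (0 : ℝ)).mul_const (2 * R)).const_add
        (‖waveModes c f‖ ^ 2)).add (((hasDerivAt_id (0 : ℝ)).pow 2).mul_const
        (‖waveModes c h‖ ^ 2))).const_mul 2).neg
      refine h2.congr_deriv ?_
      simp only [id_eq]
      ring
    have h3 := h1.exp.ofReal_comp
    refine ⟨h3.differentiableAt, ?_⟩
    rw [h3.deriv]
    simp only [zero_smul, add_zero]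
    push_cast
    ring

/-- Every vacuum wavefunctional is a Gaussian, `Ψ[φ] = Ψ[0] exp(-½ ∫ g²)`. -/
theorem IsVacuumWavefunctional.eq {Ψ : HalfPhase c → ℂ} (h : IsVacuumWavefunctional Ψ)
    (f : HalfPhase c) : Ψ f = Ψ 0 * (Real.exp (-(2 * ‖waveModes c f‖ ^ 2)) : ℝ) := by
  set q := ‖waveModes c f‖ ^ 2 with hq
  have hd : ∀ t : ℝ, HasDerivAt (fun t : ℝ => Ψ (t • f)) (-(4 * t * q : ℝ) * Ψ (t • f)) t := by
    intro t
    obtain ⟨h1, h2⟩ := h.2 f (t • f)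
    have h3 : deriv (fun s : ℝ => Ψ (t • f + s • f)) 0 = -(4 * t * q : ℝ) * Ψ (t • f) := by
      have h4 : I / √2 ≠ (0 : ℂ) := by
        refine div_ne_zero I_ne_zero ?_
        have : √2 ≠ (0 : ℝ) := by positivity
        exact_mod_cast this
      have h5 := (mul_eq_zero.1 h2).resolve_left h4
      have h6 : sinePairing f (t • f) = 4 * t * q := by
        rw [sinePairing_eq, map_smul, real_smul_Lp, inner_smul_right, inner_self_ofReal,
          ← ofReal_mul, ofReal_re, hq]
        ring
      rw [h6] at h5
      linear_combination h5
    have h7 := h1.hasDerivAt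
    rw [h3] at h7
    have h8 : HasDerivAt (fun s : ℝ => Ψ (t • f + (s - t) • f)) (-(4 * t * q : ℝ) * Ψ (t • f)) t :=
      HasDerivAt.comp_sub_const t t (by rwa [sub_self])
    refine h8.congr_of_eventuallyEq (Filter.Eventually.of_forall fun s => ?_)
    simp only
    rw [← add_smul]
    congr 2; ring
  have hg : ∀ t : ℝ, HasDerivAt (fun t : ℝ => Ψ (t • f) * (Real.exp (2 * q * t ^ 2) : ℝ)) 0 t := by
    intro t
    have h1 : HasDerivAt (fun t : ℝ => 2 * q * t ^ 2) (4 * t * q) t := by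
      refine (((hasDerivAt_id t).pow 2).const_mul (2 * q)).congr_deriv ?_
      simp only [id_eq]
      push_cast
      ring
    refine ((hd t).mul h1.exp.ofReal_comp).congr_deriv ?_
    push_cast
    ring
  have hconst := is_const_of_deriv_eq_zero (fun t => (hg t).differentiableAt)
    (fun t => (hg t).deriv) 1 0
  simp only [one_smul, zero_smul, one_pow, mul_one, zero_pow two_ne_zero, mul_zero, Real.exp_zero,
    ofReal_one] at hconst
  rw [← hconst, mul_assoc, ← ofReal_mul, ← Real.exp_add]
  simp

theorem IsVacuumWavefunctional.apply_zero_ne {Ψ : HalfPhase c → ℂ}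
    (h : IsVacuumWavefunctional Ψ) : Ψ 0 ≠ 0 := fun h0 =>
  h.1 (funext fun f => by rw [h.eq f, h0, zero_mul]; rfl)

/-- The symplectic Fourier transform of the vacuum wavefunctional is Gaussian. -/
theorem IsVacuumWavefunctional.exists_weylCoeff_eq {Ψ : HalfPhase c → ℂ}
    (h : IsVacuumWavefunctional Ψ) {v : Fin m → HalfPhase c} (hv : IsSymplecticFrame v) :
    ∃ κ : ℂ, κ ≠ 0 ∧ ∀ r, weylCoeff Ψ v r = κ * (Real.exp (-(r ⬝ᵥ dualMatrix v *ᵥ r)) : ℝ) := by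
  obtain ⟨Z, hZ, hG⟩ := integral_gaussian (waveMatrix_posDef hv)
  refine ⟨Ψ 0 * Z, mul_ne_zero h.apply_zero_ne (by exact_mod_cast hZ.ne'), fun r => ?_⟩
  set k : Fin m → ℝ := -(r ᵥ* symplecticMatrix v) with hk
  have h1 : ∀ s : Fin m → ℝ, Ψ (combine v s) *
      Complex.exp (-I * symplecticForm S (combine v r).1 (combine v s).1) =
      Ψ 0 * Complex.exp (-((s ⬝ᵥ waveMatrix v *ᵥ s : ℝ) : ℂ) +
        ∑ i, (((0 : Fin m → ℝ) i : ℂ) + k i * I) * s i) := by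
    intro s
    have h2 : ∑ i, (((0 : Fin m → ℝ) i : ℂ) + k i * I) * s i =
        -I * symplecticForm S (combine v r).1 (combine v s).1 := by
      rw [← symplecticBilin_apply, ← vecMul_symplecticMatrix]
      simp only [dotProduct, ofReal_sum, Finset.mul_sum]
      refine Finset.sum_congr rfl fun i _ => ?_
      simp only [hk, Pi.zero_apply, Pi.neg_apply]
      push_cast
      ring
    rw [h.eq, h2, Complex.exp_add, waveMatrix, gramMatrix_form]
    push_cast
    ring
  rw [weylCoeff]
  simp only [h1]
  rw [integral_const_mul, hG, complexForm_add_mul_I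
    (transpose_eq_of_posDef (waveMatrix_posDef hv).inv), dualMatrix_form, hk]
  simp only [mulVec_neg, neg_dotProduct_neg, zero_dotProduct, mul_zero, zero_sub]
  push_cast
  rw [mul_assoc]
  congr 3
  ring

/-- The matrix elements of the Weyl quantization of the vacuum wavefunctional. -/
theorem IsVacuumWavefunctional.exists_weylQuantization_eq {Ψ : HalfPhase c → ℂ}
    (h : IsVacuumWavefunctional Ψ) {v : Fin m → HalfPhase c} (hv : IsSymplecticFrame v) :
    ∃ κ : ℂ, κ ≠ 0 ∧ ∀ z w, weylQuantization Ψ v z w = κ * Complex.exp (inner ℂ z w +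
      complexForm (weylMatrix v)⁻¹
        (fun i => (response v (w - z) i : ℂ) + response v (-I • (w + z)) i * I) / 4) := by
  obtain ⟨κ, hκ, hc⟩ := h.exists_weylCoeff_eq hv
  obtain ⟨Z, hZ, hG⟩ := integral_gaussian (weylMatrix_posDef hv)
  refine ⟨κ * Z, mul_ne_zero hκ (by exact_mod_cast hZ.ne'), fun z w => ?_⟩
  set k : Fin m → ℂ := fun i => (response v (w - z) i : ℂ) + response v (-I • (w + z)) i * I
    with hk
  have h1 : ∀ r : Fin m → ℝ, weylCoeff Ψ v r *
      inner ℂ (expVec z) (weylTau (combine v r) (expVec w)) =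
      κ * Complex.exp (inner ℂ z w) *
        Complex.exp (-((r ⬝ᵥ weylMatrix v *ᵥ r : ℝ) : ℂ) + ∑ i, k i * r i) := by
    intro r
    have h2 : ∑ i, k i * r i = inner ℂ (modesTauL c (combine v r)) w -
        inner ℂ z (modesTauL c (combine v r)) := by
      have h3 : ∑ i, k i * r i = ((response v (w - z) ⬝ᵥ r : ℝ) : ℂ) +
          ((response v (-I • (w + z)) ⬝ᵥ r : ℝ) : ℂ) * I := by
        simp only [hk, dotProduct, ofReal_sum, Finset.sum_mul, ← Finset.sum_add_distrib]
        refine Finset.sum_congr rfl fun i _ => ?_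
        push_cast; ring
      rw [h3, response_dotProduct, response_dotProduct]
      set a := modesTauL c (combine v r)
      have hre : (inner ℂ z a).re = (inner ℂ a z).re := by
        rw [← inner_conj_symm, Complex.conj_re]
      have him : (inner ℂ z a).im = -(inner ℂ a z).im := by
        rw [← inner_conj_symm, Complex.conj_im]
      rw [inner_sub_right, inner_smul_right, inner_add_right]
      apply Complex.ext <;> simp [hre, him]
    rw [hc, weylTau, ← modesTauL_apply, inner_expVec_fockWeyl, h2, weylMatrix, add_mulVec,
      dotProduct_add, gramMatrix_form, ofReal_exp, mul_assoc, mul_assoc, ← Complex.exp_add,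
      ← Complex.exp_add]
    congr 2
    push_cast
    ring
  rw [weylQuantization]
  simp only [h1]
  rw [integral_const_mul, hG, Complex.exp_add]
  ring

/-- The Gaussian exponents in the matrix elements converge. -/
theorem tendsto_complexForm (z w : Lp ℂ 2 (modeMeasure S.μ)) :
    Filter.Tendsto (fun V : Σ m : ℕ, Fin m → HalfPhase c =>
      inner ℂ z w + complexForm (weylMatrix V.2)⁻¹ (fun i => (response V.2 (w - z) i : ℂ) +
        response V.2 (-I • (w + z)) i * I) / 4) (frameFilter c)
      (nhds (-inner ℂ z ((boltzmann X).toCLM w))) := by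
  set y₁ := w - z with hy₁
  set y₂ := -I • (w + z) with hy₂
  let q : Lp ℂ 2 (modeMeasure S.μ) → (Σ m : ℕ, Fin m → HalfPhase c) → ℝ := fun y V =>
    response V.2 y ⬝ᵥ (weylMatrix V.2)⁻¹ *ᵥ response V.2 y / 4
  let L : Lp ℂ 2 (modeMeasure S.μ) → ℝ := fun y =>
    (‖y‖ ^ 2 + (inner ℂ y ((boltzmann X).toCLM y)).re) / 4
  have hlim : Filter.Tendsto (fun V => inner ℂ z w + (((q y₁ V - q y₂ V : ℝ) : ℂ) +
      ((q (y₁ + y₂) V - q y₁ V - q y₂ V : ℝ) : ℂ) * I)) (frameFilter c)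
      (nhds (inner ℂ z w + (((L y₁ - L y₂ : ℝ) : ℂ) +
        ((L (y₁ + y₂) - L y₁ - L y₂ : ℝ) : ℂ) * I))) := by
    have h1 := tendsto_weylForm (c := c) y₁
    have h2 := tendsto_weylForm (c := c) y₂
    have h3 := tendsto_weylForm (c := c) (y₁ + y₂)
    refine tendsto_const_nhds.add (Filter.Tendsto.add ?_ (Filter.Tendsto.mul_const _ ?_))
    · exact (Complex.continuous_ofReal.tendsto _).comp (h1.sub h2)
    · exact (Complex.continuous_ofReal.tendsto _).comp ((h3.sub h1).sub h2)
  have hval : inner ℂ z w + (((L y₁ - L y₂ : ℝ) : ℂ) +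
      ((L (y₁ + y₂) - L y₁ - L y₂ : ℝ) : ℂ) * I) = -inner ℂ z ((boltzmann X).toCLM w) := by
    have hs : ∀ x y : Lp ℂ 2 (modeMeasure S.μ), inner ℂ x ((boltzmann X).toCLM y) =
        (starRingEnd ℂ) (inner ℂ y ((boltzmann X).toCLM x)) := by
      intro x y
      rw [inner_conj_symm, Multiplier.inner_toCLM_left, boltzmann, conj_frequencyMultiplier]
    have hn : ∀ x : Lp ℂ 2 (modeMeasure S.μ), ‖x‖ ^ 2 = (inner ℂ x x).re := fun x => by
      rw [inner_self_ofReal, ofReal_re]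
    have hLdef : ∀ y, L y = ((inner ℂ y y).re + (inner ℂ y ((boltzmann X).toCLM y)).re) / 4 :=
      fun y => by rw [← hn]
    simp only [hLdef, hy₁, hy₂, map_add, map_sub, map_smul, inner_add_left, inner_add_right,
      inner_sub_left, inner_sub_right, inner_smul_left, inner_smul_right]
    have h1 : (inner ℂ w z).re = (inner ℂ z w).re := by rw [← inner_conj_symm, Complex.conj_re]
    have h2 : (inner ℂ w z).im = -(inner ℂ z w).im := by rw [← inner_conj_symm, Complex.conj_im]
    have h3 := congrArg Complex.re (hs w z)
    have h4 := congrArg Complex.im (hs w z)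
    rw [Complex.conj_re] at h3
    rw [Complex.conj_im] at h4
    apply Complex.ext
    · simp [h1, h2, h3, h4]
      ring
    · simp [h1, h2, h3, h4]
      ring
  rw [← hval]
  refine hlim.congr' ?_
  filter_upwards [eventually_isSymplecticFrame c] with V hV
  have ht := transpose_eq_of_posDef (weylMatrix_posDef hV).inv
  rw [complexForm_add_mul_I ht]
  congr 1
  simp only [q, response_add, form_add ht]
  push_cast
  ring

/-- The function `-e^{-πΩ}` of the frequency. -/
def negBoltzmann (X : Type*) [MeasurableSpace X] : Multiplier (ℝ × X) :=
  ⟨fun p => -(boltzmann X).1 p, (boltzmann X).2.1.neg, fun p => by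
    rw [norm_neg]; exact (boltzmann X).2.2 p⟩

theorem negBoltzmann_toCLM (w : Lp ℂ 2 (modeMeasure S.μ)) :
    (negBoltzmann X).toCLM w = -(boltzmann X).toCLM w := by
  refine Lp.ext ?_
  filter_upwards [(negBoltzmann X).coeFn_toCLM w, (boltzmann X).coeFn_toCLM w,
    Lp.coeFn_neg ((boltzmann X).toCLM w)] with p h1 h2 h3
  rw [h1, h3, Pi.neg_apply, h2, negBoltzmann, neg_mul]

theorem IsVacuumWavefunctional.tendsto_weylQuantization {Ψ : HalfPhase c → ℂ}
    (h : IsVacuumWavefunctional Ψ) (z w : Lp ℂ 2 (modeMeasure S.μ)) :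
    Filter.Tendsto (fun V : Σ m : ℕ, Fin m → HalfPhase c =>
      (weylQuantization Ψ V.2 0 0)⁻¹ * weylQuantization Ψ V.2 z w) (frameFilter c)
      (nhds (inner ℂ (expVec z) ((negBoltzmann X).secondQuantization (expVec w)))) := by
  have h1 := ((tendsto_complexForm (c := c) z w).sub (tendsto_complexForm (c := c) 0 0)).cexp
  have h2 : -inner ℂ z ((boltzmann X).toCLM w) -
      -inner ℂ (0 : Lp ℂ 2 (modeMeasure S.μ)) ((boltzmann X).toCLM 0) =
      inner ℂ z ((negBoltzmann X).toCLM w) := by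
    rw [negBoltzmann_toCLM, inner_zero_left, inner_neg_right, neg_zero, sub_zero]
  rw [h2] at h1
  rw [Multiplier.secondQuantization_expVec, inner_expVec]
  refine h1.congr' ?_
  filter_upwards [eventually_isSymplecticFrame c] with V hV
  obtain ⟨κ, hκ, hq⟩ := h.exists_weylQuantization_eq hV
  rw [hq, hq, Complex.exp_sub]
  field_simp

theorem secondQuantization_negBoltzmann_ne_zero :
    (negBoltzmann X).secondQuantization (ν := modeMeasure S.μ) ≠ 0 := by
  intro h
  have h1 : inner ℂ (vac (ν := modeMeasure S.μ)) ((negBoltzmann X).secondQuantization vac) = 1 := by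
    rw [vac, Multiplier.secondQuantization_expVec, inner_expVec]
    simp
  rw [h] at h1
  simp at h1

theorem IsVacuumWavefunctional.exists_isWignerWeylTransform {Ψ : HalfPhase c → ℂ}
    (h : IsVacuumWavefunctional Ψ) :
    IsWignerWeylTransform Ψ ((negBoltzmann X).secondQuantization (ν := modeMeasure S.μ)) :=
  ⟨secondQuantization_negBoltzmann_ne_zero, fun _ v => (weylQuantization Ψ v 0 0)⁻¹, fun z w =>
    tendsto_frameFilter.1 (h.tendsto_weylQuantization z w)⟩

/-- Wigner–Weyl transforms are unique up to normalization. -/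
theorem IsVacuumWavefunctional.eq_of_isWignerWeylTransform {Ψ : HalfPhase c → ℂ}
    (h : IsVacuumWavefunctional Ψ) {A : HorizonFock S →L[ℂ] HorizonFock S}
    (hA : IsWignerWeylTransform Ψ A) :
    ∃ k : ℂ, k ≠ 0 ∧ A = k • (negBoltzmann X).secondQuantization := by
  obtain ⟨h0, N, hN⟩ := hA
  have hlim : ∀ z w, Filter.Tendsto (fun V : Σ m : ℕ, Fin m → HalfPhase c =>
      N V.1 V.2 * weylQuantization Ψ V.2 z w) (frameFilter c)
      (nhds (inner ℂ (expVec z) (A (expVec w)))) := fun z w => tendsto_frameFilter.2 (hN z w)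
  set k : ℂ := inner ℂ (expVec 0) (A (expVec 0)) with hk
  have hA : A = k • (negBoltzmann X).secondQuantization := by
    refine fock_ext_inner fun z w => ?_
    refine tendsto_nhds_unique (hlim z w) ?_
    rw [_root_.smul_apply, inner_smul_right]
    refine ((hlim 0 0).mul (h.tendsto_weylQuantization z w)).congr' ?_
    filter_upwards [eventually_isSymplecticFrame c] with V hV
    obtain ⟨κ, hκ, hq⟩ := h.exists_weylQuantization_eq hV
    have : weylQuantization Ψ V.2 0 0 ≠ 0 := by
      rw [hq]; exact mul_ne_zero hκ (Complex.exp_ne_zero _)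
    field_simp
  refine ⟨k, fun h1 => h0 ?_, hA⟩
  rw [hA, h1, zero_smul]

/-- The expectation values in the finite-mode density operators. -/
theorem IsVacuumWavefunctional.reducedExpectation_eq {Ψ : HalfPhase c → ℂ}
    (h : IsVacuumWavefunctional Ψ) {v : Fin m → HalfPhase c} (hv : IsSymplecticFrame v)
    (s : Fin m → ℝ) : reducedExpectation Ψ v s =
      (Real.exp (-((s ⬝ᵥ dualMatrix v *ᵥ s) / 2 + ‖waveModes c (combine v s)‖ ^ 2 / 4)) : ℝ) := by
  obtain ⟨κ, hκ, hc⟩ := h.exists_weylCoeff_eq hv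
  have hD := dualMatrix_posDef hv
  have hDt := transpose_eq_of_posDef hD
  have h2D : ((2 : ℝ) • dualMatrix v).PosDef := hD.smul two_pos
  obtain ⟨Z, hZ, hG⟩ := integral_gaussian h2D
  set P := s ⬝ᵥ dualMatrix v *ᵥ s with hP
  set k₁ : Fin m → ℝ := (-2 : ℝ) • (dualMatrix v *ᵥ s) with hk₁
  set k₂ : Fin m → ℝ := (-(1 / 2) : ℝ) • (s ᵥ* symplecticMatrix v) with hk₂
  have hnum : ∀ r : Fin m → ℝ, weylCoeff Ψ v r * (starRingEnd ℂ) (weylCoeff Ψ v (r + s)) *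
      Complex.exp (-I * symplecticForm S (combine v s).1 (combine v r).1 / 2) =
      κ * (starRingEnd ℂ) κ * Complex.exp (-P) *
        Complex.exp (-((r ⬝ᵥ ((2 : ℝ) • dualMatrix v) *ᵥ r : ℝ) : ℂ) +
          ∑ i, ((k₁ i : ℂ) + k₂ i * I) * r i) := by
    intro r
    have h2 : ∑ i, ((k₁ i : ℂ) + k₂ i * I) * r i = ((-2 * (r ⬝ᵥ dualMatrix v *ᵥ s) : ℝ) : ℂ) -
        I * symplecticForm S (combine v s).1 (combine v r).1 / 2 := by
      have h3 : ∑ i, ((k₁ i : ℂ) + k₂ i * I) * r i = ((k₁ ⬝ᵥ r : ℝ) : ℂ) +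
          ((k₂ ⬝ᵥ r : ℝ) : ℂ) * I := by
        simp only [dotProduct, ofReal_sum, Finset.sum_mul, ← Finset.sum_add_distrib]
        refine Finset.sum_congr rfl fun i _ => ?_
        push_cast; ring
      rw [h3, hk₁, hk₂, smul_dotProduct, smul_dotProduct, vecMul_symplecticMatrix,
        dotProduct_comm _ r, symplecticBilin_apply]
      simp only [smul_eq_mul]
      push_cast; ring
    rw [hc, hc, map_mul, conj_ofReal, h2, form_add hDt, ← hP, smul_mulVec, dotProduct_smul,
      smul_eq_mul, ofReal_exp, ofReal_exp]
    rw [show ∀ x y z w t : ℂ, x * y * (z * w) * t = x * z * (y * w * t) by intros; ring,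
      ← Complex.exp_add, ← Complex.exp_add, mul_assoc (κ * _) (Complex.exp (-P)),
      ← Complex.exp_add]
    congr 2
    push_cast
    ring
  have hden : ∀ r : Fin m → ℝ, weylCoeff Ψ v r * (starRingEnd ℂ) (weylCoeff Ψ v r) =
      κ * (starRingEnd ℂ) κ *
        Complex.exp (-((r ⬝ᵥ ((2 : ℝ) • dualMatrix v) *ᵥ r : ℝ) : ℂ) +
          ∑ i, (0 : Fin m → ℂ) i * r i) := by
    intro r
    rw [hc, map_mul, conj_ofReal, smul_mulVec, dotProduct_smul, smul_eq_mul, ofReal_exp]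
    rw [show ∀ x y z : ℂ, x * y * (z * y) = x * z * (y * y) by intros; ring, ← Complex.exp_add]
    congr 2
    simp
    ring
  have hform : complexForm ((2 : ℝ) • dualMatrix v)⁻¹ (fun i => (k₁ i : ℂ) + k₂ i * I) =
      ((2 * P - ‖waveModes c (combine v s)‖ ^ 2 : ℝ) : ℂ) := by
    have hJ : IsUnit (symplecticMatrix v).det := hv.isUnit
    have hM : IsUnit (waveMatrix v).det :=
      (isUnit_iff_isUnit_det _).1 (waveMatrix_posDef hv).isUnit
    -- the vectors whose images under the inverse matrix are needed
    have hinv : ∀ x : Fin m → ℝ,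
        ((2 : ℝ) • dualMatrix v)⁻¹ *ᵥ (((2 : ℝ) • dualMatrix v) *ᵥ x) = x := fun x => by
      rw [mulVec_mulVec, nonsing_inv_mul _ ((isUnit_iff_isUnit_det _).1 h2D.isUnit), one_mulVec]
    have e1 : k₁ = ((2 : ℝ) • dualMatrix v) *ᵥ (-s) := by
      rw [hk₁, smul_mulVec, mulVec_neg, smul_neg, neg_smul]
    have hskew : (symplecticMatrix v)ᵀ = -symplecticMatrix v := by
      ext i j
      exact symplecticBilin_swap _ _
    set x₂ : Fin m → ℝ := -((symplecticMatrix v)ᵀ⁻¹ *ᵥ (waveMatrix v *ᵥ s)) with hx₂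
    have hJt : IsUnit ((symplecticMatrix v)ᵀ).det := by rwa [det_transpose]
    have e2 : k₂ = ((2 : ℝ) • dualMatrix v) *ᵥ (-x₂) := by
      rw [hk₂, hx₂, neg_neg, dualMatrix, smul_mulVec, smul_mulVec, smul_smul, ← mulVec_mulVec,
        ← mulVec_mulVec, mulVec_mulVec _ _ ((symplecticMatrix v)ᵀ⁻¹), mul_nonsing_inv _ hJt,
        one_mulVec, mulVec_mulVec _ _ (waveMatrix v), nonsing_inv_mul _ hM, one_mulVec,
        ← mulVec_transpose, hskew, neg_mulVec]
      ext i
      simp only [Pi.smul_apply, Pi.neg_apply, smul_eq_mul]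
      ring
    rw [complexForm_add_mul_I (transpose_eq_of_posDef h2D.inv)]
    have f1 : k₁ ⬝ᵥ ((2 : ℝ) • dualMatrix v)⁻¹ *ᵥ k₁ = 2 * P := by
      rw [e1, hinv, ← e1, hk₁, smul_dotProduct, dotProduct_neg, dotProduct_comm, ← hP]
      simp
    have f2 : k₁ ⬝ᵥ ((2 : ℝ) • dualMatrix v)⁻¹ *ᵥ k₂ = 0 := by
      rw [dotProduct_mulVec_symm (transpose_eq_of_posDef h2D.inv), e1, hinv, hk₂, smul_dotProduct,
        dotProduct_neg, vecMul_symplecticMatrix, symplecticBilin_self]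
      simp
    have f3 : k₂ ⬝ᵥ ((2 : ℝ) • dualMatrix v)⁻¹ *ᵥ k₂ = ‖waveModes c (combine v s)‖ ^ 2 := by
      have f4 : k₂ ⬝ᵥ ((2 : ℝ) • dualMatrix v)⁻¹ *ᵥ k₂ = k₂ ⬝ᵥ (-x₂) := by
        conv_lhs => rw [e2, hinv, ← e2]
      have f5 : (s ᵥ* symplecticMatrix v) ⬝ᵥ x₂ = 2 * ‖waveModes c (combine v s)‖ ^ 2 := by
        rw [← dotProduct_mulVec, ← gramMatrix_form, hx₂,
          show symplecticMatrix v = -(symplecticMatrix v)ᵀ by rw [hskew, neg_neg], neg_mulVec,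
          transpose_neg, transpose_transpose, ← hskew, mulVec_neg, neg_neg, mulVec_mulVec,
          mul_nonsing_inv _ hJt, one_mulVec]
        rfl
      rw [f4, hk₂, smul_dotProduct, dotProduct_neg, f5, smul_eq_mul]
      ring
    rw [f1, f2, f3]
    simp
  rw [reducedExpectation]
  simp only [hnum, hden]
  rw [integral_const_mul, integral_const_mul, hG, hG, hform]
  have h0 : complexForm ((2 : ℝ) • dualMatrix v)⁻¹ (0 : Fin m → ℂ) = 0 := by simp [complexForm]
  have hκ' : (starRingEnd ℂ) κ ≠ 0 := by simpa using hκ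
  have hZ' : (Z : ℂ) ≠ 0 := by exact_mod_cast hZ.ne'
  rw [h0, zero_div, Complex.exp_zero, mul_one,
    show ∀ x y : ℂ, κ * (starRingEnd ℂ) κ * x * (Z * y) / (κ * (starRingEnd ℂ) κ * Z) = x * y by
      intro x y; field_simp, ← Complex.exp_add, ofReal_exp]
  congr 1
  push_cast
  ring

end Wave

/-! ### Functions of the number operator and of the Hamiltonian -/

section Functions

variable {X : Type*} [MeasurableSpace X] {S : NullHorizon X} {c : NullCoordinate S}

theorem IsFunctionOfNH.const_smul {n : ℕ → ℝ → ℂ} {A : HorizonFock S →L[ℂ] HorizonFock S}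
    (h : IsFunctionOfNH n A) (k : ℂ) : IsFunctionOfNH (fun j E => k * n j E) (k • A) := by
  intro ψ j
  have h1 : (((k • A) ψ).1.1 j : (Fin j → ℝ × X) → ℂ) =ᵐ[Measure.pi fun _ : Fin j =>
      modeMeasure S.μ] k • ((A ψ).1.1 j : (Fin j → ℝ × X) → ℂ) := Lp.coeFn_smul k ((A ψ).1.1 j)
  filter_upwards [h1, h ψ j] with p h2 h3
  rw [h2, Pi.smul_apply, h3, smul_eq_mul, mul_assoc]

theorem IsFunctionOfNH.mul {n n' : ℕ → ℝ → ℂ} {A B : HorizonFock S →L[ℂ] HorizonFock S}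
    (h : IsFunctionOfNH n A) (h' : IsFunctionOfNH n' B) :
    IsFunctionOfNH (fun j E => n j E * n' j E) (A * B) := by
  intro ψ j
  filter_upwards [h (B ψ) j, h' ψ j] with p h2 h3
  rw [mul_apply_eq_comp, h2, h3, mul_assoc]

theorem isFunctionOfNH_phase (t : ℝ) :
    IsFunctionOfNH (S := S) (fun _ E => Complex.exp (I * t * E))
      (phase X t).secondQuantization := by
  intro ψ j
  filter_upwards [(phase X t).coeFn_secondQuantization ψ j] with p hp
  rw [hp]
  congr 1
  change ∏ i, Complex.exp (I * t * (p i).1) = _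
  rw [← Complex.exp_sum, ofReal_sum, Finset.mul_sum]

theorem isFunctionOfNH_negBoltzmann :
    IsFunctionOfNH (S := S) (fun j E => (-1) ^ j * Real.exp (-π * E))
      (negBoltzmann X).secondQuantization := by
  intro ψ j
  filter_upwards [(negBoltzmann X).coeFn_secondQuantization ψ j,
    ae_coordinates (modeMeasure_ae_pos S.μ) j] with p hp hpos
  rw [hp]
  congr 1
  have h1 : ∀ i, (negBoltzmann X).1 (p i) = -1 * (Real.exp (-π * (p i).1) : ℝ) := fun i => by
    change -((Real.exp (-(π * |(p i).1|)) : ℝ) : ℂ) = _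
    rw [abs_of_pos (hpos i)]
    ring_nf
  simp only [h1]
  rw [Finset.prod_mul_distrib, Finset.prod_const, Finset.card_univ, Fintype.card_fin,
    ← ofReal_prod, ← Real.exp_sum, Finset.mul_sum]

theorem conj_negBoltzmann : (negBoltzmann X).conj = negBoltzmann X := by
  refine Subtype.ext (funext fun p => ?_)
  change (starRingEnd ℂ) (-((Real.exp (-(π * |p.1|)) : ℝ) : ℂ)) = -((Real.exp (-(π * |p.1|)) : ℝ) : ℂ)
  rw [map_neg, conj_ofReal]

/-- The translations of `τ` are implemented by the second quantization of the phases `e^{itΩ}`. -/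
theorem phase_mul_weylTau_mul_phase (t : ℝ) (f : HalfPhase c) :
    (phase X t).secondQuantization * weylTau f * (phase X (-t)).secondQuantization =
      weylTau (translate t f) := by
  rw [weylTau, weylTau, modesTau_translate,
    ← Multiplier.secondQuantization_conj_fockWeyl _ (norm_phase t), conj_phase]

/-- The density operator of the restricted state. -/
theorem isFunctionOfNH_density (k : ℂ) :
    IsFunctionOfNH (S := S) (fun _ E => (‖k‖ ^ 2 * Real.exp (-2 * π * E) : ℝ))
      ((k • (negBoltzmann X).secondQuantization) *
        ContinuousLinearMap.adjoint (k • (negBoltzmann X).secondQuantization)) := by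
  have h := (isFunctionOfNH_negBoltzmann (S := S)).const_smul k
  have h' := (isFunctionOfNH_negBoltzmann (S := S)).const_smul ((starRingEnd ℂ) k)
  have hadj : ContinuousLinearMap.adjoint
      (k • (negBoltzmann X).secondQuantization (ν := modeMeasure S.μ)) =
      (starRingEnd ℂ) k • (negBoltzmann X).secondQuantization := by
    rw [map_smulₛₗ, Multiplier.adjoint_secondQuantization, conj_negBoltzmann]
  rw [hadj]
  convert h.mul h' using 3 with j E
  have h1 : ((-1 : ℂ) ^ j) * (-1) ^ j = 1 := by rw [← mul_pow]; simp
  have h2 : Real.exp (-2 * π * E) = Real.exp (-π * E) * Real.exp (-π * E) := by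
    rw [← Real.exp_add]; ring_nf
  rw [h2]
  push_cast
  linear_combination (-(Complex.exp (-π * E) * Complex.exp (-π * E)) * (‖k‖ : ℂ) ^ 2) * h1 +
    (-(Complex.exp (-π * E) * Complex.exp (-π * E)) * ((-1 : ℂ) ^ j * (-1) ^ j)) *
      Complex.mul_conj' k

end Functions

/-! ### The vacuum state on the half-horizon -/

section Thermal

variable {X : Type*} [MeasurableSpace X] {S : NullHorizon X} {c : NullCoordinate S}

theorem vacuumState_weylU (f : HalfPhase c) : vacuumState (weylU f.toFull) =
    Real.exp (-(‖vacuumModes c f‖ ^ 2 / 2)) := by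
  rw [vacuumState, weylU, inner_vac_fockWeyl, norm_sq_modesU]
  push_cast
  rfl

theorem IsVacuumWavefunctional.exists_reducedExpectation_near {Ψ : HalfPhase c → ℂ}
    (h : IsVacuumWavefunctional Ψ) (f : HalfPhase c) {ε : ℝ} (hε : 0 < ε) :
    ∃ F : Finset (HalfPhase c), ∀ (m : ℕ) (v : Fin m → HalfPhase c), IsSymplecticFrame v →
      Contains v F → ∀ s : Fin m → ℝ, Represents v s f →
        ‖reducedExpectation Ψ v s - vacuumState (weylU f.toFull)‖ < ε := by
  let q : ℝ → ℝ := fun P => Real.exp (-(P / 2 + ‖waveModes c f‖ ^ 2 / 4))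
  have hq : Continuous q := by fun_prop
  obtain ⟨δ, hδ, hlim⟩ := Metric.continuousAt_iff.1
    (hq.continuousAt (x := ‖(sqrtTanh X).toCLM (modesTauL c f)‖ ^ 2 / 2)) ε hε
  obtain ⟨F, hF⟩ := exists_finset_dualMatrix f hδ
  refine ⟨F, fun m v hv hc s hs => ?_⟩
  have h1 := hlim (x := dotProduct s ((dualMatrix v).mulVec s)) (hF m v hv hc s hs)
  rw [h.reducedExpectation_eq hv, hs.waveModes_eq, vacuumState_weylU, norm_sq_vacuumModes,
    ← ofReal_sub, Complex.norm_real]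
  rw [Real.dist_eq] at h1
  refine lt_of_eq_of_lt ?_ h1
  simp only [q, Real.norm_eq_abs]
  congr 4
  ring

theorem vacuumState_weylU_eq_thermal (f : HalfPhase c) : vacuumState (weylU f.toFull) =
    Real.exp (-(1 / 2) * ∫ p, (1 + 2 / (Real.exp (2 * π * p.1) - 1)) * ‖modesTau f p‖ ^ 2
      ∂(modeMeasure S.μ)) := by
  rw [vacuumState_weylU, norm_sq_eq_integral]
  have h : ∫ p, ‖vacuumModes c f p‖ ^ 2 ∂(modeMeasure S.μ) =
      ∫ p, (1 + 2 / (Real.exp (2 * π * p.1) - 1)) * ‖modesTau f p‖ ^ 2 ∂(modeMeasure S.μ) := by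
    refine integral_congr_ae ?_
    filter_upwards [(isWeight_vacuumWeight c f).coeFn_toLp,
      (memLp_amplitude (tauField f).2).coeFn_toLp, modeMeasure_ae_pos S.μ] with p h1 h2 h3
    rw [show vacuumModes c f p = _ from h1, show modesTau f p = _ from h2, norm_mul, mul_pow,
      Complex.norm_real, Real.norm_eq_abs, sq_abs]
    congr 1
    have hx : 0 < π * p.1 := mul_pos Real.pi_pos h3
    rw [vacuumWeight, Real.sq_sqrt (coth_pos hx).le, coth_eq hx]
    have he : Real.exp (-(π * p.1)) ^ 2 = (Real.exp (2 * π * p.1))⁻¹ := by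
      rw [← Real.exp_nat_mul, ← Real.exp_neg]; congr 1; push_cast; ring
    have h4 : 1 < Real.exp (2 * π * p.1) := Real.one_lt_exp_iff.2 (by linarith)
    have h5 : Real.exp (2 * π * p.1) - 1 ≠ 0 := by linarith
    rw [he]
    have h6 : 1 - (Real.exp (2 * π * p.1))⁻¹ ≠ 0 := by
      have := inv_lt_one_of_one_lt₀ h4
      linarith
    field_simp
    ring
  rw [h]
  congr 2
  ring

end Thermal

/-! ### The Kubo–Martin–Schwinger condition -/

section KMSIntegrand

variable {X : Type*}

/-- The integrand of the thermal two-point function at complex time `z`, for the product `k` of the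
amplitudes weighted by `coth(πΩ)`:
`(k e^{iΩz} + k^* e^{-2πΩ - iΩz}) / (1 + e^{-2πΩ})`. -/
def kmsIntegrand (k : ℝ × X → ℂ) (z : ℂ) (p : ℝ × X) : ℂ :=
  (k p * Complex.exp (I * p.1 * z) +
    (starRingEnd ℂ) (k p) * Complex.exp (-(2 * π * p.1) - I * p.1 * z)) /
      ((1 + Real.exp (-(2 * π * p.1)) : ℝ) : ℂ)

/-- The derivative of the integrand with respect to the time. -/
def kmsDeriv (k : ℝ × X → ℂ) (z : ℂ) (p : ℝ × X) : ℂ :=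
  (k p * (Complex.exp (I * p.1 * z) * (I * p.1)) +
    (starRingEnd ℂ) (k p) * (Complex.exp (-(2 * π * p.1) - I * p.1 * z) * -(I * p.1))) /
      ((1 + Real.exp (-(2 * π * p.1)) : ℝ) : ℂ)

theorem hasDerivAt_kmsIntegrand (k : ℝ × X → ℂ) (z : ℂ) (p : ℝ × X) :
    HasDerivAt (fun z => kmsIntegrand k z p) (kmsDeriv k z p) z := by
  have h1 : HasDerivAt (fun z : ℂ => I * p.1 * z) (I * p.1) z := by
    simpa using (hasDerivAt_id z).const_mul (I * (p.1 : ℂ))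
  have h2 : HasDerivAt (fun z : ℂ => -(2 * π * p.1) - I * p.1 * z : ℂ → ℂ) (-(I * p.1)) z :=
    h1.const_sub _
  exact ((h1.cexp.const_mul _).add (h2.cexp.const_mul _)).div_const _

theorem norm_exp_I_mul (Ω : ℝ) (z : ℂ) : ‖Complex.exp (I * Ω * z)‖ = Real.exp (-(Ω * z.im)) := by
  rw [Complex.norm_exp]
  congr 1
  simp [Complex.mul_re]

theorem norm_exp_sub_I_mul (Ω : ℝ) (z : ℂ) : ‖Complex.exp (-(2 * π * Ω) - I * Ω * z)‖ =
    Real.exp (-(Ω * (2 * π - z.im))) := by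
  rw [Complex.norm_exp]
  congr 1
  simp [Complex.mul_re]
  ring

theorem norm_kms_denominator (Ω : ℝ) : 1 ≤ ‖((1 + Real.exp (-(2 * π * Ω)) : ℝ) : ℂ)‖ := by
  have := Real.exp_pos (-(2 * π * Ω))
  rw [Complex.norm_real, Real.norm_eq_abs, abs_of_pos (by linarith)]
  linarith

theorem norm_kmsIntegrand_le (k : ℝ × X → ℂ) {z : ℂ} (h0 : 0 ≤ z.im) (h1 : z.im ≤ 2 * π)
    {p : ℝ × X} (hp : 0 < p.1) : ‖kmsIntegrand k z p‖ ≤ 2 * ‖k p‖ := by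
  rw [kmsIntegrand, norm_div]
  refine (div_le_self (norm_nonneg _) (norm_kms_denominator p.1)).trans ((norm_add_le _ _).trans ?_)
  rw [norm_mul, norm_mul, RCLike.norm_conj, norm_exp_I_mul, norm_exp_sub_I_mul]
  have e1 : Real.exp (-(p.1 * z.im)) ≤ 1 := Real.exp_le_one_iff.2 (by nlinarith)
  have e2 : Real.exp (-(p.1 * (2 * π - z.im))) ≤ 1 := Real.exp_le_one_iff.2 (by nlinarith)
  have := norm_nonneg (k p)
  nlinarith

theorem mul_exp_neg_le {x δ y : ℝ} (hx : 0 ≤ x) (hδ : 0 < δ) (hy : δ ≤ y) :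
    Real.exp (-(x * y)) * x ≤ δ⁻¹ := by
  have h1 : x * δ ≤ Real.exp (x * y) := by
    have := Real.add_one_le_exp (x * y)
    nlinarith
  rw [Real.exp_neg, inv_mul_le_iff₀ (Real.exp_pos _), ← div_eq_mul_inv, le_div_iff₀ hδ]
  exact h1

theorem norm_kmsDeriv_le (k : ℝ × X → ℂ) {z : ℂ} {δ : ℝ} (hδ : 0 < δ) (h0 : δ ≤ z.im)
    (h1 : δ ≤ 2 * π - z.im) {p : ℝ × X} (hp : 0 < p.1) :
    ‖kmsDeriv k z p‖ ≤ 2 * δ⁻¹ * ‖k p‖ := by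
  rw [kmsDeriv, norm_div]
  refine (div_le_self (norm_nonneg _) (norm_kms_denominator p.1)).trans ((norm_add_le _ _).trans ?_)
  simp only [norm_mul, norm_neg, RCLike.norm_conj, norm_exp_I_mul, norm_exp_sub_I_mul, norm_I,
    one_mul, Complex.norm_real, Real.norm_eq_abs, abs_of_pos hp]
  have e1 := mul_le_mul_of_nonneg_left (mul_exp_neg_le hp.le hδ h0) (norm_nonneg (k p))
  have e2 := mul_le_mul_of_nonneg_left (mul_exp_neg_le hp.le hδ h1) (norm_nonneg (k p))
  linarith

end KMSIntegrand

section KMS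

variable {X : Type*} [MeasurableSpace X] {S : NullHorizon X} {c : NullCoordinate S}

theorem aestronglyMeasurable_kmsIntegrand {k : ℝ × X → ℂ}
    (hk : AEStronglyMeasurable k (modeMeasure S.μ)) (z : ℂ) :
    AEStronglyMeasurable (kmsIntegrand k z) (modeMeasure S.μ) := by
  have h1 : Measurable fun p : ℝ × X => Complex.exp (I * p.1 * z) := by fun_prop
  have h2 : Measurable fun p : ℝ × X => Complex.exp (-(2 * π * p.1) - I * p.1 * z) := by fun_prop
  have h3 : Measurable fun p : ℝ × X => ((1 + Real.exp (-(2 * π * p.1)) : ℝ) : ℂ) := by fun_prop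
  exact ((hk.mul h1.aestronglyMeasurable).add
    ((Complex.continuous_conj.comp_aestronglyMeasurable hk).mul h2.aestronglyMeasurable)).mul
      h3.inv.aestronglyMeasurable

theorem aestronglyMeasurable_kmsDeriv {k : ℝ × X → ℂ}
    (hk : AEStronglyMeasurable k (modeMeasure S.μ)) (z : ℂ) :
    AEStronglyMeasurable (kmsDeriv k z) (modeMeasure S.μ) := by
  have h1 : Measurable fun p : ℝ × X => Complex.exp (I * p.1 * z) * (I * p.1) := by fun_prop
  have h2 : Measurable fun p : ℝ × X =>
      Complex.exp (-(2 * π * p.1) - I * p.1 * z) * -(I * p.1) := by fun_prop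
  have h3 : Measurable fun p : ℝ × X => ((1 + Real.exp (-(2 * π * p.1)) : ℝ) : ℂ) := by fun_prop
  exact ((hk.mul h1.aestronglyMeasurable).add
    ((Complex.continuous_conj.comp_aestronglyMeasurable hk).mul h2.aestronglyMeasurable)).mul
      h3.inv.aestronglyMeasurable

theorem continuousOn_integral_kms {k : ℝ × X → ℂ} (hk : Integrable k (modeMeasure S.μ)) :
    ContinuousOn (fun z => ∫ p, kmsIntegrand k z p ∂(modeMeasure S.μ))
      {z : ℂ | 0 ≤ z.im ∧ z.im ≤ 2 * π} := by
  refine continuousOn_of_dominated (bound := fun p => 2 * ‖k p‖)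
    (fun z _ => aestronglyMeasurable_kmsIntegrand hk.1 z) (fun z hz => ?_) (hk.norm.const_mul 2)
    (Filter.Eventually.of_forall fun p z _ =>
      (hasDerivAt_kmsIntegrand k z p).continuousAt.continuousWithinAt)
  filter_upwards [modeMeasure_ae_pos S.μ] with p hp using norm_kmsIntegrand_le k hz.1 hz.2 hp

theorem norm_integral_kms_le {k : ℝ × X → ℂ} (hk : Integrable k (modeMeasure S.μ)) {z : ℂ}
    (h0 : 0 ≤ z.im) (h1 : z.im ≤ 2 * π) :
    ‖∫ p, kmsIntegrand k z p ∂(modeMeasure S.μ)‖ ≤ ∫ p, 2 * ‖k p‖ ∂(modeMeasure S.μ) := by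
  refine norm_integral_le_of_norm_le (hk.norm.const_mul 2) ?_
  filter_upwards [modeMeasure_ae_pos S.μ] with p hp using norm_kmsIntegrand_le k h0 h1 hp

theorem differentiableOn_integral_kms {k : ℝ × X → ℂ} (hk : Integrable k (modeMeasure S.μ)) :
    DifferentiableOn ℂ (fun z => ∫ p, kmsIntegrand k z p ∂(modeMeasure S.μ))
      {z : ℂ | 0 < z.im ∧ z.im < 2 * π} := by
  intro z hz
  set δ := min z.im (2 * π - z.im) / 2 with hδ
  have hδ0 : 0 < δ := half_pos (lt_min hz.1 (by linarith [hz.2]))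
  have hU : {y : ℂ | δ < y.im ∧ δ < 2 * π - y.im} ∈ nhds z := by
    refine IsOpen.mem_nhds ?_ ⟨?_, ?_⟩
    · exact (isOpen_lt continuous_const Complex.continuous_im).inter
        (isOpen_lt continuous_const (continuous_const.sub Complex.continuous_im))
    · have := min_le_left z.im (2 * π - z.im); have := hz.1; linarith
    · have := min_le_right z.im (2 * π - z.im); have := hz.2; linarith
  have hint : Integrable (kmsIntegrand k z) (modeMeasure S.μ) := by
    refine (hk.norm.const_mul 2).mono' (aestronglyMeasurable_kmsIntegrand hk.1 z) ?_
    filter_upwards [modeMeasure_ae_pos S.μ] with p hp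
      using norm_kmsIntegrand_le k hz.1.le hz.2.le hp
  refine (hasDerivAt_integral_of_dominated_loc_of_deriv_le (F' := kmsDeriv k)
    (bound := fun p => 2 * δ⁻¹ * ‖k p‖) hU
    (Filter.Eventually.of_forall fun y => aestronglyMeasurable_kmsIntegrand hk.1 y) hint
    (aestronglyMeasurable_kmsDeriv hk.1 z) ?_ (hk.norm.const_mul _)
    (Filter.Eventually.of_forall fun p y _ => hasDerivAt_kmsIntegrand k y p)).2.differentiableAt
      |>.differentiableWithinAt
  filter_upwards [modeMeasure_ae_pos S.μ] with p hp y hy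
  exact norm_kmsDeriv_le k hδ0 hy.1.le hy.2.le hp

theorem integral_re_inner {α : Type*} [MeasurableSpace α] {ν : Measure α} (f g : Lp ℂ 2 ν) :
    ∫ p, (inner ℂ (f p) (g p)).re ∂ν = (inner ℂ f g).re := by
  rw [L2.inner_def]
  exact integral_re (L2.integrable_inner (𝕜 := ℂ) f g)

theorem integral_im_inner {α : Type*} [MeasurableSpace α] {ν : Measure α} (f g : Lp ℂ 2 ν) :
    ∫ p, (inner ℂ (f p) (g p)).im ∂ν = (inner ℂ f g).im := by
  rw [L2.inner_def]
  exact integral_im (L2.integrable_inner (𝕜 := ℂ) f g)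

/-- The boundary values of the thermal two-point function, for both signs `σ` of the commutator
term. -/
theorem integral_add_mul_I (f g : HalfPhase c) (t σ : ℝ) {K : ℝ × X → ℂ}
    (hK : ∀ᵐ p ∂(modeMeasure S.μ), K p =
      ((inner ℂ (vacuumModes c f p) (vacuumModes c (translate t g) p)).re : ℂ) +
        σ * (inner ℂ (modesTauL c f p) (modesTauL c (translate t g) p)).im * I) :
    ∫ p, K p ∂(modeMeasure S.μ) =
      ((inner ℂ (vacuumModes c f) (vacuumModes c (translate t g))).re : ℂ) +
        σ * (inner ℂ (modesTauL c f) (modesTauL c (translate t g))).im * I := by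
  rw [integral_congr_ae hK, integral_add, integral_mul_const, integral_const_mul,
    integral_complex_ofReal, integral_complex_ofReal, integral_re_inner, integral_im_inner]
  · exact (L2.integrable_inner (𝕜 := ℂ) (vacuumModes c f) (vacuumModes c (translate t g))).re.ofReal
  · exact ((L2.integrable_inner (𝕜 := ℂ) (modesTauL c f)
      (modesTauL c (translate t g))).im.ofReal.const_mul _).mul_const _

/-- The products of the amplitudes of `f` and of the translate of `g`, in terms of
`k = coth(πΩ) a_f^* a_g`. -/
theorem ae_inner_translate (f g : HalfPhase c) (t : ℝ) : ∀ᵐ p ∂(modeMeasure S.μ), 0 < p.1 ∧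
    inner ℂ (vacuumModes c f p) (vacuumModes c (translate t g) p) =
      inner ℂ (vacuumModes c f p) (vacuumModes c g p) * Complex.exp (I * t * p.1) ∧
    inner ℂ (modesTauL c f p) (modesTauL c (translate t g) p) =
      ((1 - Real.exp (-(2 * π * p.1))) / (1 + Real.exp (-(2 * π * p.1))) : ℝ) *
      (inner ℂ (vacuumModes c f p) (vacuumModes c g p) * Complex.exp (I * t * p.1)) := by
  have hv := weightedModes_translate (isWeight_vacuumWeight c) t g
  have ht := weightedModes_translate (isWeight_one c) t g
  filter_upwards [(isWeight_one c f).coeFn_toLp, (isWeight_one c g).coeFn_toLp,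
    (isWeight_vacuumWeight c f).coeFn_toLp, (isWeight_vacuumWeight c g).coeFn_toLp,
    (phase X t).coeFn_toCLM (vacuumModes c g), (phase X t).coeFn_toCLM (modesTauL c g),
    modeMeasure_ae_pos S.μ] with p h1 h2 h3 h4 h5 h6 h7
  rw [show vacuumModes c (translate t g) p = _ from
      (congrArg (fun x : Lp ℂ 2 (modeMeasure S.μ) => x p) hv).trans h5,
    show modesTauL c (translate t g) p = _ from
      (congrArg (fun x : Lp ℂ 2 (modeMeasure S.μ) => x p) ht).trans h6,
    show vacuumModes c f p = _ from h3, show vacuumModes c g p = _ from h4,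
    show modesTauL c f p = _ from h1, show modesTauL c g p = _ from h2]
  change _ ∧ inner ℂ _ (Complex.exp (I * t * p.1) * _) = _ ∧
    inner ℂ _ (Complex.exp (I * t * p.1) * _) = _
  have hx : 0 < π * p.1 := mul_pos Real.pi_pos h7
  have he : Real.exp (-(π * p.1)) ^ 2 = Real.exp (-(2 * π * p.1)) := by
    rw [← Real.exp_nat_mul]; congr 1; push_cast; ring
  have hq0 := Real.exp_pos (-(2 * π * p.1))
  have hq1 : Real.exp (-(2 * π * p.1)) < 1 := Real.exp_lt_one_iff.2 (by linarith)
  have hw : ((vacuumWeight p.1 : ℝ) : ℂ) * (vacuumWeight p.1 : ℝ) =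
      ((1 + Real.exp (-(2 * π * p.1))) / (1 - Real.exp (-(2 * π * p.1))) : ℝ) := by
    rw [← ofReal_mul, vacuumWeight, Real.mul_self_sqrt (coth_pos hx).le, coth_eq hx, he]
  have hr : (((1 - Real.exp (-(2 * π * p.1))) / (1 + Real.exp (-(2 * π * p.1))) : ℝ) : ℂ) *
      ((1 + Real.exp (-(2 * π * p.1))) / (1 - Real.exp (-(2 * π * p.1))) : ℝ) = 1 := by
    rw [← ofReal_mul, div_mul_div_comm, mul_comm (1 - _) _, div_self, ofReal_one]
    exact (mul_pos (by linarith) (by linarith)).ne'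
  refine ⟨h7, ?_, ?_⟩
  · simp only [RCLike.inner_apply]
    ring
  · simp only [RCLike.inner_apply, ofReal_one, one_mul, map_mul, conj_ofReal]
    rw [← hw] at hr
    linear_combination (-(Complex.exp (I * t * p.1) * amplitude (tauField g).1 p *
      (starRingEnd ℂ) (amplitude (tauField f).1 p))) * hr

theorem re_add_im_mul (x : ℂ) {q : ℝ} (hq : 0 < q) :
    (x + (starRingEnd ℂ) x * q) / ((1 + q : ℝ) : ℂ) =
      (x.re : ℂ) + (((1 - q) / (1 + q) * x.im : ℝ) : ℂ) * I := by
  have h : ((1 + q : ℝ) : ℂ) ≠ 0 := by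
    have : 1 + q ≠ 0 := by positivity
    exact_mod_cast this
  have h2 : (1 + q : ℂ) ≠ 0 := by simpa using h
  rw [div_eq_iff h]
  conv_lhs => rw [← Complex.re_add_im x]
  simp only [map_add, map_mul, conj_ofReal, conj_I]
  push_cast
  field_simp
  ring

theorem integral_kms_ofReal (f g : HalfPhase c) (t : ℝ) :
    ∫ p, kmsIntegrand (fun p => inner ℂ (vacuumModes c f p) (vacuumModes c g p)) t p
        ∂(modeMeasure S.μ) =
      inner ℂ (modesU f.toFull) (modesU (translate t g).toFull) := by
  rw [inner_modesU, ← modesTauL_apply, ← modesTauL_apply]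
  have h := integral_add_mul_I f g t 1
    (K := kmsIntegrand (fun p => inner ℂ (vacuumModes c f p) (vacuumModes c g p)) t) ?_
  · rw [h]; push_cast; ring
  filter_upwards [ae_inner_translate f g t] with p hp
  rw [hp.2.1, hp.2.2, Complex.im_ofReal_mul, ofReal_one, one_mul,
    ← re_add_im_mul _ (Real.exp_pos _), kmsIntegrand]
  set y := inner ℂ (vacuumModes c f p) (vacuumModes c g p)
  congr 2
  · ring_nf
  · rw [map_mul, ← Complex.exp_conj, mul_assoc ((starRingEnd ℂ) y), ofReal_exp, ← Complex.exp_add]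
    congr 2
    simp
    ring

theorem integral_kms_add_period (f g : HalfPhase c) (t : ℝ) :
    ∫ p, kmsIntegrand (fun p => inner ℂ (vacuumModes c f p) (vacuumModes c g p))
        (t + (2 * π : ℝ) * I) p ∂(modeMeasure S.μ) =
      inner ℂ (modesU (translate t g).toFull) (modesU f.toFull) := by
  rw [← inner_conj_symm, inner_modesU, ← modesTauL_apply, ← modesTauL_apply]
  have h := integral_add_mul_I f g t (-1)
    (K := kmsIntegrand (fun p => inner ℂ (vacuumModes c f p) (vacuumModes c g p))
      (t + (2 * π : ℝ) * I)) ?_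
  · rw [h]; simp
  filter_upwards [ae_inner_translate f g t] with p hp
  rw [hp.2.1, hp.2.2, Complex.im_ofReal_mul]
  set y := inner ℂ (vacuumModes c f p) (vacuumModes c g p) with hy
  set x := y * Complex.exp (I * t * p.1) with hx
  have h1 := re_add_im_mul ((starRingEnd ℂ) x) (Real.exp_pos (-(2 * π * p.1)))
  rw [Complex.conj_re, Complex.conj_im, Complex.conj_conj] at h1
  have h2 : ((-1 : ℝ) : ℂ) * (((1 - Real.exp (-(2 * π * p.1))) /
      (1 + Real.exp (-(2 * π * p.1))) * x.im : ℝ) : ℂ) * I =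
      (((1 - Real.exp (-(2 * π * p.1))) / (1 + Real.exp (-(2 * π * p.1))) * -x.im : ℝ) : ℂ) * I := by
    push_cast; ring
  rw [h2, ← h1, kmsIntegrand, ← hy, add_comm]
  congr 2
  · rw [hx, map_mul, ← Complex.exp_conj]
    congr 2
    simp
    linear_combination (-(2 * π * p.1 : ℂ)) * I_mul_I
  · rw [hx, mul_assoc y, ofReal_exp, ← Complex.exp_add]
    congr 2
    push_cast
    linear_combination (2 * π * p.1 : ℂ) * I_mul_I

theorem norm_modesU_translate (t : ℝ) (g : HalfPhase c) :
    ‖modesU (translate t g).toFull‖ ^ 2 = ‖vacuumModes c g‖ ^ 2 := by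
  rw [norm_sq_modesU, norm_sq_eq_integral, norm_sq_eq_integral]
  refine integral_congr_ae ?_
  filter_upwards [(phase X t).coeFn_toCLM (vacuumModes c g)] with p hp
  rw [show vacuumModes c (translate t g) p = _ from (congrArg
    (fun x : Lp ℂ 2 (modeMeasure S.μ) => x p)
    (weightedModes_translate (isWeight_vacuumWeight c) t g)).trans hp, norm_mul, norm_phase, one_mul]

/-- The vacuum state satisfies the KMS condition with respect to the translations of `τ`. -/
theorem isThermalState_vacuumState (c : NullCoordinate S) : IsThermalState vacuumState
    (fun f : HalfPhase c => weylU f.toFull) translate (1 / (2 * π)) := by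
  intro f g
  rw [one_div_one_div]
  set k : ℝ × X → ℂ := fun p => inner ℂ (vacuumModes c f p) (vacuumModes c g p) with hk
  have hki : Integrable k (modeMeasure S.μ) := L2.integrable_inner _ _
  set N : ℝ := ‖vacuumModes c f‖ ^ 2 / 2 + ‖vacuumModes c g‖ ^ 2 / 2 with hN
  refine ⟨fun z => Complex.exp (-(N : ℂ) - ∫ p, kmsIntegrand k z p ∂(modeMeasure S.μ)), ?_, ?_,
    ⟨Real.exp (-N + ∫ p, 2 * ‖k p‖ ∂(modeMeasure S.μ)), fun z h0 h1 => ?_⟩, fun t => ⟨?_, ?_⟩⟩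
  · exact (continuousOn_const.sub (continuousOn_integral_kms hki)).cexp
  · exact ((differentiableOn_const _).sub (differentiableOn_integral_kms hki)).cexp
  · rw [Complex.norm_exp]
    refine Real.exp_le_exp.2 ?_
    rw [Complex.sub_re, Complex.neg_re, ofReal_re, sub_eq_add_neg]
    refine add_le_add_right ?_ _
    exact (neg_le_abs _).trans ((Complex.abs_re_le_norm _).trans (norm_integral_kms_le hki h0 h1))
  · refine Eq.trans ?_ (inner_vac_fockWeyl_mul (modesU f.toFull) (modesU (translate t g).toFull)).symm
    beta_reduce
    rw [norm_modesU_translate, norm_sq_modesU, integral_kms_ofReal, hN]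
    congr 1
    push_cast
    ring
  · refine Eq.trans ?_ (inner_vac_fockWeyl_mul (modesU (translate t g).toFull) (modesU f.toFull)).symm
    beta_reduce
    rw [norm_modesU_translate, norm_sq_modesU, integral_kms_add_period, hN]
    congr 1
    push_cast
    ring

end KMS

end Unruh

end

theorem mainTheorem2 {X : Type*} [MeasurableSpace X] (S : Unruh.NullHorizon X)
    (c : Unruh.NullCoordinate S) :
    -- quantization of the horizon's and the half-horizon's phase space: Weyl relations
    (∀ f g : Unruh.FullPhase c, Unruh.weylU f * Unruh.weylU g =
      Complex.exp (-Complex.I * Unruh.symplecticForm S f.1 g.1 / 2) • Unruh.weylU (f + g)) ∧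
    (∀ f g : Unruh.HalfPhase c, Unruh.weylTau f * Unruh.weylTau g =
      Complex.exp (-Complex.I * Unruh.symplecticForm S f.1 g.1 / 2) • Unruh.weylTau (f + g)) ∧
    -- the Hamiltonian `H` generates the translations of `τ = ln u`
    (∃ U : ℝ → Unruh.HorizonFock S →L[ℂ] Unruh.HorizonFock S,
      (∀ t : ℝ, Unruh.IsFunctionOfNH (fun _ E => Complex.exp (Complex.I * t * E)) (U t)) ∧
      ∀ (t : ℝ) (f : Unruh.HalfPhase c),
        U t * Unruh.weylTau f * U (-t) = Unruh.weylTau (Unruh.translate t f)) ∧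
    -- the restriction recipe, applied to the vacuum wavefunctional
    (∃ Ψ : Unruh.HalfPhase c → ℂ, Unruh.IsVacuumWavefunctional Ψ) ∧
    (∀ Ψ : Unruh.HalfPhase c → ℂ, Unruh.IsVacuumWavefunctional Ψ →
      (∃ A, Unruh.IsWignerWeylTransform Ψ A) ∧
      (∀ A, Unruh.IsWignerWeylTransform Ψ A → ∃ k : ℂ, k ≠ 0 ∧
        Unruh.IsFunctionOfNH (fun n E => k * ((-1) ^ n * Real.exp (-Real.pi * E))) A ∧
        Unruh.IsFunctionOfNH (fun _ E => (‖k‖ ^ 2 * Real.exp (-2 * Real.pi * E) : ℝ))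
          (A * ContinuousLinearMap.adjoint A)) ∧
      -- the state given by the recipe is the restriction of the vacuum state
      ∀ f : Unruh.HalfPhase c, ∀ ε > 0, ∃ F : Finset (Unruh.HalfPhase c),
        ∀ (m : ℕ) (v : Fin m → Unruh.HalfPhase c),
          Unruh.IsSymplecticFrame v → Unruh.Contains v F →
          ∀ s : Fin m → ℝ, Unruh.Represents v s f →
            ‖Unruh.reducedExpectation Ψ v s -
              Unruh.vacuumState (Unruh.weylU f.toFull)‖ < ε) ∧
    -- this state is the thermal state at temperature `1/2π` with respect to `τ = ln u`
    (∀ f : Unruh.HalfPhase c, Unruh.vacuumState (Unruh.weylU f.toFull) =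
      Real.exp (-(1 / 2) * ∫ p, (1 + 2 / (Real.exp (2 * Real.pi * p.1) - 1)) *
        ‖Unruh.modesTau f p‖ ^ 2 ∂(Unruh.modeMeasure S.μ))) ∧
    Unruh.IsThermalState Unruh.vacuumState (fun f : Unruh.HalfPhase c => Unruh.weylU f.toFull)
      Unruh.translate (1 / (2 * Real.pi)) := by
  refine ⟨fun f g => ?_, fun f g => ?_, ⟨fun t => (Unruh.phase X t).secondQuantization,
    Unruh.isFunctionOfNH_phase, Unruh.phase_mul_weylTau_mul_phase⟩,
    ⟨_, Unruh.isVacuumWavefunctional_exp c⟩, fun Ψ hΨ =>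
      ⟨⟨_, hΨ.exists_isWignerWeylTransform⟩, fun A hA => ?_, fun f ε hε =>
        hΨ.exists_reducedExpectation_near f hε⟩,
    Unruh.vacuumState_weylU_eq_thermal, Unruh.isThermalState_vacuumState c⟩
  · rw [Unruh.weylU, Unruh.weylU, Unruh.fockWeyl_mul, Unruh.weylU, Unruh.modesU_add,
      Unruh.symplecticForm_eq_im_modesU]
    congr 2
    push_cast
    ring
  · rw [Unruh.weylTau, Unruh.weylTau, Unruh.fockWeyl_mul, Unruh.weylTau,
      Unruh.symplecticForm_eq_im_modesTau, ← Unruh.modesTauL_apply (f + g), map_add,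
      Unruh.modesTauL_apply, Unruh.modesTauL_apply]
    congr 2
    push_cast
    ring
  · obtain ⟨k, hk, rfl⟩ := hΨ.eq_of_isWignerWeylTransform hA
    exact ⟨k, hk, Unruh.isFunctionOfNH_negBoltzmann.const_smul k, Unruh.isFunctionOfNH_density k⟩
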